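/- **Setting.** Let $\zeta_1,\dots,\zeta_n$ be random variables on a probability space $(\Omega,\mathcal F,\mathbb P)$, let $g_i(x;\zeta_i)$, $x\in\mathbb R^d$, be the random cost of agent $i\in\mathcal V=\{1,\dots,n\}$, let $f_i(x)=\mathbb E[g_i(x;\zeta_i)]$ (assumed finite) and $f=\sum_{j=1}^n f_j$, and let $x^*$ be a minimizer of $f$. For each $k\ge 0$ let $\zeta_{i,k}$ be a copy of $\zeta_i$ (same law), such that the sample vectors $(\zeta_{1,k},\dots,\zeta_{n,k})$, $k=0,1,\dots$, are mutually independent and jointly independent of the (deterministic or random) initial values $x_{i,0}\in\mathbb R^d$. Given $n\times n$ weight matrices $\mathbf A=(a_{ij})$, $\mathbf B=(b_{ij})$ and step sizes $\alpha_k$, put $\nabla g_{i,k}=\nabla g_i(x_{i,k};\zeta_{i,k})$, $\nabla^2 g_{i,k}=\nabla^2 g_i(x_{i,k};\zeta_{i,k})$, $y_{i,0}=\nabla g_{i,0}$ and, for $k=0,1,\dots$, $$x_{i,k+1}=\sum_{j}a_{ij}x_{j,k}-\alpha_k y_{i,k},\qquad y_{i,k+1}=\sum_j b_{ij}y_{j,k}+\nabla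 g_{i,k+1}-\nabla g_{i,k}.$$ The distributed plug-in estimators are given by $u_{i,0}=e_i$ (the $i$-th unit vector of $\mathbb R^n$), $\mathbf S_{i,0}=\mathbf H_{i,0}=\mathbf 0$ and, for $k=1,2,\dots$, $u_{i,k}=\sum_j a_{ij}u_{j,k-1}$, $$\mathbf S_{i,k}=\frac{k}{k+1}\sum_j a_{ij}\mathbf S_{j,k-1}+\frac{\nabla g_{i,k}(\nabla g_{i,k}-\nabla g_{i,k-1})^\top+(\nabla g_{i,k}-\nabla g_{i,k-1})\nabla g_{i,k}^\top}{2(k+1)u_{i,k}(i)},\qquad \mathbf H_{i,k}=\frac{k}{k+1}\sum_j a_{ij}\mathbf H_{j,k-1}+\frac{\nabla^2 g_{i,k}}{(k+1)u_{i,k}(i)}.$$ **Theorem.** Assume the following. 1. (Objective) (i) $f$ is differentiable and $\mu$-strongly convex for some $\mu>0$: $f(y)\ge f(x)+\langle\nabla f(x),y-x\rangle+\frac\mu2\|x-y\|^2$ for all $x,y$. (ii) There is $c>0$ with $\|\nabla f(x)-\nabla^2 f(x^*)(x-x^*)\|\le c\|x-x^*\|^2$ for all $x\in\mathbb R^d$.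 (iii) For every $i$, $g_i(\cdot;\zeta_i)$ is differentiable and there are $p>2$, $U_1>0$ with $\mathbb E\|\nabla g_i(x;\zeta_i)-\nabla f_i(x)\|^p\le U_1^{p/2}$ for all $x$, and $\|\nabla g_i(x;\zeta_i)-\nabla g_i(y;\zeta_i)\|\le L_i(\zeta_i)\|x-y\|$ for all $x,y$, where $L_i(\zeta_i)>0$ and $\mathbb E[L_i(\zeta_i)^p]<\infty$. 2. (Weights) $\mathbf A,\mathbf B$ are entrywise nonnegative with positive diagonals, $\mathbf A\mathbf 1=\mathbf 1$ and $\mathbf 1^\top\mathbf B=\mathbf 1^\top$. For a nonnegative matrix $\mathbf M$ let $\mathcal G_{\mathbf M}$ be the directed graph on $\mathcal V$ with an edge $(j,i)$ iff $\mathbf M_{ij}>0$; some node is a root both of a spanning tree of $\mathcal G_{\mathbf A}$ and of a spanning tree of $\mathcal G_{\mathbf B^\top}$. Let $u,v$ be the nonnegative vectors with $u^\top\mathbf A=u^\top$, $u^\top\mathbf 1=n$, $\mathbf Bv=v$, $\mathbf 1^\top v=n$. 3. (Steps) $\alpha_k=a/(k+b)^\alpha$ with $\alpha\in(1/2,1)$,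 $a,b>0$ and $\frac{a}{b^\alpha}\le\min\{1,\frac{n}{u^\top v\,L}\}$, where $L=\max_i\sqrt{\mathbb E[L_i(\zeta_i)^2]}$. 4. $\mathcal G_{\mathbf A}$ is strongly connected. 5. $\mathrm{Cov}\big(\sum_j\nabla g_j(x^*;\zeta_j)\big)=\sum_j\mathrm{Cov}\big(\nabla g_j(x^*;\zeta_j)\big)$. 6. Each $g_i(\cdot;\zeta_i)$ is twice differentiable and, for every $i$, there are $L_1,L_2>0$ with $\mathbb E\|\nabla^2g_i(x;\zeta_i)-\nabla^2g_i(x^*;\zeta_i)\|\le L_1\|x-x^*\|$ for all $x$ and $\mathbb E\|\nabla^2g_i(x^*;\zeta_i)\|^2\le L_2$. Let $\mathbf H=\nabla^2f(x^*)$ and $\mathbf S=\mathrm{Cov}\big(\sum_j\nabla g_j(x^*;\zeta_j)\big)$. Then $\mathbf H$ is invertible and, for every agent $i\in\mathcal V$, $\mathbf H_{i,k}$ is invertible with probability tending to $1$ and $$\mathbf H_{i,k}^{-1}\mathbf S_{i,k}\mathbf H_{i,k}^{-1}\longrightarrow\mathbf H^{-1}\mathbf S\mathbf H^{-1}\quad\text{in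 probability as }k\to\infty$$ (with any convention for $\mathbf H_{i,k}^{-1}$ where $\mathbf H_{i,k}$ is singular). -/

import Mathlib

open MeasureTheory ProbabilityTheory Filter Topology
open scoped Matrix Matrix.Norms.L2Operator

noncomputable section

/-- `E[X] ≤ c`, including that the expectation exists (is finite). -/
def ExpectationLE {Ω : Type*} [MeasurableSpace Ω] (P : Measure Ω) (X : Ω → ℝ) (c : ℝ) : Prop :=
  Integrable X P ∧ ∫ ω, X ω ∂P ≤ c

/-- The Hessian matrix of `f` at `x`: the matrix of the derivative of the gradient of `f`.
Matrices carry the Euclidean operator norm. -/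
def hessian {d : ℕ} (f : EuclideanSpace ℝ (Fin d) → ℝ) (x : EuclideanSpace ℝ (Fin d)) :
    Matrix (Fin d) (Fin d) ℝ :=
  (Matrix.toEuclideanCLM (n := Fin d) (𝕜 := ℝ)).symm (fderiv ℝ (gradient f) x)

/-- The covariance matrix of a random vector. -/
def covMatrix {Ω : Type*} [MeasurableSpace Ω] (P : Measure Ω) {d : ℕ}
    (X : Ω → EuclideanSpace ℝ (Fin d)) : Matrix (Fin d) (Fin d) ℝ :=
  Matrix.of fun i j => covariance (fun ω => X ω i) (fun ω => X ω j) P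

/-- The matrix `v wᵀ`. -/
def outerProd {d : ℕ} (v w : EuclideanSpace ℝ (Fin d)) : Matrix (Fin d) (Fin d) ℝ :=
  Matrix.of fun i j => v i * w j

/-! ### Graphs of weight matrices -/

/-- The directed graph induced by the weight matrix `M`: there is an edge `(j, i)`, i.e. node `i`
receives information from node `j`, iff `M i j > 0`. -/
def inducedGraph {n : ℕ} (M : Matrix (Fin n) (Fin n) ℝ) (j i : Fin n) : Prop :=
  0 < M i j

/-- `T` is a (directed) spanning tree of the directed graph `G` with root `r`. -/
structure IsSpanningTree {n : ℕ} (G T : Fin n → Fin n → Prop) (r : Fin n) : Prop where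
  subgraph : ∀ i j, T i j → G i j
  root_no_parent : ∀ i, ¬ T i r
  unique_parent : ∀ i, i ≠ r → ∃! j, T j i
  reach : ∀ i, Relation.ReflTransGen T r i

/-- The set of roots of all spanning trees of `G`. -/
def spanningRoots {n : ℕ} (G : Fin n → Fin n → Prop) : Set (Fin n) :=
  {r | ∃ T, IsSpanningTree G T r}

/-- Strong connectivity of a directed graph. -/
def IsStronglyConnected {n : ℕ} (G : Fin n → Fin n → Prop) : Prop :=
  ∀ i j, Relation.ReflTransGen G i j

/-- The assumption on weight matrices and networks. -/
structure WeightAssumption {n : ℕ} (A B : Matrix (Fin n) (Fin n) ℝ) : Prop where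
  A_nonneg : ∀ i j, 0 ≤ A i j
  B_nonneg : ∀ i j, 0 ≤ B i j
  A_row_stochastic : ∀ i, ∑ j, A i j = 1
  B_col_stochastic : ∀ j, ∑ i, B i j = 1
  A_diag_pos : ∀ i, 0 < A i i
  B_diag_pos : ∀ i, 0 < B i i
  common_root : (spanningRoots (inducedGraph A) ∩ spanningRoots (inducedGraph Bᵀ)).Nonempty

/-! ### The stochastic optimization problem -/

section Problem

variable {Ω : Type*} [MeasurableSpace Ω] (P : Measure Ω) {n d : ℕ} {Z : Fin n → Type*}

/-- The cost `f_i(x) = E[g_i(x; ζ_i)]` of agent `i`. -/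
def localCost (g : ∀ i, EuclideanSpace ℝ (Fin d) → Z i → ℝ) (ζ : ∀ i, Ω → Z i) (i : Fin n)
    (x : EuclideanSpace ℝ (Fin d)) : ℝ :=
  ∫ ω, g i x (ζ i ω) ∂P

/-- The global objective `f = ∑ j, f_j`. -/
def globalCost (g : ∀ i, EuclideanSpace ℝ (Fin d) → Z i → ℝ) (ζ : ∀ i, Ω → Z i)
    (x : EuclideanSpace ℝ (Fin d)) : ℝ :=
  ∑ j, localCost P g ζ j x

/-- The stochastic gradient `∇ g_i(x; z)` (in `x`). -/
def stochGrad (g : ∀ i, EuclideanSpace ℝ (Fin d) → Z i → ℝ) (i : Fin n)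
    (x : EuclideanSpace ℝ (Fin d)) (z : Z i) : EuclideanSpace ℝ (Fin d) :=
  gradient (fun w => g i w z) x

/-- The stochastic Hessian `∇² g_i(x; z)` (in `x`). -/
def stochHess (g : ∀ i, EuclideanSpace ℝ (Fin d) → Z i → ℝ) (i : Fin n)
    (x : EuclideanSpace ℝ (Fin d)) (z : Z i) : Matrix (Fin d) (Fin d) ℝ :=
  hessian (fun w => g i w z) x

/-- The constant `L = max_i √(E[L_i(ζ_i)²])`. -/
def lipConst (Lip : ∀ i, Z i → ℝ) (ζ : ∀ i, Ω → Z i) : ℝ :=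
  ⨆ i, √(∫ ω, Lip i (ζ i ω) ^ 2 ∂P)

/-- The covariance matrix `S = Cov(∑ j, ∇ g_j(x*; ζ_j))`. -/
def gradCov (g : ∀ i, EuclideanSpace ℝ (Fin d) → Z i → ℝ) (ζ : ∀ i, Ω → Z i)
    (xs : EuclideanSpace ℝ (Fin d)) : Matrix (Fin d) (Fin d) ℝ :=
  covMatrix P fun ω => ∑ j, stochGrad g j xs (ζ j ω)

variable [∀ i, MeasurableSpace (Z i)]

/-- The assumption on the objective functions: `f_i` is well defined, (i) `f` is differentiable and
strongly convex, (ii) the gradient of `f` is linear around the optimal solution `xs` up to a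
quadratic error, (iii) the stochastic gradients have uniformly bounded central moments of some
order `p > 2` and are Lipschitz with a random constant `Lip i (ζ i)` in `L^p`. -/
structure ObjectiveAssumption (g : ∀ i, EuclideanSpace ℝ (Fin d) → Z i → ℝ) (ζ : ∀ i, Ω → Z i)
    (Lip : ∀ i, Z i → ℝ) (xs : EuclideanSpace ℝ (Fin d)) : Prop where
  measurable_g : ∀ i x, Measurable (g i x)
  integrable_g : ∀ i x, Integrable (fun ω => g i x (ζ i ω)) P
  differentiable_f : Differentiable ℝ (globalCost P g ζ)
  strongly_convex : ∃ μ : ℝ, 0 < μ ∧ ∀ x y,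
    globalCost P g ζ x + inner ℝ (gradient (globalCost P g ζ) x) (y - x) + μ / 2 * ‖x - y‖ ^ 2
      ≤ globalCost P g ζ y
  optimal : ∀ x, globalCost P g ζ xs ≤ globalCost P g ζ x
  quadratic_error : ∃ c : ℝ, 0 < c ∧ ∀ x,
    ‖gradient (globalCost P g ζ) x
      - Matrix.toEuclideanCLM (n := Fin d) (𝕜 := ℝ) (hessian (globalCost P g ζ) xs) (x - xs)‖
      ≤ c * ‖x - xs‖ ^ 2
  differentiable_g : ∀ i z, Differentiable ℝ fun x => g i x z
  measurable_Lip : ∀ i, Measurable (Lip i)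
  Lip_pos : ∀ i z, 0 < Lip i z
  lipschitz : ∀ i z x y, ‖stochGrad g i x z - stochGrad g i y z‖ ≤ Lip i z * ‖x - y‖
  moments : ∀ i, ∃ p : ℝ, 2 < p ∧ ∃ U : ℝ, 0 < U ∧
    (∀ x, ExpectationLE P
      (fun ω => ‖stochGrad g i x (ζ i ω) - gradient (localCost P g ζ i) x‖ ^ p) (U ^ (p / 2))) ∧
    Integrable (fun ω => Lip i (ζ i ω) ^ p) P

/-- The samples `ζs k i` (agent `i`, time `k`) are copies of `ζ i`, and the sample vectors
`(ζs k i)_i`, `k = 0, 1, …`, are mutually independent and independent of the initial values `x0`.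
Dependence between agents at the same time is allowed. -/
structure SamplingModel (ζ : ∀ i, Ω → Z i) (ζs : ℕ → ∀ i, Ω → Z i)
    (x0 : Fin n → Ω → EuclideanSpace ℝ (Fin d)) : Prop where
  measurable_zeta : ∀ i, Measurable (ζ i)
  measurable_sample : ∀ k i, Measurable (ζs k i)
  measurable_init : ∀ i, Measurable (x0 i)
  identDistrib : ∀ k i, IdentDistrib (ζs k i) (ζ i) P P
  indep_time : iIndepFun (fun k ω i => ζs k i ω) P
  indep_init : IndepFun (fun ω i => x0 i ω) (fun ω k i => ζs k i ω) P

/-- The conditions on the stochastic Hessians: they exist, are Lipschitz in mean at `xs`, and have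
bounded second moment at `xs`. -/
structure HessianAssumption (g : ∀ i, EuclideanSpace ℝ (Fin d) → Z i → ℝ) (ζ : ∀ i, Ω → Z i)
    (xs : EuclideanSpace ℝ (Fin d)) : Prop where
  twice_differentiable : ∀ i z, Differentiable ℝ fun x => stochGrad g i x z
  bounds : ∀ i, ∃ L₁ : ℝ, 0 < L₁ ∧ ∃ L₂ : ℝ, 0 < L₂ ∧
    (∀ x, ExpectationLE P
      (fun ω => ‖stochHess g i x (ζ i ω) - stochHess g i xs (ζ i ω)‖) (L₁ * ‖x - xs‖)) ∧
    ExpectationLE P (fun ω => ‖stochHess g i xs (ζ i ω)‖ ^ 2) L₂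

end Problem

/-! ### The algorithms, along a realization `z k i` of the samples -/

section Algorithm

variable {n d : ℕ} {Z : Fin n → Type*}

/-- The iterates `(x_k, y_k)` of the stochastic `AB` (push-pull) method. -/
def sabIter (A B : Matrix (Fin n) (Fin n) ℝ) (g : ∀ i, EuclideanSpace ℝ (Fin d) → Z i → ℝ)
    (step : ℕ → ℝ) (x0 : Fin n → EuclideanSpace ℝ (Fin d)) (z : ℕ → ∀ i, Z i) :
    ℕ → (Fin n → EuclideanSpace ℝ (Fin d)) × (Fin n → EuclideanSpace ℝ (Fin d))
  | 0 => (x0, fun i => stochGrad g i (x0 i) (z 0 i))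
  | k + 1 =>
    let x := (sabIter A B g step x0 z k).1
    let y := (sabIter A B g step x0 z k).2
    let x' := fun i => ∑ j, A i j • x j - step k • y i
    (x', fun i => ∑ j, B i j • y j
      + stochGrad g i (x' i) (z (k + 1) i) - stochGrad g i (x i) (z k i))

/-- `∇ g_{i,k} = ∇ g_i(x_{i,k}; ζ_{i,k})`. -/
def gradIter (A B : Matrix (Fin n) (Fin n) ℝ) (g : ∀ i, EuclideanSpace ℝ (Fin d) → Z i → ℝ)
    (step : ℕ → ℝ) (x0 : Fin n → EuclideanSpace ℝ (Fin d)) (z : ℕ → ∀ i, Z i)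
    (k : ℕ) (i : Fin n) : EuclideanSpace ℝ (Fin d) :=
  stochGrad g i ((sabIter A B g step x0 z k).1 i) (z k i)

/-- `∇² g_{i,k} = ∇² g_i(x_{i,k}; ζ_{i,k})`. -/
def hessIter (A B : Matrix (Fin n) (Fin n) ℝ) (g : ∀ i, EuclideanSpace ℝ (Fin d) → Z i → ℝ)
    (step : ℕ → ℝ) (x0 : Fin n → EuclideanSpace ℝ (Fin d)) (z : ℕ → ∀ i, Z i)
    (k : ℕ) (i : Fin n) : Matrix (Fin d) (Fin d) ℝ :=
  stochHess g i ((sabIter A B g step x0 z k).1 i) (z k i)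

/-- The vectors `u_{i,k}`: `u_{i,0} = e_i`, `u_{i,k} = ∑ j, a_{ij} u_{j,k-1}`. -/
def eigIter (A : Matrix (Fin n) (Fin n) ℝ) : ℕ → Fin n → Fin n → ℝ
  | 0 => fun i => Pi.single i 1
  | k + 1 => fun i => ∑ j, A i j • eigIter A k j

/-- The plug-in estimators `S_{i,k}`. -/
def covEst (A B : Matrix (Fin n) (Fin n) ℝ) (g : ∀ i, EuclideanSpace ℝ (Fin d) → Z i → ℝ)
    (step : ℕ → ℝ) (x0 : Fin n → EuclideanSpace ℝ (Fin d)) (z : ℕ → ∀ i, Z i) :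
    ℕ → Fin n → Matrix (Fin d) (Fin d) ℝ
  | 0 => fun _ => 0
  | k + 1 => fun i =>
    let G := gradIter A B g step x0 z (k + 1) i
    let G' := gradIter A B g step x0 z k i
    (((k + 1 : ℕ) : ℝ) / ((k + 1 : ℕ) + 1)) • ∑ j, A i j • covEst A B g step x0 z k j
      + (1 / (2 * (((k + 1 : ℕ) : ℝ) + 1) * eigIter A (k + 1) i i)) •
        (outerProd G (G - G') + outerProd (G - G') G)

/-- The plug-in estimators `H_{i,k}`. -/
def hessEst (A B : Matrix (Fin n) (Fin n) ℝ) (g : ∀ i, EuclideanSpace ℝ (Fin d) → Z i → ℝ)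
    (step : ℕ → ℝ) (x0 : Fin n → EuclideanSpace ℝ (Fin d)) (z : ℕ → ∀ i, Z i) :
    ℕ → Fin n → Matrix (Fin d) (Fin d) ℝ
  | 0 => fun _ => 0
  | k + 1 => fun i =>
    (((k + 1 : ℕ) : ℝ) / ((k + 1 : ℕ) + 1)) • ∑ j, A i j • hessEst A B g step x0 z k j
      + (1 / ((((k + 1 : ℕ) : ℝ) + 1) * eigIter A (k + 1) i i)) •
        hessIter A B g step x0 z (k + 1) i

end Algorithm

end

/-! Write `w` and `v` for the two eigenvectors divided by `n`, so that both are probability vectors.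
The argument has four layers.

Mean-square convergence of the iterates. The tracking variable is split as `y = S + G`, with `G` the
current stochastic gradients. The residual obeys `S' = B (S + G) - G`, so it depends only on samples
before the present one, and its entries sum to zero. The average `wᵀx` moves along `wᵀ(S + G)`,
which is not a multiple of the aggregate gradient `1ᵀG`. The Poisson equation `q - Bᵀq = w - c 1`
with `c = v · w > 0` repairs this: `wᵀ(S + G) = c 1ᵀG + qᵀ(S - S')`. After summation by parts the
corrected error `e = wᵀx - α qᵀS - x*` performs stochastic gradient descent, up to a perturbation
`(α - α') qᵀS'` of order `α²`. Strong monotonicity contracts `E‖e‖²`. The consensus error and the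
residual contract in norms adapted to `A - 1wᵀ` and `B - v1ᵀ`. A weighted sum `W` of the three
second moments satisfies `W' ≤ (1 - γα) W + Dα²`, hence tends to zero
(`tendsto_zero_of_coupled_recursion`, `NoisyPushPull.tendsto_integral_sq`).

Distributed averaging. Multiplied by `k + 1`, an estimator obeys `M' = A M + F`, so each agent holds
`∑ wᵀF` up to a geometrically discounted error of bounded mean, which division by `k + 1` removes.
The factors `1 / u_{i,k}(i)` converge to `1 / w_i` and cancel the weights `w`. What remains is the
sum over agents of ordinary time averages (`tendstoInMeasure_distributed_average`).

Laws of large numbers. By the mean-square convergence, gradients and Hessians at the iterates may be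
replaced by those at `x*` with an error vanishing in mean. Averages of independent copies converge
by the strong law. Averages of products of consecutive samples converge to products of means, since
the centred products are orthogonal. Thus the lagged gradient in `S_{i,k}` subtracts the squared
mean and each agent contributes its own covariance, while the mean Hessians add up to the Hessian of
`f` by differentiation under the expectation.

Conclusion. Initial values without second moments are truncated, which changes the whole trajectory
only on an event of small probability. Strong monotonicity makes the Hessian at `x*` invertible, and
the continuous mapping theorem finishes the proof. -/

/-! ### Stochastic matrices acting on vectors of agents -/

section Mixing

variable {n : ℕ} {V : Type*} [NormedAddCommGroup V] [NormedSpace ℝ V]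

/-- The action of a weight matrix on a family of vectors, one for each agent. -/
def mix (M : Matrix (Fin n) (Fin n) ℝ) : (Fin n → V) →ₗ[ℝ] (Fin n → V) where
  toFun x := fun i => ∑ j, M i j • x j
  map_add' x y := by ext i; simp [Finset.sum_add_distrib]
  map_smul' c x := by ext i; simp [Finset.smul_sum, smul_comm c]

/-- The weighted sum of a family of vectors. -/
def wsum (w : Fin n → ℝ) : (Fin n → V) →ₗ[ℝ] V where
  toFun x := ∑ j, w j • x j
  map_add' x y := by simp [Finset.sum_add_distrib]
  map_smul' c x := by simp [Finset.smul_sum, smul_comm c]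

theorem mix_apply (M : Matrix (Fin n) (Fin n) ℝ) (x : Fin n → V) (i : Fin n) :
    mix M x i = ∑ j, M i j • x j := rfl

theorem wsum_apply (w : Fin n → ℝ) (x : Fin n → V) : wsum w x = ∑ j, w j • x j := rfl

theorem mix_one (x : Fin n → V) : mix (1 : Matrix (Fin n) (Fin n) ℝ) x = x := by
  ext i; simp [mix_apply, Matrix.one_apply]

theorem mix_mul (M N : Matrix (Fin n) (Fin n) ℝ) (x : Fin n → V) :
    mix (M * N) x = mix M (mix N x) := by
  ext i
  simp only [mix_apply, Matrix.mul_apply, Finset.sum_smul, Finset.smul_sum, mul_smul]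
  exact Finset.sum_comm

theorem mix_sub_matrix (M N : Matrix (Fin n) (Fin n) ℝ) (x : Fin n → V) :
    mix (M - N) x = mix M x - mix N x := by
  ext i
  simp [mix_apply, sub_smul]

theorem wsum_mix (w : Fin n → ℝ) (M : Matrix (Fin n) (Fin n) ℝ) (x : Fin n → V) :
    wsum w (mix M x) = wsum (w ᵥ* M) x := by
  simp only [wsum_apply, mix_apply, Matrix.vecMul, dotProduct, Finset.sum_smul, Finset.smul_sum,
    mul_smul]
  exact Finset.sum_comm

theorem wsum_const {w : Fin n → ℝ} (hw : ∑ i, w i = 1) (c : V) :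
    wsum w (fun _ => c) = c := by
  rw [wsum_apply, ← Finset.sum_smul, hw, one_smul]

theorem continuous_mix (M : Matrix (Fin n) (Fin n) ℝ) :
    Continuous (mix M : (Fin n → V) → (Fin n → V)) := by
  refine continuous_pi fun i => ?_
  simp only [mix_apply]
  fun_prop

theorem continuous_wsum (w : Fin n → ℝ) : Continuous (wsum w : (Fin n → V) → V) := by
  show Continuous fun x : Fin n → V => ∑ j, w j • x j
  fun_prop

theorem norm_wsum_le (w : Fin n → ℝ) (x : Fin n → V) : ‖wsum w x‖ ≤ (∑ j, |w j|) * ‖x‖ := by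
  rw [wsum_apply, Finset.sum_mul]
  refine (norm_sum_le _ _).trans (Finset.sum_le_sum fun j _ => ?_)
  rw [norm_smul, Real.norm_eq_abs]
  gcongr
  exact norm_le_pi_norm x j

theorem norm_mix_le {M : Matrix (Fin n) (Fin n) ℝ} {c : ℝ} (hc : 0 ≤ c)
    (h : ∀ i, ∑ j, |M i j| ≤ c) (x : Fin n → V) : ‖mix M x‖ ≤ c * ‖x‖ := by
  refine (pi_norm_le_iff_of_nonneg (by positivity)).2 fun i => ?_
  refine (norm_wsum_le (M i) x).trans ?_
  gcongr
  exact h i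

theorem exists_norm_mix_le (M : Matrix (Fin n) (Fin n) ℝ) :
    ∃ c : ℝ, 0 ≤ c ∧ ∀ x : Fin n → V, ‖mix M x‖ ≤ c * ‖x‖ := by
  refine ⟨∑ i, ∑ j, |M i j|, by positivity, fun x => norm_mix_le (by positivity) (fun i => ?_) x⟩
  exact Finset.single_le_sum (f := fun i => ∑ j, |M i j|) (fun i _ => by positivity)
    (Finset.mem_univ i)

theorem exists_pow_row_sum_le {M : Matrix (Fin n) (Fin n) ℝ}
    (hM : ∀ i j, Tendsto (fun k => (M ^ k) i j) atTop (𝓝 0)) :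
    ∃ m, 0 < m ∧ ∀ i, ∑ j, |(M ^ m) i j| ≤ 1 / 2 := by
  have h : ∀ i, Tendsto (fun k => ∑ j, |(M ^ k) i j|) atTop (𝓝 0) := fun i => by
    simpa using tendsto_finsetSum Finset.univ fun j _ => (hM i j).abs
  have h' : ∀ᶠ k in atTop, ∀ i, ∑ j, |(M ^ k) i j| < 1 / 2 :=
    eventually_all.2 fun i => (h i).eventually_lt_const (by norm_num)
  obtain ⟨m, hm, hm'⟩ := (h'.and (eventually_gt_atTop 0)).exists
  exact ⟨m, hm', fun i => (hm i).le⟩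

/-- A matrix whose powers tend to zero is a contraction for an equivalent norm. -/
theorem exists_adapted_norm (V : Type*) [NormedAddCommGroup V] [NormedSpace ℝ V]
    {M : Matrix (Fin n) (Fin n) ℝ}
    (hM : ∀ i j, Tendsto (fun k => (M ^ k) i j) atTop (𝓝 0)) :
    ∃ ρ C : ℝ, 0 < ρ ∧ ρ < 1 ∧ 0 < C ∧ ∃ N : (Fin n → V) → ℝ, Continuous N ∧
      (∀ x, ‖x‖ ≤ N x) ∧ (∀ x, N x ≤ C * ‖x‖) ∧
      ∀ x h, N (mix M x + h) ≤ ρ * N x + C * ‖h‖ := by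
  obtain ⟨m, hm, hm'⟩ := exists_pow_row_sum_le hM
  set ρ : ℝ := (1 / 2 : ℝ) ^ (1 / m : ℝ) with hρdef
  have hm0 : (m : ℝ) ≠ 0 := by positivity
  have hρ0 : 0 < ρ := by positivity
  have hρ1 : ρ < 1 := Real.rpow_lt_one (by norm_num) (by norm_num) (by positivity)
  have hρm : ρ ^ m = 1 / 2 := by
    rw [hρdef, ← Real.rpow_natCast, ← Real.rpow_mul (by norm_num), one_div_mul_cancel hm0,
      Real.rpow_one]
  choose c hc0 hc using fun t => exists_norm_mix_le (V := V) (M ^ t)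
  -- Applying `M` shifts the sum by one index and costs a factor `ρ`. The term gained at the end is
  -- `ρ⁻ᵐ ‖Mᵐ x‖ = 2 ‖Mᵐ x‖ ≤ ‖x‖`, which is no more than the term lost at the start.
  let N : (Fin n → V) → ℝ := fun x => ∑ t ∈ Finset.range m, (ρ ^ t)⁻¹ * ‖mix (M ^ t) x‖
  let C : ℝ := ∑ t ∈ Finset.range m, (ρ ^ t)⁻¹ * c t
  have hC0 : 0 ≤ C := Finset.sum_nonneg fun t _ => mul_nonneg (by positivity) (hc0 t)
  have hNC : ∀ x, N x ≤ C * ‖x‖ := fun x => by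
    simp only [N, C, Finset.sum_mul, mul_assoc]
    exact Finset.sum_le_sum fun t _ => by gcongr; exact hc t x
  have hNadd : ∀ x y, N (x + y) ≤ N x + N y := fun x y => by
    simp only [N, ← Finset.sum_add_distrib, ← mul_add]
    refine Finset.sum_le_sum fun t _ => ?_
    rw [map_add]
    gcongr
    exact norm_add_le _ _
  have hNM : ∀ x, N (mix M x) ≤ ρ * N x := fun x => by
    have h1 : N (mix M x) = ρ * ∑ t ∈ Finset.range m, (ρ ^ (t + 1))⁻¹ * ‖mix (M ^ (t + 1)) x‖ := by
      simp only [N, Finset.mul_sum]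
      refine Finset.sum_congr rfl fun t _ => ?_
      rw [pow_succ M, mix_mul, pow_succ ρ]
      field_simp
    have h2 := Finset.sum_range_succ (fun t => (ρ ^ t)⁻¹ * ‖mix (M ^ t) x‖) m
    have h3 := Finset.sum_range_succ' (fun t => (ρ ^ t)⁻¹ * ‖mix (M ^ t) x‖) m
    have h4 : (ρ ^ m)⁻¹ * ‖mix (M ^ m) x‖ ≤ ‖x‖ := by
      rw [hρm]
      have := norm_mix_le (by norm_num) hm' x
      linarith
    simp only [pow_zero, mix_one, inv_one, one_mul] at h3
    rw [h1]
    gcongr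
    simp only [N]
    linarith
  refine ⟨ρ, C + 1, hρ0, hρ1, by positivity, N, ?_, ?_, ?_, ?_⟩
  · exact continuous_finsetSum _ fun t _ => continuous_const.mul (continuous_mix _).norm
  · intro x
    have := Finset.single_le_sum (f := fun t => (ρ ^ t)⁻¹ * ‖mix (M ^ t) x‖)
      (fun t _ => by positivity) (Finset.mem_range.2 hm)
    simpa [mix_one] using this
  · intro x
    have := norm_nonneg x
    linarith [hNC x]
  · intro x h
    have := norm_nonneg h
    linarith [hNadd (mix M x) h, hNC h, hNM x]

/-- Convexity of the square with weights `ρ` and `1 - ρ`, applied to `s` and `C r / (1 - ρ)`. It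
keeps the contraction factor `ρ` without a cross term, so the bound is linear in second moments. -/
theorem sq_le_of_contraction {ρ C s t r : ℝ} (hρ : 0 ≤ ρ) (hρ1 : ρ < 1)
    (ht : 0 ≤ t) (h : t ≤ ρ * s + C * r) :
    t ^ 2 ≤ ρ * s ^ 2 + C ^ 2 / (1 - ρ) * r ^ 2 := by
  have h1 : 0 < 1 - ρ := by linarith
  have h2 : t ^ 2 ≤ (ρ * s + C * r) ^ 2 := by gcongr
  have h3 : ρ * s ^ 2 + C ^ 2 / (1 - ρ) * r ^ 2 - (ρ * s + C * r) ^ 2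
      = ρ / (1 - ρ) * ((1 - ρ) * s - C * r) ^ 2 := by
    field_simp
    ring
  have : 0 ≤ ρ / (1 - ρ) * ((1 - ρ) * s - C * r) ^ 2 := by positivity
  linarith

end Mixing

/-! ### Convergence of the powers of a stochastic matrix -/

section Powers

variable {n : ℕ} {M : Matrix (Fin n) (Fin n) ℝ}

theorem pow_entry_nonneg (h0 : ∀ i j, 0 ≤ M i j) (k : ℕ) : ∀ i j, 0 ≤ (M ^ k) i j := by
  induction k with
  | zero => intro i j; rw [pow_zero, Matrix.one_apply]; split_ifs <;> norm_num
  | succ k ih =>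
    intro i j
    rw [pow_succ, Matrix.mul_apply]
    exact Finset.sum_nonneg fun l _ => mul_nonneg (ih i l) (h0 l j)

theorem pow_row_sum (h1 : ∀ i, ∑ j, M i j = 1) (k : ℕ) : ∀ i, ∑ j, (M ^ k) i j = 1 := by
  induction k with
  | zero => intro i; simp [Matrix.one_apply]
  | succ k ih =>
    intro i
    simp only [pow_succ, Matrix.mul_apply]
    rw [Finset.sum_comm]
    simp only [← Finset.mul_sum, h1, mul_one, ih]

theorem pow_diag_pos (h0 : ∀ i j, 0 ≤ M i j) (hd : ∀ i, 0 < M i i) (k : ℕ) :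
    ∀ i, 0 < (M ^ k) i i := by
  induction k with
  | zero => intro i; simp
  | succ k ih =>
    intro i
    rw [pow_succ, Matrix.mul_apply]
    exact (mul_pos (ih i) (hd i)).trans_le
      (Finset.single_le_sum (f := fun l => (M ^ k) i l * M l i)
        (fun l _ => mul_nonneg (pow_entry_nonneg h0 k i l) (h0 l i)) (Finset.mem_univ i))

/-- A positive diagonal allows a path to be lengthened by waiting at a node, so positivity persists
at all later times. This is what makes a common exponent for all `i` available. -/
theorem pow_pos_of_reach (h0 : ∀ i j, 0 ≤ M i j) (hd : ∀ i, 0 < M i i) {r i : Fin n}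
    (h : Relation.ReflTransGen (inducedGraph M) r i) : ∃ t, ∀ k, t ≤ k → 0 < (M ^ k) i r := by
  induction h with
  | refl => exact ⟨0, fun k _ => pow_diag_pos h0 hd k r⟩
  | @tail b c _ hbc ih =>
    obtain ⟨t, ht⟩ := ih
    refine ⟨t + 1, fun k hk => ?_⟩
    obtain ⟨k, rfl⟩ : ∃ l, k = l + 1 := ⟨k - 1, by omega⟩
    rw [pow_succ', Matrix.mul_apply]
    exact (mul_pos hbc (ht k (by omega))).trans_le
      (Finset.single_le_sum (f := fun l => M c l * (M ^ k) l r)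
        (fun l _ => mul_nonneg (h0 c l) (pow_entry_nonneg h0 k l r)) (Finset.mem_univ b))

/-- Doeblin's minorization condition: it forces the oscillation of every column of `M ^ k` to shrink
by the factor `1 - ε` over each block of `m` steps. -/
theorem exists_pow_column_ge (h0 : ∀ i j, 0 ≤ M i j) (hd : ∀ i, 0 < M i i) {r : Fin n}
    (hr : ∀ i, Relation.ReflTransGen (inducedGraph M) r i) :
    ∃ m, ∃ ε : ℝ, 0 < ε ∧ ∀ i, ε ≤ (M ^ m) i r := by
  choose t ht using fun i => pow_pos_of_reach h0 hd (hr i)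
  refine ⟨∑ i, t i, ?_⟩
  have hpos : ∀ i, 0 < (M ^ ∑ i, t i) i r := fun i =>
    ht i _ (Finset.single_le_sum (f := t) (fun _ _ => Nat.zero_le _) (Finset.mem_univ i))
  have : Nonempty (Fin n) := ⟨r⟩
  obtain ⟨i₀, hi₀⟩ := Finite.exists_min fun i => (M ^ ∑ i, t i) i r
  exact ⟨_, hpos i₀, hi₀⟩

theorem le_row_average {w x : Fin n → ℝ} (hw : ∀ j, 0 ≤ w j) (hw1 : ∑ j, w j = 1) {lo : ℝ}
    (hx : ∀ j, lo ≤ x j) (r : Fin n) {ε : ℝ} (hε : ε ≤ w r) :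
    lo + ε * (x r - lo) ≤ ∑ j, w j * x j := by
  have h1 : ∑ j, w j * x j - lo = ∑ j, w j * (x j - lo) := by
    simp only [mul_sub, Finset.sum_sub_distrib, ← Finset.sum_mul, hw1, one_mul]
  have h2 : w r * (x r - lo) ≤ ∑ j, w j * (x j - lo) :=
    Finset.single_le_sum (f := fun j => w j * (x j - lo))
      (fun j _ => mul_nonneg (hw j) (by linarith [hx j])) (Finset.mem_univ r)
  have h3 : ε * (x r - lo) ≤ w r * (x r - lo) :=
    mul_le_mul_of_nonneg_right hε (by linarith [hx r])
  linarith

theorem row_average_le {w x : Fin n → ℝ} (hw : ∀ j, 0 ≤ w j) (hw1 : ∑ j, w j = 1) {hi : ℝ}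
    (hx : ∀ j, x j ≤ hi) (r : Fin n) {ε : ℝ} (hε : ε ≤ w r) :
    ∑ j, w j * x j ≤ hi - ε * (hi - x r) := by
  have := le_row_average (x := fun j => - x j) hw hw1 (lo := -hi) (fun j => by linarith [hx j]) r hε
  simp only [mul_neg, Finset.sum_neg_distrib] at this
  linarith

/-- The powers of a stochastic matrix with positive diagonal and rooted graph converge to the
rank-one matrix given by its stationary distribution. -/
theorem tendsto_pow_entry (h0 : ∀ i j, 0 ≤ M i j) (h1 : ∀ i, ∑ j, M i j = 1)
    (hd : ∀ i, 0 < M i i) {r : Fin n} (hr : ∀ i, Relation.ReflTransGen (inducedGraph M) r i)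
    {w : Fin n → ℝ} (hw0 : ∀ i, 0 ≤ w i) (hw1 : ∑ i, w i = 1) (hw : w ᵥ* M = w) (i j : Fin n) :
    Tendsto (fun k => (M ^ k) i j) atTop (𝓝 (w j)) := by
  obtain ⟨m, ε, hε, hm⟩ := exists_pow_column_ge h0 hd hr
  have hε1 : ε ≤ 1 := by
    refine (hm r).trans ?_
    rw [← pow_row_sum h1 m r]
    exact Finset.single_le_sum (f := fun l => (M ^ m) r l)
      (fun l _ => pow_entry_nonneg h0 m r l) (Finset.mem_univ r)
  have hwk : ∀ k, w ᵥ* M ^ k = w := fun k => by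
    induction k with
    | zero => simp
    | succ k ih => rw [pow_succ, ← Matrix.vecMul_vecMul, ih, hw]
  -- `I k δ` says that column `j` of `M ^ k` oscillates by at most `δ`. Averaging never increases
  -- the oscillation, and `m` steps multiply it by `1 - ε`.
  let I : ℕ → ℝ → Prop := fun k δ => ∃ lo hi, hi - lo ≤ δ ∧ ∀ l, lo ≤ (M ^ k) l j ∧ (M ^ k) l j ≤ hi
  have hI : ∀ k p δ, I k δ → I (p + k) δ := by
    rintro k p δ ⟨lo, hi, hδ, h⟩
    refine ⟨lo, hi, hδ, fun l => ?_⟩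
    rw [pow_add, Matrix.mul_apply]
    have a := le_row_average (pow_entry_nonneg h0 p l) (pow_row_sum h1 p l) (fun q => (h q).1) r
      (pow_entry_nonneg h0 p l r)
    have b := row_average_le (pow_entry_nonneg h0 p l) (pow_row_sum h1 p l) (fun q => (h q).2) r
      (pow_entry_nonneg h0 p l r)
    constructor <;> linarith
  have hIm : ∀ k δ, I k δ → I (m + k) ((1 - ε) * δ) := by
    rintro k δ ⟨lo, hi, hδ, h⟩
    refine ⟨lo + ε * ((M ^ k) r j - lo), hi - ε * (hi - (M ^ k) r j), ?_, fun l => ?_⟩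
    · have : (1 - ε) * (hi - lo) ≤ (1 - ε) * δ := mul_le_mul_of_nonneg_left hδ (by linarith)
      linarith
    · rw [pow_add, Matrix.mul_apply]
      exact ⟨le_row_average (pow_entry_nonneg h0 m l) (pow_row_sum h1 m l)
          (fun q => (h q).1) r (hm l),
        row_average_le (pow_entry_nonneg h0 m l) (pow_row_sum h1 m l) (fun q => (h q).2) r (hm l)⟩
  have hIq : ∀ q, I (m * q) ((1 - ε) ^ q) := fun q => by
    induction q with
    | zero =>
      refine ⟨0, 1, by norm_num, fun l => ?_⟩
      rw [mul_zero, pow_zero, Matrix.one_apply]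
      split_ifs <;> norm_num
    | succ q ih =>
      have := hIm _ _ ih
      rwa [← pow_succ', add_comm, ← Nat.mul_succ] at this
  rw [Metric.tendsto_atTop]
  intro δ hδ
  obtain ⟨q, hq⟩ := exists_pow_lt_of_lt_one hδ (by linarith : 1 - ε < 1)
  refine ⟨m * q, fun k hk => ?_⟩
  obtain ⟨p, rfl⟩ := Nat.exists_eq_add_of_le' hk
  obtain ⟨lo, hi, hlen, h⟩ := hI _ p _ (hIq q)
  -- By stationarity `w j` is itself an average of column `j`, so it lies in the same short interval
  -- as the entries.
  have hwj : ∑ l, w l * (M ^ (p + m * q)) l j = w j := by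
    have := congrFun (hwk (p + m * q)) j
    simpa [Matrix.vecMul, dotProduct] using this
  have a := le_row_average hw0 hw1 (fun l => (h l).1) i (hw0 i)
  have b := row_average_le hw0 hw1 (fun l => (h l).2) i (hw0 i)
  rw [hwj] at a b
  rw [Real.dist_eq, abs_lt]
  have := h i
  constructor <;> linarith

/-- With `Q = 1wᵀ` the relations `MQ = QM = Q² = Q` give `(M - Q)^(k+1) = M^(k+1) - Q`. The identity
fails for exponent `0`, hence the shift by one. -/
theorem tendsto_pow_sub_entry (h0 : ∀ i j, 0 ≤ M i j) (h1 : ∀ i, ∑ j, M i j = 1)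
    (hd : ∀ i, 0 < M i i) {r : Fin n} (hr : ∀ i, Relation.ReflTransGen (inducedGraph M) r i)
    {w : Fin n → ℝ} (hw0 : ∀ i, 0 ≤ w i) (hw1 : ∑ i, w i = 1) (hw : w ᵥ* M = w) (i j : Fin n) :
    Tendsto (fun k => ((M - Matrix.vecMulVec (1 : Fin n → ℝ) w) ^ k) i j) atTop (𝓝 0) := by
  have hMP : M * Matrix.vecMulVec (1 : Fin n → ℝ) w = Matrix.vecMulVec (1 : Fin n → ℝ) w := by
    ext a b
    simp [Matrix.mul_apply, Matrix.vecMulVec_apply, ← Finset.sum_mul, h1]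
  have hPM : Matrix.vecMulVec (1 : Fin n → ℝ) w * M = Matrix.vecMulVec (1 : Fin n → ℝ) w := by
    ext a b
    have := congrFun hw b
    simpa [Matrix.mul_apply, Matrix.vecMulVec_apply, Matrix.vecMul, dotProduct] using this
  have hPP : Matrix.vecMulVec (1 : Fin n → ℝ) w * Matrix.vecMulVec (1 : Fin n → ℝ) w = Matrix.vecMulVec (1 : Fin n → ℝ) w := by
    ext a b
    simp [Matrix.mul_apply, Matrix.vecMulVec_apply, ← Finset.sum_mul, hw1]
  have hpowP : ∀ k, M ^ k * Matrix.vecMulVec (1 : Fin n → ℝ) w = Matrix.vecMulVec (1 : Fin n → ℝ) w := fun k => by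
    induction k with
    | zero => simp
    | succ k ih => rw [pow_succ, Matrix.mul_assoc, hMP, ih]
  have hpow : ∀ k, (M - Matrix.vecMulVec (1 : Fin n → ℝ) w) ^ (k + 1) = M ^ (k + 1) - Matrix.vecMulVec (1 : Fin n → ℝ) w :=
    fun k => by
    induction k with
    | zero => simp
    | succ k ih =>
      rw [pow_succ, ih, Matrix.sub_mul, Matrix.mul_sub, Matrix.mul_sub, hpowP, hPM, hPP,
        ← pow_succ]
      simp
  rw [← tendsto_add_atTop_iff_nat 1]
  simp only [hpow, Matrix.sub_apply, Matrix.vecMulVec_apply, Pi.one_apply, one_mul]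
  have := (tendsto_add_atTop_iff_nat 1).2 (tendsto_pow_entry h0 h1 hd hr hw0 hw1 hw i j)
  simpa using this.sub_const (w j)

/-- Strong connectivity makes every node `i` a root, so some power of `M` has column `i` bounded
below by `ε`, and `w i = (w M ^ m) i ≥ ε`. -/
theorem stationary_pos (h0 : ∀ i j, 0 ≤ M i j) (hd : ∀ i, 0 < M i i)
    (hconn : IsStronglyConnected (inducedGraph M))
    {w : Fin n → ℝ} (hw0 : ∀ i, 0 ≤ w i) (hw1 : ∑ i, w i = 1) (hw : w ᵥ* M = w) (i : Fin n) :
    0 < w i := by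
  obtain ⟨m, ε, hε, hm⟩ := exists_pow_column_ge h0 hd (hconn i)
  have hwk : ∀ k, w ᵥ* M ^ k = w := fun k => by
    induction k with
    | zero => simp
    | succ k ih => rw [pow_succ, ← Matrix.vecMul_vecMul, ih, hw]
  have h := congrFun (hwk m) i
  simp only [Matrix.vecMul, dotProduct] at h
  rw [← h]
  calc 0 < ε := hε
    _ = ∑ l, w l * ε := by rw [← Finset.sum_mul, hw1, one_mul]
    _ ≤ _ := Finset.sum_le_sum fun l _ => mul_le_mul_of_nonneg_left (hm l) (hw0 l)

/-- Solvability of the Poisson equation of a stochastic matrix. -/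
theorem exists_poisson (h0 : ∀ i j, 0 ≤ M i j) (h1 : ∀ i, ∑ j, M i j = 1)
    (hd : ∀ i, 0 < M i i) {r : Fin n} (hr : ∀ i, Relation.ReflTransGen (inducedGraph M) r i)
    {w : Fin n → ℝ} (hw0 : ∀ i, 0 ≤ w i) (hw1 : ∑ i, w i = 1) (hw : w ᵥ* M = w)
    (f : Fin n → ℝ) : ∃ q : Fin n → ℝ, ∀ i, q i - (M *ᵥ q) i = f i - w ⬝ᵥ f := by
  -- Since a power of `T` is a strict contraction, `1 - T` is injective and, in finite dimension,
  -- surjective. Solving with `T` in place of `M` leaves an extra term `w ⬝ᵥ q`.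
  set T := M - Matrix.vecMulVec (1 : Fin n → ℝ) w with hT
  obtain ⟨m, hm, hm'⟩ := exists_pow_row_sum_le (tendsto_pow_sub_entry h0 h1 hd hr hw0 hw1 hw)
  have hinj : Function.Injective fun q : Fin n → ℝ => q - mix T q := by
    intro x y hxy
    have h : mix T (x - y) = x - y := by
      simp only at hxy
      rw [map_sub]
      rw [sub_eq_sub_iff_add_eq_add] at hxy
      rw [sub_eq_sub_iff_add_eq_add, add_comm, ← hxy, add_comm]
    have hpow : ∀ k, mix (T ^ k) (x - y) = x - y := fun k => by
      induction k with
      | zero => rw [pow_zero, mix_one]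
      | succ k ih => rw [pow_succ, mix_mul, h, ih]
    have := norm_mix_le (by norm_num) hm' (x - y)
    rw [hpow] at this
    have h0 : ‖x - y‖ = 0 := le_antisymm (by linarith) (norm_nonneg _)
    exact sub_eq_zero.1 (norm_eq_zero.1 h0)
  have hsurj : Function.Surjective (LinearMap.id - mix T : (Fin n → ℝ) →ₗ[ℝ] (Fin n → ℝ)) :=
    LinearMap.injective_iff_surjective.1 hinj
  obtain ⟨q, hq⟩ := hsurj fun i => f i - w ⬝ᵥ f
  have hq' : ∀ i, q i - (M *ᵥ q) i + w ⬝ᵥ q = f i - w ⬝ᵥ f := fun i => by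
    rw [← congrFun hq i]
    simp only [LinearMap.sub_apply, LinearMap.id_apply, Pi.sub_apply, hT, mix_sub_matrix, mix_apply,
      Matrix.mulVec, dotProduct, Matrix.vecMulVec_apply, Pi.one_apply, one_mul, smul_eq_mul]
    ring
  have hwq : w ⬝ᵥ (M *ᵥ q) = w ⬝ᵥ q := by rw [Matrix.dotProduct_mulVec, hw]
  -- Averaging the equation against the stationary vector `w` cancels everything except the extra
  -- term, which is therefore zero.
  have hsum : ∑ i, w i * (q i - (M *ᵥ q) i + w ⬝ᵥ q) = ∑ i, w i * (f i - w ⬝ᵥ f) :=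
    Finset.sum_congr rfl fun i _ => by rw [hq']
  simp only [mul_add, mul_sub, Finset.sum_add_distrib, Finset.sum_sub_distrib, ← Finset.sum_mul,
    hw1, one_mul] at hsum
  change w ⬝ᵥ q - w ⬝ᵥ (M *ᵥ q) + w ⬝ᵥ q = w ⬝ᵥ f - w ⬝ᵥ f at hsum
  refine ⟨q, fun i => ?_⟩
  have := hq' i
  linarith

end Powers

/-! ### Recursive inequalities for real sequences -/

section Sequences

/-- A form of Chung's lemma. -/
theorem tendsto_zero_of_recursive_le {W α : ℕ → ℝ} {γ D : ℝ} (hγ : 0 < γ)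
    (hW : ∀ k, 0 ≤ W k) (hα0 : ∀ k, 0 ≤ α k) (hα : Tendsto α atTop (𝓝 0)) (hαs : ¬ Summable α)
    (h : ∀ᶠ k in atTop, W (k + 1) ≤ (1 - γ * α k) * W k + D * α k ^ 2) :
    Tendsto W atTop (𝓝 0) := by
  refine tendsto_order.2 ⟨fun c hc => Eventually.of_forall fun k => hc.trans_le (hW k),
    fun ε' hε' => ?_⟩
  set ε := ε' / 2 with hεdef
  have hε : 0 < ε := by positivity
  have e1 : ∀ᶠ k in atTop, γ * α k < 1 := by
    have : Tendsto (fun k => γ * α k) atTop (𝓝 0) := by simpa using hα.const_mul γ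
    exact this.eventually_lt_const one_pos
  have e2 : ∀ᶠ k in atTop, D * α k < γ * ε := by
    have : Tendsto (fun k => D * α k) atTop (𝓝 0) := by simpa using hα.const_mul D
    exact this.eventually_lt_const (by positivity)
  obtain ⟨K, hK⟩ := eventually_atTop.1 (h.and (e1.and e2))
  -- As soon as `D α ≤ γ ε`, the inhomogeneity is absorbed by recentring at `ε`. The product of the
  -- remaining factors is at most `exp (-γ ∑ α)`, which tends to zero.
  have hstep : ∀ k, K ≤ k → W (k + 1) - ε ≤ (1 - γ * α k) * (W k - ε) := fun k hk => by
    obtain ⟨h1, h2, h3⟩ := hK k hk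
    have : D * α k * α k ≤ γ * ε * α k := mul_le_mul_of_nonneg_right h3.le (hα0 k)
    nlinarith
  have hbound : ∀ m, W (m + K) - ε ≤
      Real.exp (-(γ * ∑ t ∈ Finset.range m, α (t + K))) * |W K - ε| := fun m => by
    induction m with
    | zero => simpa using le_abs_self (W K - ε)
    | succ m ih =>
      have h1 := hstep (m + K) (by omega)
      have h2 := (hK (m + K) (by omega)).2.1
      rw [show m + 1 + K = m + K + 1 by ring]
      refine h1.trans ((mul_le_mul_of_nonneg_left ih (by linarith)).trans ?_)
      rw [Finset.sum_range_succ, mul_add, neg_add, Real.exp_add, mul_right_comm, mul_comm]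
      exact mul_le_mul_of_nonneg_left (Real.one_sub_le_exp_neg _) (by positivity)
  have hsum : Tendsto (fun m => ∑ t ∈ Finset.range m, α (t + K)) atTop atTop := by
    rw [← not_summable_iff_tendsto_nat_atTop_of_nonneg fun t => hα0 _]
    rwa [summable_nat_add_iff]
  have hlim : Tendsto (fun m => Real.exp (-(γ * ∑ t ∈ Finset.range m, α (t + K))) * |W K - ε|)
      atTop (𝓝 0) := by
    have := (Real.tendsto_exp_neg_atTop_nhds_zero.comp (hsum.const_mul_atTop hγ)).mul_const
      |W K - ε|
    simpa using this
  have hev := hlim.eventually_lt_const hε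
  have : ∀ᶠ m in atTop, W (m + K) < ε' := hev.mono fun m hm => by
    have := hbound m
    linarith
  obtain ⟨m₀, hm₀⟩ := eventually_atTop.1 this
  refine eventually_atTop.2 ⟨m₀ + K, fun k hk => ?_⟩
  obtain ⟨m, rfl⟩ := Nat.exists_eq_add_of_le' hk
  have := hm₀ (m + m₀) (by omega)
  rwa [add_assoc] at this

/-- Convergence of a coupled system consisting of a slow descent recursion `a`, a fast
contraction `b` and a driven stable recursion `s`. -/
theorem tendsto_zero_of_coupled_recursion {a b s α : ℕ → ℝ} {γ ρ C : ℝ} (hγ : 0 < γ)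
    (hρ1 : ρ < 1) (hC : 0 ≤ C)
    (ha0 : ∀ k, 0 ≤ a k) (hb0 : ∀ k, 0 ≤ b k) (hs0 : ∀ k, 0 ≤ s k)
    (hα0 : ∀ k, 0 ≤ α k) (hαa : ∀ k, α (k + 1) ≤ α k) (hα : Tendsto α atTop (𝓝 0))
    (hαs : ¬ Summable α)
    (ha : ∀ k, a (k + 1) ≤
      (1 - γ * α k) * a k + C * α k * b k + C * α k ^ 2 * (1 + a k + b k + s k))
    (hb : ∀ k, b (k + 1) ≤ ρ * b k + C * α k ^ 2 * (1 + a k + b k + s k))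
    (hs : ∀ k, s (k + 1) ≤ ρ * s k + C * (1 + a k + b k + α k ^ 2 * s k)) :
    Tendsto a atTop (𝓝 0) ∧ Tendsto b atTop (𝓝 0) ∧
      Tendsto (fun k => α k ^ 2 * s k) atTop (𝓝 0) := by
  -- The residual enters the first two recursions through `2 C α² s`, and its own contraction gains
  -- `κ (1 - ρ) α² s` in the Lyapunov function `W`. This `κ` covers the former and leaves one unit
  -- of `α² s` for the higher-order terms, while the constant terms collect into `D α²`.
  set κ := (2 * C + 1) / (1 - ρ) with hκdef
  have h1ρ : 0 < 1 - ρ := by linarith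
  have hκ : κ * (1 - ρ) = 2 * C + 1 := by rw [hκdef]; field_simp
  have hκ0 : 0 < κ := by positivity
  set D := 2 * C + κ * C with hD
  set W : ℕ → ℝ := fun k => a k + b k + κ * (α k ^ 2 * s k) with hWdef
  have hW0 : ∀ k, 0 ≤ W k := fun k => by
    have := ha0 k; have := hb0 k; have := hs0 k; positivity
  have hα2 : Tendsto (fun k => α k ^ 2) atTop (𝓝 0) := by simpa using hα.pow 2
  have e1 : ∀ᶠ k in atTop, D * α k < γ / 2 := by
    have : Tendsto (fun k => D * α k) atTop (𝓝 0) := by simpa using hα.const_mul D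
    exact this.eventually_lt_const (by positivity)
  have e2 : ∀ᶠ k in atTop, C * α k + D * α k ^ 2 + γ / 2 * α k < 1 - ρ := by
    have := ((hα.const_mul C).add (hα2.const_mul D)).add (hα.const_mul (γ / 2))
    simp only [mul_zero, add_zero] at this
    exact this.eventually_lt_const h1ρ
  have e3 : ∀ᶠ k in atTop, κ * C * α k ^ 2 + κ * (γ / 2) * α k < 1 := by
    have := (hα2.const_mul (κ * C)).add (hα.const_mul (κ * (γ / 2)))
    simp only [mul_zero, add_zero] at this
    exact this.eventually_lt_const one_pos
  have hW : Tendsto W atTop (𝓝 0) := by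
    refine tendsto_zero_of_recursive_le (γ := γ / 2) (D := D) (by positivity) hW0 hα0 hα hαs ?_
    filter_upwards [e1, e2, e3] with k h1 h2 h3
    have hsq : α (k + 1) ^ 2 * s (k + 1) ≤ α k ^ 2 * s (k + 1) := by
      have := hs0 (k + 1); have := hα0 (k + 1); have := hαa k
      gcongr
    have hs' : κ * (α (k + 1) ^ 2 * s (k + 1)) ≤
        κ * (α k ^ 2 * (ρ * s k + C * (1 + a k + b k + α k ^ 2 * s k))) := by
      have := hs k
      refine mul_le_mul_of_nonneg_left (hsq.trans ?_) hκ0.le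
      gcongr
    have p1 : 0 ≤ (γ / 2 - D * α k) * (α k * a k) :=
      mul_nonneg (by linarith) (mul_nonneg (hα0 k) (ha0 k))
    have p2 : 0 ≤ (1 - ρ - (C * α k + D * α k ^ 2 + γ / 2 * α k)) * b k :=
      mul_nonneg (by linarith) (hb0 k)
    have p3 : 0 ≤ (1 - (κ * C * α k ^ 2 + κ * (γ / 2) * α k)) * (α k ^ 2 * s k) :=
      mul_nonneg (by linarith) (mul_nonneg (sq_nonneg _) (hs0 k))
    have p4 : κ * (1 - ρ) * (α k ^ 2 * s k) = (2 * C + 1) * (α k ^ 2 * s k) := by rw [hκ]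
    simp only [hWdef]
    calc a (k + 1) + b (k + 1) + κ * (α (k + 1) ^ 2 * s (k + 1))
        ≤ ((1 - γ * α k) * a k + C * α k * b k + C * α k ^ 2 * (1 + a k + b k + s k))
          + (ρ * b k + C * α k ^ 2 * (1 + a k + b k + s k))
          + κ * (α k ^ 2 * (ρ * s k + C * (1 + a k + b k + α k ^ 2 * s k))) :=
          add_le_add (add_le_add (ha k) (hb k)) hs'
      _ = (1 - γ / 2 * α k) * (a k + b k + κ * (α k ^ 2 * s k)) + D * α k ^ 2
          - (γ / 2 - D * α k) * (α k * a k)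
          - (1 - ρ - (C * α k + D * α k ^ 2 + γ / 2 * α k)) * b k
          - (1 - (κ * C * α k ^ 2 + κ * (γ / 2) * α k)) * (α k ^ 2 * s k)
          - (κ * (1 - ρ) * (α k ^ 2 * s k) - (2 * C + 1) * (α k ^ 2 * s k)) := by
          rw [hD]; ring
      _ ≤ _ := by rw [p4]; linarith
  have hsα : ∀ k, 0 ≤ α k ^ 2 * s k := fun k => mul_nonneg (sq_nonneg _) (hs0 k)
  refine ⟨squeeze_zero ha0 (fun k => ?_) hW, squeeze_zero hb0 (fun k => ?_) hW,
    squeeze_zero hsα (fun k => ?_) (by simpa using hW.const_mul κ⁻¹)⟩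
  · have := hb0 k; have := mul_nonneg hκ0.le (hsα k); simp only [hWdef]; linarith
  · have := ha0 k; have := mul_nonneg hκ0.le (hsα k); simp only [hWdef]; linarith
  · rw [le_inv_mul_iff₀ hκ0]
    have := ha0 k; have := hb0 k; simp only [hWdef]; linarith

variable {a b α : ℝ} {step : ℕ → ℝ}

theorem step_pos (ha : 0 < a) (hb : 0 < b) (hstep : ∀ k : ℕ, step k = a / ((k : ℝ) + b) ^ α)
    (k : ℕ) : 0 < step k := by
  rw [hstep]; positivity

theorem step_succ_le (ha : 0 < a) (hb : 0 < b) (hα : 0 ≤ α)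
    (hstep : ∀ k : ℕ, step k = a / ((k : ℝ) + b) ^ α) (k : ℕ) : step (k + 1) ≤ step k := by
  rw [hstep, hstep]
  push_cast
  gcongr
  linarith

theorem rpow_le_add_one {α t : ℝ} (ht : 0 < t) (hα0 : 0 ≤ α) (hα : α ≤ 1) : t ^ α ≤ t + 1 :=
  calc t ^ α ≤ (t + 1) ^ α := by gcongr; linarith
    _ ≤ (t + 1) ^ (1 : ℝ) := Real.rpow_le_rpow_of_exponent_le (by linarith) hα
    _ = t + 1 := Real.rpow_one _

/-- With `t = k + b` and `α ≤ 1`, one has `(t / (t + 1)) ^ α ≥ t / (t + 1)`. The relative decrease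
of the step is thus at most `1 / (t + 1) ≤ 1 / t ^ α`, which is the step divided by `a`. -/
theorem step_sub_le (ha : 0 < a) (hb : 0 < b) (hα0 : 0 ≤ α) (hα : α ≤ 1)
    (hstep : ∀ k : ℕ, step k = a / ((k : ℝ) + b) ^ α) (k : ℕ) :
    step k - step (k + 1) ≤ a⁻¹ * step k ^ 2 := by
  rw [hstep, hstep]
  push_cast
  set t : ℝ := (k : ℝ) + b with ht
  have ht0 : 0 < t := by positivity
  rw [show (k : ℝ) + 1 + b = t + 1 by rw [ht]; ring]
  have h1 : t / (t + 1) ≤ (t / (t + 1)) ^ α := by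
    have := Real.rpow_le_rpow_of_exponent_ge (x := t / (t + 1)) (by positivity)
      ((div_le_one (by positivity)).2 (by linarith)) hα
    rwa [Real.rpow_one] at this
  rw [Real.div_rpow ht0.le (by positivity)] at h1
  have h2 : 1 / (t + 1) ≤ 1 / t ^ α :=
    one_div_le_one_div_of_le (by positivity) (rpow_le_add_one ht0 hα0 hα)
  have h3 : t / (t + 1) = 1 - 1 / (t + 1) := by field_simp; ring
  have h4 : a / t ^ α - a / (t + 1) ^ α = a / t ^ α * (1 - t ^ α / (t + 1) ^ α) := by
    have : t ^ α ≠ 0 := by positivity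
    field_simp
  have h5 : a⁻¹ * (a / t ^ α) ^ 2 = a / t ^ α * (1 / t ^ α) := by field_simp
  rw [h4, h5]
  have : 0 < a / t ^ α := by positivity
  gcongr
  linarith

theorem tendsto_step (hα : 0 < α) (hstep : ∀ k : ℕ, step k = a / ((k : ℝ) + b) ^ α) :
    Tendsto step atTop (𝓝 0) := by
  rw [funext hstep]
  refine Tendsto.const_div_atTop ((tendsto_rpow_atTop hα).comp ?_) a
  exact tendsto_atTop_add_const_right _ _ tendsto_natCast_atTop_atTop

theorem not_summable_step (ha : 0 < a) (hb : 0 < b) (hα0 : 0 ≤ α) (hα : α ≤ 1)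
    (hstep : ∀ k : ℕ, step k = a / ((k : ℝ) + b) ^ α) : ¬ Summable step := by
  intro h
  have h1 : Summable fun k : ℕ => 1 / ((k + 1 : ℕ) : ℝ) := by
    refine Summable.of_nonneg_of_le (fun k => by positivity) (fun k => ?_)
      (h.mul_left ((b + 1) / a))
    rw [hstep]
    have ht0 : 0 < (k : ℝ) + b := by positivity
    have hk : (0 : ℝ) ≤ k := by positivity
    have h2 := rpow_le_add_one ht0 hα0 hα
    have h3 : (k : ℝ) + b + 1 ≤ (b + 1) * (k + 1) := by nlinarith
    rw [div_mul_div_cancel₀ ha.ne']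
    push_cast
    rw [div_le_div_iff₀ (by positivity) (by positivity)]
    linarith
  exact Real.not_summable_one_div_natCast ((summable_nat_add_iff 1).1 h1)

end Sequences

/-! ### Independence of the past and the present -/

section Past

variable {Ω α β : Type*} [MeasurableSpace α] [MeasurableSpace β]

/-- The information generated by the initial value `X` and the samples `Y 0, …, Y (k - 1)`. -/
@[reducible] def past (X : Ω → α) (Y : ℕ → Ω → β) (k : ℕ) : MeasurableSpace Ω :=
  MeasurableSpace.comap (fun ω => (X ω, fun t : Finset.range k => Y t ω)) inferInstance

theorem measurable_past_init (X : Ω → α) (Y : ℕ → Ω → β) (k : ℕ) : Measurable[past X Y k] X :=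
  measurable_fst.comp (comap_measurable fun ω => (X ω, fun t : Finset.range k => Y t ω))

theorem measurable_past_sample (X : Ω → α) (Y : ℕ → Ω → β) {k t : ℕ} (h : t < k) :
    Measurable[past X Y k] (Y t) :=
  (measurable_pi_apply (⟨t, Finset.mem_range.2 h⟩ : Finset.range k)).comp
    (measurable_snd.comp (comap_measurable fun ω => (X ω, fun t : Finset.range k => Y t ω)))

theorem past_mono (X : Ω → α) (Y : ℕ → Ω → β) {k l : ℕ} (h : k ≤ l) : past X Y k ≤ past X Y l := by
  refine MeasurableSpace.comap_le_iff_le_map.2 ?_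
  have h2 : Measurable[past X Y l] fun ω (t : Finset.range k) => Y t ω :=
    @measurable_pi_lambda _ _ _ (past X Y l) _ _ fun t =>
      measurable_past_sample X Y ((Finset.mem_range.1 t.2).trans_le h)
  exact fun s hs => (measurable_past_init X Y l).prodMk h2 hs

end Past

section Independence

open scoped ENNReal

variable {Ω α β γ : Type*} [mΩ : MeasurableSpace Ω] {P : Measure Ω} [IsProbabilityMeasure P]
  [MeasurableSpace α] [MeasurableSpace β] [MeasurableSpace γ]

/-- Both hypotheses together say that the joint law of the three variables is the product of their
laws; only the bracketing changes. It joins the initial value to the past samples. -/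
theorem indepFun_prodMk_left {f : Ω → α} {g : Ω → β} {h : Ω → γ} (hf : Measurable f)
    (hg : Measurable g) (hh : Measurable h) (h1 : IndepFun f (fun ω => (g ω, h ω)) P)
    (h2 : IndepFun g h P) : IndepFun (fun ω => (f ω, g ω)) h P := by
  have h3 : IndepFun f g P := h1.comp measurable_id measurable_fst
  rw [indepFun_iff_map_prod_eq_prod_map_map (hf.prodMk hg).aemeasurable hh.aemeasurable,
    h3.map_prod_eq_prod_map_map hf.aemeasurable hg.aemeasurable]
  have e := h1.map_prod_eq_prod_map_map hf.aemeasurable (hg.prodMk hh).aemeasurable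
  rw [h2.map_prod_eq_prod_map_map hg.aemeasurable hh.aemeasurable] at e
  have : IsProbabilityMeasure (P.map f) := Measure.isProbabilityMeasure_map hf.aemeasurable
  have : IsProbabilityMeasure (P.map g) := Measure.isProbabilityMeasure_map hg.aemeasurable
  have : IsProbabilityMeasure (P.map h) := Measure.isProbabilityMeasure_map hh.aemeasurable
  apply (MeasurableEquiv.prodAssoc (α := α) (β := β) (γ := γ)).map_measurableEquiv_injective
  rw [Measure.prodAssoc_prod, ← e,
    Measure.map_map (MeasurableEquiv.measurable _) ((hf.prodMk hg).prodMk hh)]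
  rfl

/-- Tonelli for the product law of `(X, Y)`: the argument `X` is frozen while `Y` is integrated out.
This freezing replaces conditional expectations given the past. -/
theorem lintegral_comp_of_indepFun {X : Ω → α} {Y Y' : Ω → β} (hX : Measurable X)
    (hY : Measurable Y) (hY' : Measurable Y') (hXY : IndepFun X Y P)
    (hid : IdentDistrib Y Y' P P) {φ : α × β → ℝ≥0∞} (hφ : Measurable φ) :
    ∫⁻ ω, φ (X ω, Y ω) ∂P = ∫⁻ ω, ∫⁻ ω', φ (X ω, Y' ω') ∂P ∂P := by
  have : IsProbabilityMeasure (P.map Y') := Measure.isProbabilityMeasure_map hY'.aemeasurable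
  rw [← lintegral_map hφ (hX.prodMk hY),
    hXY.map_prod_eq_prod_map_map hX.aemeasurable hY.aemeasurable, hid.map_eq,
    lintegral_prod _ hφ.aemeasurable, lintegral_map hφ.lintegral_prod_right' hX]
  refine lintegral_congr fun ω => ?_
  exact lintegral_map (f := fun y => φ (X ω, y)) (hφ.comp measurable_prodMk_left) hY'

/-- A conditional bound on the mean of `φ (x, ·)` integrates over an independent argument. -/
theorem expectationLE_comp_of_indepFun {X : Ω → α} {Y Y' : Ω → β} (hX : Measurable X)
    (hY : Measurable Y) (hY' : Measurable Y') (hXY : IndepFun X Y P)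
    (hid : IdentDistrib Y Y' P P) {φ : α × β → ℝ} (hφ : Measurable φ) (hφ0 : ∀ p, 0 ≤ φ p)
    {ψ : α → ℝ} (hψ : ∀ x, ExpectationLE P (fun ω => φ (x, Y' ω)) (ψ x))
    (hψX : Integrable (fun ω => ψ (X ω)) P) :
    ExpectationLE P (fun ω => φ (X ω, Y ω)) (∫ ω, ψ (X ω) ∂P) := by
  have hψ0 : ∀ x, 0 ≤ ψ x := fun x => (integral_nonneg fun ω => hφ0 _).trans (hψ x).2
  have hle : ∫⁻ ω, ENNReal.ofReal (φ (X ω, Y ω)) ∂P ≤ ∫⁻ ω, ENNReal.ofReal (ψ (X ω)) ∂P := by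
    rw [lintegral_comp_of_indepFun hX hY hY' hXY hid (φ := fun p => ENNReal.ofReal (φ p))
      hφ.ennreal_ofReal]
    refine lintegral_mono fun ω => ?_
    rw [← ofReal_integral_eq_lintegral_ofReal (hψ (X ω)).1 (ae_of_all _ fun _ => hφ0 _)]
    exact ENNReal.ofReal_le_ofReal (hψ (X ω)).2
  rw [← ofReal_integral_eq_lintegral_ofReal hψX (ae_of_all _ fun _ => hψ0 _)] at hle
  have hm : Measurable fun ω => φ (X ω, Y ω) := hφ.comp (hX.prodMk hY)
  have hint : Integrable (fun ω => φ (X ω, Y ω)) P := by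
    refine ⟨hm.aestronglyMeasurable, ?_⟩
    rw [hasFiniteIntegral_iff_ofReal (ae_of_all _ fun _ => hφ0 _)]
    exact hle.trans_lt ENNReal.ofReal_lt_top
  refine ⟨hint, ?_⟩
  rw [← ofReal_integral_eq_lintegral_ofReal hint (ae_of_all _ fun _ => hφ0 _)] at hle
  exact (ENNReal.ofReal_le_ofReal_iff (integral_nonneg fun ω => hψ0 _)).1 hle

/-- The Fubini counterpart for signed integrands. It expresses that gradient noise is a martingale
difference. -/
theorem integral_comp_eq_zero_of_indepFun {X : Ω → α} {Y Y' : Ω → β} (hX : Measurable X)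
    (hY : Measurable Y) (hY' : Measurable Y') (hXY : IndepFun X Y P)
    (hid : IdentDistrib Y Y' P P) {φ : α × β → ℝ} (hφ : Measurable φ)
    (h0 : ∀ x, ∫ ω, φ (x, Y' ω) ∂P = 0) (hint : Integrable (fun ω => φ (X ω, Y ω)) P) :
    ∫ ω, φ (X ω, Y ω) ∂P = 0 := by
  have : IsProbabilityMeasure (P.map Y') := Measure.isProbabilityMeasure_map hY'.aemeasurable
  have hlaw : P.map (fun ω => (X ω, Y ω)) = (P.map X).prod (P.map Y') := by
    rw [hXY.map_prod_eq_prod_map_map hX.aemeasurable hY.aemeasurable, hid.map_eq]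
  have hint' : Integrable φ ((P.map X).prod (P.map Y')) := by
    rw [← hlaw]
    exact (integrable_map_measure hφ.aestronglyMeasurable (hX.prodMk hY).aemeasurable).2 hint
  rw [← integral_map (hX.prodMk hY).aemeasurable (f := φ) hφ.aestronglyMeasurable, hlaw,
    integral_prod _ hint']
  refine integral_eq_zero_of_ae (ae_of_all _ fun x => ?_)
  simp only [Pi.zero_apply]
  rw [integral_map (f := fun y => φ (x, y)) hY'.aemeasurable
    (hφ.comp measurable_prodMk_left).aestronglyMeasurable, h0]

variable {X : Ω → α} {Y : ℕ → Ω → β}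

theorem past_le (hX : Measurable X) (hY : ∀ k, Measurable (Y k)) (k : ℕ) : past X Y k ≤ mΩ :=
  Measurable.comap_le (hX.prodMk (measurable_pi_lambda _ fun t => hY t))

theorem indep_past (hX : Measurable X) (hY : ∀ k, Measurable (Y k)) (hYi : iIndepFun Y P)
    (hXY : IndepFun X (fun ω k => Y k ω) P) (k : ℕ) :
    Indep (past X Y k) (MeasurableSpace.comap (Y k) inferInstance) P := by
  have h1 : IndepFun (fun ω (t : Finset.range k) => Y t ω) (Y k) P := by
    have := hYi.indepFun_finset (Finset.range k) {k} (by simp) hY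
    exact this.comp measurable_id
      (measurable_pi_apply (⟨k, Finset.mem_singleton_self k⟩ : ({k} : Finset ℕ)))
  have h2 : IndepFun X (fun ω => ((fun t : Finset.range k => Y t ω), Y k ω)) P :=
    hXY.comp measurable_id (ψ := fun y : ℕ → β => ((fun t : Finset.range k => y t), y k))
      (Measurable.prodMk (measurable_pi_lambda _ fun t => measurable_pi_apply _)
        (measurable_pi_apply _))
  exact indepFun_prodMk_left hX (measurable_pi_lambda _ fun t => hY t) (hY k) h2 h1

theorem indepFun_of_measurable_past (hX : Measurable X) (hY : ∀ k, Measurable (Y k))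
    (hYi : iIndepFun Y P) (hXY : IndepFun X (fun ω k => Y k ω) P) {k : ℕ} {W : Ω → γ}
    (hW : Measurable[past X Y k] W) : IndepFun W (Y k) P := by
  rw [IndepFun_iff_Indep]
  exact indep_of_indep_of_le_left (indep_past hX hY hYi hXY k) hW.comap_le

end Independence

/-! ### Convergence in probability to a constant -/

section InMeasure

variable {Ω : Type*} [MeasurableSpace Ω] {P : Measure Ω}

/-- For a constant limit, convergence in probability is a statement about neighbourhoods of one
point. The continuous mapping theorem then needs continuity only at that point and no measurability.
-/
theorem tendstoInMeasure_const_iff {E : Type*} [PseudoMetricSpace E] {f : ℕ → Ω → E} {c : E} :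
    TendstoInMeasure P f atTop (fun _ => c) ↔
      ∀ U ∈ 𝓝 c, Tendsto (fun k => P {ω | f k ω ∉ U}) atTop (𝓝 0) := by
  rw [tendstoInMeasure_iff_dist]
  constructor
  · intro h U hU
    obtain ⟨ε, hε, hεU⟩ := Metric.mem_nhds_iff.1 hU
    refine tendsto_of_tendsto_of_tendsto_of_le_of_le tendsto_const_nhds (h ε hε)
      (fun _ => zero_le) fun k => measure_mono fun ω hω => ?_
    by_contra hlt
    exact hω (hεU (Metric.mem_ball.2 (not_le.1 hlt)))
  · intro h ε hε
    refine tendsto_of_tendsto_of_tendsto_of_le_of_le tendsto_const_nhds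
      (h _ (Metric.ball_mem_nhds c hε)) (fun _ => zero_le) fun k => measure_mono fun ω hω => ?_
    simpa using hω

theorem MeasureTheory.TendstoInMeasure.continuousAt_comp {E F : Type*} [PseudoMetricSpace E]
    [PseudoMetricSpace F] {f : ℕ → Ω → E} {c : E} {φ : E → F}
    (h : TendstoInMeasure P f atTop (fun _ => c)) (hφ : ContinuousAt φ c) :
    TendstoInMeasure P (fun k ω => φ (f k ω)) atTop (fun _ => φ c) := by
  rw [tendstoInMeasure_const_iff] at h ⊢
  exact fun U hU => h _ (hφ hU)

theorem MeasureTheory.TendstoInMeasure.pi {ι : Type*} [Fintype ι] {E : ι → Type*} [∀ i, PseudoMetricSpace (E i)]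
    {f : ℕ → Ω → ∀ i, E i} {c : ∀ i, E i}
    (h : ∀ i, TendstoInMeasure P (fun k ω => f k ω i) atTop (fun _ => c i)) :
    TendstoInMeasure P f atTop (fun _ => c) := by
  rw [tendstoInMeasure_iff_dist]
  intro ε hε
  simp_rw [tendstoInMeasure_iff_dist] at h
  have hsum : Tendsto (fun k => ∑ i, P {ω | ε ≤ dist (f k ω i) (c i)}) atTop (𝓝 0) := by
    simpa using tendsto_finsetSum Finset.univ fun i _ => h i ε hε
  refine tendsto_of_tendsto_of_tendsto_of_le_of_le tendsto_const_nhds hsum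
    (fun _ => zero_le) fun k => ?_
  refine (measure_mono fun ω hω => ?_).trans (measure_iUnion_fintype_le P _)
  by_contra hlt
  simp only [Set.mem_iUnion, Set.mem_ofPred_eq, not_exists, not_le] at hlt
  exact absurd hω (not_le.2 ((dist_pi_lt_iff hε).2 hlt))

theorem MeasureTheory.TendstoInMeasure.prodMk_const {E F : Type*} [PseudoMetricSpace E] [PseudoMetricSpace F]
    {f : ℕ → Ω → E} {g : ℕ → Ω → F} {c : E} {d : F}
    (hf : TendstoInMeasure P f atTop (fun _ => c)) (hg : TendstoInMeasure P g atTop (fun _ => d)) :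
    TendstoInMeasure P (fun k ω => (f k ω, g k ω)) atTop (fun _ => (c, d)) := by
  rw [tendstoInMeasure_iff_dist] at *
  intro ε hε
  have hsum := (hf ε hε).add (hg ε hε)
  rw [add_zero] at hsum
  refine tendsto_of_tendsto_of_tendsto_of_le_of_le tendsto_const_nhds hsum
    (fun _ => zero_le) fun k => ?_
  refine (measure_mono fun ω hω => ?_).trans (measure_union_le _ _)
  simpa [Prod.dist_eq] using hω

theorem MeasureTheory.TendstoInMeasure.add_const {f g : ℕ → Ω → ℝ} {c d : ℝ}
    (hf : TendstoInMeasure P f atTop (fun _ => c)) (hg : TendstoInMeasure P g atTop (fun _ => d)) :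
    TendstoInMeasure P (fun k ω => f k ω + g k ω) atTop (fun _ => c + d) :=
  (hf.prodMk_const hg).continuousAt_comp (φ := fun p : ℝ × ℝ => p.1 + p.2) (by fun_prop)

theorem MeasureTheory.TendstoInMeasure.const_mul {f : ℕ → Ω → ℝ} {c : ℝ}
    (hf : TendstoInMeasure P f atTop (fun _ => c)) (r : ℝ) :
    TendstoInMeasure P (fun k ω => r * f k ω) atTop (fun _ => r * c) :=
  hf.continuousAt_comp (φ := fun x : ℝ => r * x) (by fun_prop)

theorem MeasureTheory.TendstoInMeasure.sum_const {n : ℕ} {f : Fin n → ℕ → Ω → ℝ} {c : Fin n → ℝ}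
    (hf : ∀ j, TendstoInMeasure P (f j) atTop (fun _ => c j)) :
    TendstoInMeasure P (fun k ω => ∑ j, f j k ω) atTop (fun _ => ∑ j, c j) :=
  (TendstoInMeasure.pi (f := fun k ω j => f j k ω) hf).continuousAt_comp
    (φ := fun x : Fin n → ℝ => ∑ j, x j) (by fun_prop)

theorem tendstoInMeasure_zero_of_integral_abs {f : ℕ → Ω → ℝ} (hf : ∀ k, Integrable (f k) P)
    (h : Tendsto (fun k => ∫ ω, |f k ω| ∂P) atTop (𝓝 0)) :
    TendstoInMeasure P f atTop (fun _ => 0) := by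
  refine tendstoInMeasure_of_tendsto_eLpNorm (p := 1) one_ne_zero
    (fun k => (hf k).aestronglyMeasurable) aestronglyMeasurable_const ?_
  have : ∀ k, eLpNorm (f k - fun _ => 0) 1 P = ENNReal.ofReal (∫ ω, |f k ω| ∂P) := fun k => by
    rw [eLpNorm_one_eq_lintegral_enorm,
      ofReal_integral_eq_lintegral_ofReal (hf k).abs (ae_of_all _ fun _ => abs_nonneg _)]
    refine lintegral_congr fun ω => ?_
    simp [← ofReal_norm]
  simp only [this]
  simpa using ENNReal.tendsto_ofReal h

theorem tendsto_measure_mem_of_tendstoInMeasure [IsProbabilityMeasure P] {E : Type*}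
    [PseudoMetricSpace E] {f : ℕ → Ω → E} {c : E} (h : TendstoInMeasure P f atTop (fun _ => c))
    {U : Set E} (hU : U ∈ 𝓝 c) : Tendsto (fun k => P {ω | f k ω ∈ U}) atTop (𝓝 1) := by
  have h1 : Tendsto (fun k => 1 - P {ω | f k ω ∉ U}) atTop (𝓝 (1 - 0)) :=
    ENNReal.Tendsto.sub tendsto_const_nhds (tendstoInMeasure_const_iff.1 h U hU) (by simp)
  rw [tsub_zero] at h1
  refine tendsto_of_tendsto_of_tendsto_of_le_of_le h1 tendsto_const_nhds (fun k => ?_)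
    fun k => prob_le_one
  refine tsub_le_iff_right.2 ?_
  rw [← measure_univ (μ := P)]
  refine (measure_mono fun ω _ => ?_).trans (measure_union_le _ _)
  exact em (f k ω ∈ U)

/-- Convergence in probability may be checked for approximations that are exact with
probability close to one. -/
theorem tendstoInMeasure_of_approx {E : Type*} [PseudoMetricSpace E] {f : ℕ → Ω → E} {c : E}
    {f' : ℕ → ℕ → Ω → E} {T : ℕ → Set Ω} (hT : Tendsto (fun R => P (T R)) atTop (𝓝 0))
    (heq : ∀ R k ω, ω ∉ T R → f k ω = f' R k ω)
    (h : ∀ R, TendstoInMeasure P (f' R) atTop (fun _ => c)) :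
    TendstoInMeasure P f atTop (fun _ => c) := by
  simp_rw [tendstoInMeasure_const_iff] at h ⊢
  intro U hU
  rw [ENNReal.tendsto_nhds_zero]
  intro ε hε
  have hε2 : 0 < ε / 2 := ENNReal.half_pos hε.ne'
  obtain ⟨R, hR⟩ := ((ENNReal.tendsto_nhds_zero.1 hT) _ hε2).exists
  filter_upwards [(ENNReal.tendsto_nhds_zero.1 (h R U hU)) _ hε2] with k hk
  calc P {ω | f k ω ∉ U} ≤ P (T R ∪ {ω | f' R k ω ∉ U}) := by
        refine measure_mono fun ω hω => ?_
        by_cases hT : ω ∈ T R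
        · exact Or.inl hT
        · right
          simpa only [Set.mem_ofPred_eq, ← heq R k ω hT] using hω
    _ ≤ P (T R) + P {ω | f' R k ω ∉ U} := measure_union_le _ _
    _ ≤ ε / 2 + ε / 2 := add_le_add hR hk
    _ = ε := ENNReal.add_halves ε

end InMeasure

/-! ### Gradients and Hessians in coordinates -/

section Coordinates

variable {d : ℕ}

theorem measurable_of_coord {α : Type*} [MeasurableSpace α] {f : α → EuclideanSpace ℝ (Fin d)}
    (h : ∀ a, Measurable fun x => f x a) : Measurable f :=
  (PiLp.continuous_toLp 2 (fun _ : Fin d => ℝ)).measurable.comp (measurable_pi_lambda _ h)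

theorem measurable_coord (a : Fin d) :
    Measurable fun x : EuclideanSpace ℝ (Fin d) => x a :=
  (PiLp.continuous_apply 2 (fun _ : Fin d => ℝ) a).measurable

theorem abs_coord_le (x : EuclideanSpace ℝ (Fin d)) (a : Fin d) : |x a| ≤ ‖x‖ := by
  simpa using PiLp.norm_apply_le x a

theorem gradient_coord (f : EuclideanSpace ℝ (Fin d) → ℝ) (x : EuclideanSpace ℝ (Fin d))
    (a : Fin d) : gradient f x a = fderiv ℝ f x (EuclideanSpace.single a 1) := by
  rw [← inner_gradient_left, EuclideanSpace.inner_single_right]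
  simp

theorem toEuclideanCLM_single (M : Matrix (Fin d) (Fin d) ℝ) (a b : Fin d) :
    Matrix.toEuclideanCLM (n := Fin d) (𝕜 := ℝ) M (EuclideanSpace.single b 1) a = M a b := by
  rw [Matrix.ofLp_toEuclideanCLM]
  simp

theorem toEuclideanCLM_hessian (f : EuclideanSpace ℝ (Fin d) → ℝ)
    (x : EuclideanSpace ℝ (Fin d)) :
    Matrix.toEuclideanCLM (n := Fin d) (𝕜 := ℝ) (hessian f x) = fderiv ℝ (gradient f) x :=
  StarAlgEquiv.apply_symm_apply _ _

theorem hessian_coord (f : EuclideanSpace ℝ (Fin d) → ℝ) (x : EuclideanSpace ℝ (Fin d))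
    (a b : Fin d) :
    hessian f x a b = fderiv ℝ (gradient f) x (EuclideanSpace.single b 1) a := by
  rw [← toEuclideanCLM_hessian, toEuclideanCLM_single]

theorem abs_entry_le_norm (M : Matrix (Fin d) (Fin d) ℝ) (a b : Fin d) : |M a b| ≤ ‖M‖ := by
  rw [← toEuclideanCLM_single M a b]
  refine (abs_coord_le _ a).trans ?_
  refine (ContinuousLinearMap.le_opNorm _ _).trans ?_
  rw [Matrix.l2_opNorm_toEuclideanCLM]
  simp

/-- A directional derivative as the limit of a sequence of difference quotients. -/
theorem tendsto_difference_quotient {E F : Type*} [NormedAddCommGroup E] [NormedSpace ℝ E]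
    [NormedAddCommGroup F] [NormedSpace ℝ F] {f : E → F} {x : E} (hf : DifferentiableAt ℝ f x)
    (v : E) :
    Tendsto (fun m : ℕ => (m : ℝ) • (f (x + (m : ℝ)⁻¹ • v) - f x)) atTop
      (𝓝 (fderiv ℝ f x v)) := by
  refine hf.hasFDerivAt.lim v (c := fun m : ℕ => (m : ℝ)) ?_
  simpa using tendsto_natCast_atTop_atTop (R := ℝ)

end Coordinates

/-! ### Properties of the stochastic gradients -/

section Oracle

variable {Ω : Type*} [MeasurableSpace Ω] {P : Measure Ω} {n d : ℕ} {Z : Fin n → Type*}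
  [∀ i, MeasurableSpace (Z i)]
  {g : ∀ i, EuclideanSpace ℝ (Fin d) → Z i → ℝ} {ζ : ∀ i, Ω → Z i} {Lip : ∀ i, Z i → ℝ}
  {xs : EuclideanSpace ℝ (Fin d)}

theorem measurable_stochGrad (hobj : ObjectiveAssumption P g ζ Lip xs) (i : Fin n)
    (x : EuclideanSpace ℝ (Fin d)) : Measurable (stochGrad g i x) := by
  refine measurable_of_coord fun a => ?_
  refine measurable_of_tendsto_metrizable (f := fun (m : ℕ) z =>
    (m : ℝ) • (g i (x + (m : ℝ)⁻¹ • EuclideanSpace.single a 1) z - g i x z)) (fun m => ?_) ?_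
  · exact Measurable.const_smul (g := fun z =>
      g i (x + (m : ℝ)⁻¹ • EuclideanSpace.single a 1) z - g i x z)
      ((hobj.measurable_g i _).sub (hobj.measurable_g i _)) (m : ℝ)
  · refine tendsto_pi_nhds.2 fun z => ?_
    rw [stochGrad, gradient_coord]
    exact tendsto_difference_quotient (hobj.differentiable_g i z x) _

theorem continuous_stochGrad (hobj : ObjectiveAssumption P g ζ Lip xs) (i : Fin n) (z : Z i) :
    Continuous fun x => stochGrad g i x z :=
  (LipschitzWith.of_dist_le_mul (K := Real.toNNReal (Lip i z)) fun x y => by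
    rw [dist_eq_norm, dist_eq_norm, Real.coe_toNNReal _ (hobj.Lip_pos i z).le]
    exact hobj.lipschitz i z x y).continuous

theorem measurable_stochGrad_uncurry (hobj : ObjectiveAssumption P g ζ Lip xs) (i : Fin n) :
    Measurable fun p : EuclideanSpace ℝ (Fin d) × Z i => stochGrad g i p.1 p.2 :=
  measurable_uncurry_of_continuous_of_measurable (u := fun x z => stochGrad g i x z)
    (continuous_stochGrad hobj i) (measurable_stochGrad hobj i)

/-- Continuity of the Hessian in `x` is not assumed, so joint measurability is obtained from
difference quotients of the jointly measurable gradient. -/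
theorem measurable_stochHess_entry (hobj : ObjectiveAssumption P g ζ Lip xs)
    (hhess : HessianAssumption P g ζ xs) (i : Fin n) (a b : Fin d) :
    Measurable fun p : EuclideanSpace ℝ (Fin d) × Z i => stochHess g i p.1 p.2 a b := by
  refine measurable_of_tendsto_metrizable (f := fun (m : ℕ) p =>
    ((m : ℝ) • (stochGrad g i (p.1 + (m : ℝ)⁻¹ • EuclideanSpace.single b 1) p.2
      - stochGrad g i p.1 p.2)) a) (fun m => ?_) ?_
  · refine (measurable_coord a).comp (Measurable.const_smul
      (g := fun p : EuclideanSpace ℝ (Fin d) × Z i =>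
        stochGrad g i (p.1 + (m : ℝ)⁻¹ • EuclideanSpace.single b 1) p.2
          - stochGrad g i p.1 p.2) (Measurable.sub ?_ ?_) (m : ℝ))
    · exact (measurable_stochGrad_uncurry hobj i).comp
        ((measurable_fst.add_const _).prodMk measurable_snd)
    · exact measurable_stochGrad_uncurry hobj i
  · refine tendsto_pi_nhds.2 fun p => ?_
    rw [stochHess, hessian_coord]
    exact ((PiLp.continuous_apply 2 (fun _ : Fin d => ℝ) a).tendsto _).comp
      (tendsto_difference_quotient (hhess.twice_differentiable i p.2 p.1) _)

/-- At `x = xs` the quadratic error bound reads `‖∇f(xs)‖ ≤ 0`. -/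
theorem gradient_globalCost_optimal (hobj : ObjectiveAssumption P g ζ Lip xs) :
    gradient (globalCost P g ζ) xs = 0 := by
  obtain ⟨c, -, hc⟩ := hobj.quadratic_error
  have := hc xs
  simp at this
  exact this

/-- The sum of the strong convexity inequalities for the pairs `(x, xs)` and `(xs, x)`. -/
theorem exists_strong_monotone (hobj : ObjectiveAssumption P g ζ Lip xs) :
    ∃ μ : ℝ, 0 < μ ∧ ∀ x,
      μ * ‖x - xs‖ ^ 2 ≤ inner ℝ (x - xs) (gradient (globalCost P g ζ) x) := by
  obtain ⟨μ, hμ, h⟩ := hobj.strongly_convex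
  refine ⟨μ, hμ, fun x => ?_⟩
  have h1 := h x xs
  have h2 := h xs x
  rw [gradient_globalCost_optimal hobj, inner_zero_left, norm_sub_rev xs x] at h2
  rw [← neg_sub x xs, inner_neg_right, real_inner_comm] at h1
  linarith

/-- `hessian` is defined through `fderiv`, which is zero by default where the derivative does not
exist. The quadratic error bound is `o(‖x - xs‖)`, so here the derivative does exist. -/
theorem hasFDerivAt_gradient_globalCost (hobj : ObjectiveAssumption P g ζ Lip xs) :
    HasFDerivAt (gradient (globalCost P g ζ))
      (Matrix.toEuclideanCLM (n := Fin d) (𝕜 := ℝ) (hessian (globalCost P g ζ) xs)) xs := by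
  obtain ⟨c, hc0, hc⟩ := hobj.quadratic_error
  rw [hasFDerivAt_iff_isLittleO, gradient_globalCost_optimal hobj]
  simp only [sub_zero]
  have h1 : (fun x => gradient (globalCost P g ζ) x -
      Matrix.toEuclideanCLM (n := Fin d) (𝕜 := ℝ) (hessian (globalCost P g ζ) xs) (x - xs))
      =O[𝓝 xs] fun x => ‖x - xs‖ ^ 2 :=
    Asymptotics.IsBigO.of_bound c (Eventually.of_forall fun x => by simpa using hc x)
  refine h1.trans_isLittleO ?_
  have h2 : (fun y : EuclideanSpace ℝ (Fin d) => ‖y‖ ^ 2) =o[𝓝 0] fun y => y :=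
    Asymptotics.isLittleO_norm_pow_id one_lt_two
  have h3 : Tendsto (fun x => x - xs) (𝓝 xs) (𝓝 0) := by
    have : Continuous fun x : EuclideanSpace ℝ (Fin d) => x - xs := by fun_prop
    simpa using this.tendsto xs
  exact h2.comp_tendsto h3

/-- If the Hessian annihilates `v`, then `m ∇f(xs + v / m)` tends to zero, whereas strong
monotonicity keeps its inner product with `v` above `μ ‖v‖²`. -/
theorem isUnit_hessian_globalCost (hobj : ObjectiveAssumption P g ζ Lip xs) :
    IsUnit (hessian (globalCost P g ζ) xs) := by
  obtain ⟨μ, hμ, hmono⟩ := exists_strong_monotone hobj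
  rw [← Matrix.mulVec_injective_iff_isUnit, ← Matrix.coe_mulVecLin,
    ← LinearMap.ker_eq_bot, LinearMap.ker_eq_bot']
  intro w hw
  set v : EuclideanSpace ℝ (Fin d) := WithLp.toLp 2 w with hv
  have hHv : Matrix.toEuclideanCLM (n := Fin d) (𝕜 := ℝ) (hessian (globalCost P g ζ) xs) v = 0 := by
    rw [hv, Matrix.toEuclideanCLM_toLp]
    rw [Matrix.mulVecLin_apply] at hw
    rw [hw]
    rfl
  have hlim := (hasFDerivAt_gradient_globalCost hobj).lim v (c := fun m : ℕ => (m : ℝ))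
    (l := atTop) (by simpa using tendsto_natCast_atTop_atTop (R := ℝ))
  rw [hHv, gradient_globalCost_optimal hobj] at hlim
  simp only [sub_zero] at hlim
  have hlim' : Tendsto (fun m : ℕ => inner ℝ v ((m : ℝ) •
      gradient (globalCost P g ζ) (xs + (m : ℝ)⁻¹ • v))) atTop (𝓝 0) := by
    have : Continuous fun y : EuclideanSpace ℝ (Fin d) => inner ℝ v y := by fun_prop
    rw [← inner_zero_right (𝕜 := ℝ) v]
    exact (this.tendsto 0).comp hlim
  have hge : ∀ᶠ m : ℕ in atTop, μ * ‖v‖ ^ 2 ≤ inner ℝ v ((m : ℝ) •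
      gradient (globalCost P g ζ) (xs + (m : ℝ)⁻¹ • v)) := by
    filter_upwards [eventually_gt_atTop 0] with m hm
    have hm' : (0 : ℝ) < m := by exact_mod_cast hm
    have := hmono (xs + (m : ℝ)⁻¹ • v)
    rw [add_sub_cancel_left, norm_smul, inner_smul_left, norm_inv, Real.norm_natCast] at this
    rw [inner_smul_right]
    simp only [conj_trivial] at this
    have h2 := mul_le_mul_of_nonneg_left this (by positivity : (0 : ℝ) ≤ (m : ℝ) ^ 2)
    have h3 : (m : ℝ) * (m : ℝ)⁻¹ = 1 := mul_inv_cancel₀ hm'.ne'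
    calc μ * ‖v‖ ^ 2 = (m : ℝ) ^ 2 * (μ * ((m : ℝ)⁻¹ * ‖v‖) ^ 2) := by
          linear_combination (-(μ * ‖v‖ ^ 2)) * (m * (m : ℝ)⁻¹ + 1) * h3
      _ ≤ _ := h2
      _ = _ := by
          linear_combination (m : ℝ) * inner ℝ v (gradient (globalCost P g ζ)
            (xs + (m : ℝ)⁻¹ • v)) * h3
  have h0 : μ * ‖v‖ ^ 2 ≤ 0 := ge_of_tendsto hlim' hge
  have hv0 : ‖v‖ ^ 2 ≤ 0 := by
    by_contra hne
    exact absurd h0 (not_le.2 (mul_pos hμ (not_le.1 hne)))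
  have hv1 : v = 0 := by
    rw [← norm_eq_zero]
    exact pow_eq_zero_iff two_ne_zero |>.1 (le_antisymm hv0 (sq_nonneg _))
  rw [hv] at hv1
  simpa using congrArg WithLp.ofLp hv1

variable [IsProbabilityMeasure P]

theorem sq_le_one_add_rpow {t p : ℝ} (ht : 0 ≤ t) (hp : 2 < p) : t ^ 2 ≤ 1 + t ^ p := by
  have h0 : 0 ≤ t ^ p := Real.rpow_nonneg ht p
  rcases le_total t 1 with h | h
  · nlinarith
  · have := Real.rpow_le_rpow_of_exponent_le h hp.le
    rw [Real.rpow_two] at this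
    linarith

theorem le_one_add_sq (t : ℝ) : t ≤ 1 + t ^ 2 := by nlinarith [sq_nonneg (t - 1)]

theorem exists_variance_bound (hobj : ObjectiveAssumption P g ζ Lip xs)
    (hζ : ∀ i, Measurable (ζ i)) :
    ∃ σ : ℝ, ∀ i x, ExpectationLE P
      (fun ω => ‖stochGrad g i x (ζ i ω) - gradient (localCost P g ζ i) x‖ ^ 2) σ := by
  choose p hp U hU hUm _ using hobj.moments
  refine ⟨∑ i, (1 + U i ^ (p i / 2)), fun i x => ?_⟩
  obtain ⟨h1, h2⟩ := hUm i x
  have hle : ∀ ω, ‖stochGrad g i x (ζ i ω) - gradient (localCost P g ζ i) x‖ ^ 2 ≤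
      1 + ‖stochGrad g i x (ζ i ω) - gradient (localCost P g ζ i) x‖ ^ (p i) := fun ω =>
    sq_le_one_add_rpow (norm_nonneg _) (hp i)
  have hm : Measurable fun ω => stochGrad g i x (ζ i ω) - gradient (localCost P g ζ i) x :=
    ((measurable_stochGrad hobj i x).comp (hζ i)).sub_const _
  have hint : Integrable (fun ω => 1 +
      ‖stochGrad g i x (ζ i ω) - gradient (localCost P g ζ i) x‖ ^ (p i)) P :=
    (integrable_const _).add h1
  have hint2 : Integrable (fun ω =>
      ‖stochGrad g i x (ζ i ω) - gradient (localCost P g ζ i) x‖ ^ 2) P :=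
    hint.mono' (hm.norm.pow_const 2).aestronglyMeasurable (ae_of_all _ fun ω => by
      rw [Real.norm_of_nonneg (by positivity)]
      exact hle ω)
  refine ⟨hint2, ?_⟩
  calc _ ≤ ∫ ω, (1 + ‖stochGrad g i x (ζ i ω) - gradient (localCost P g ζ i) x‖ ^ (p i)) ∂P :=
        integral_mono hint2 hint hle
    _ = 1 + ∫ ω, ‖stochGrad g i x (ζ i ω) - gradient (localCost P g ζ i) x‖ ^ (p i) ∂P := by
        rw [integral_add (integrable_const _) h1]
        simp
    _ ≤ 1 + U i ^ (p i / 2) := by linarith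
    _ ≤ _ := Finset.single_le_sum (f := fun i => 1 + U i ^ (p i / 2))
        (fun j _ => by have := hU j; positivity) (Finset.mem_univ i)

theorem memLp_stochGrad (hobj : ObjectiveAssumption P g ζ Lip xs)
    (hζ : ∀ i, Measurable (ζ i)) (i : Fin n) (x : EuclideanSpace ℝ (Fin d)) :
    MemLp (fun ω => stochGrad g i x (ζ i ω)) 2 P := by
  obtain ⟨σ, hσ⟩ := exists_variance_bound hobj hζ
  have hm : Measurable fun ω => stochGrad g i x (ζ i ω) :=
    (measurable_stochGrad hobj i x).comp (hζ i)
  have h1 : MemLp (fun ω => stochGrad g i x (ζ i ω) - gradient (localCost P g ζ i) x) 2 P :=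
    (memLp_two_iff_integrable_sq_norm (hm.sub_const _).aestronglyMeasurable).2 (hσ i x).1
  refine (memLp_congr_ae (ae_of_all _ fun ω => ?_)).1
    (h1.add (memLp_const (gradient (localCost P g ζ i) x)))
  simp

theorem integrable_stochGrad (hobj : ObjectiveAssumption P g ζ Lip xs)
    (hζ : ∀ i, Measurable (ζ i)) (i : Fin n) (x : EuclideanSpace ℝ (Fin d)) :
    Integrable (fun ω => stochGrad g i x (ζ i ω)) P :=
  (memLp_stochGrad hobj hζ i x).integrable one_le_two

theorem memLp_Lip (hobj : ObjectiveAssumption P g ζ Lip xs) (hζ : ∀ i, Measurable (ζ i))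
    (i : Fin n) : MemLp (fun ω => Lip i (ζ i ω)) 2 P := by
  obtain ⟨p, hp, U, hU, -, hL⟩ := hobj.moments i
  have hm : Measurable fun ω => Lip i (ζ i ω) := (hobj.measurable_Lip i).comp (hζ i)
  rw [memLp_two_iff_integrable_sq hm.aestronglyMeasurable]
  refine ((integrable_const (1 : ℝ)).add hL).mono' (hm.pow_const 2).aestronglyMeasurable
    (ae_of_all _ fun ω => ?_)
  rw [Real.norm_of_nonneg (by positivity)]
  exact sq_le_one_add_rpow (hobj.Lip_pos i _).le hp

theorem integrable_Lip (hobj : ObjectiveAssumption P g ζ Lip xs) (hζ : ∀ i, Measurable (ζ i))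
    (i : Fin n) : Integrable (fun ω => Lip i (ζ i ω)) P :=
  (memLp_Lip hobj hζ i).integrable one_le_two

/-- On the unit ball the gradient is bounded by `‖∇f(x₀)‖ + K`. With random `f` this constant is
integrable and serves as the dominating function for differentiation under the expectation. -/
theorem norm_sub_le_of_gradient_lipschitz {f : EuclideanSpace ℝ (Fin d) → ℝ}
    (hf : Differentiable ℝ f) {K : ℝ} (hK : 0 ≤ K)
    (hL : ∀ x y, ‖gradient f x - gradient f y‖ ≤ K * ‖x - y‖) (x₀ : EuclideanSpace ℝ (Fin d)) :
    LipschitzOnWith (Real.nnabs (‖gradient f x₀‖ + K)) f (Metric.ball x₀ 1) := by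
  refine (convex_ball x₀ 1).lipschitzOnWith_of_nnnorm_fderiv_le (𝕜 := ℝ) (fun x _ => hf x) ?_
  intro x hx
  rw [← NNReal.coe_le_coe, coe_nnnorm, Real.coe_nnabs, abs_of_nonneg (by positivity),
    ← toDual_gradient, LinearIsometryEquiv.norm_map]
  have h1 : ‖gradient f x‖ ≤ ‖gradient f x₀‖ + ‖gradient f x - gradient f x₀‖ :=
    norm_le_norm_add_norm_sub' _ _
  have h2 : ‖x - x₀‖ ≤ 1 := by
    rw [← dist_eq_norm]
    exact (Metric.mem_ball.1 hx).le
  nlinarith [hL x x₀]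

/-- Differentiation under the expectation: the gradient of the local cost is the mean of the
stochastic gradient. -/
theorem hasGradientAt_localCost (hobj : ObjectiveAssumption P g ζ Lip xs)
    (hζ : ∀ i, Measurable (ζ i)) (i : Fin n) (x : EuclideanSpace ℝ (Fin d)) :
    HasGradientAt (localCost P g ζ i) (∫ ω, stochGrad g i x (ζ i ω) ∂P) x := by
  have hfd : ∀ ω, fderiv ℝ (fun w => g i w (ζ i ω)) x =
      InnerProductSpace.toDual ℝ _ (stochGrad g i x (ζ i ω)) := fun ω => by
    rw [stochGrad, toDual_gradient]
  have hG := integrable_stochGrad hobj hζ i x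
  have key := hasFDerivAt_integral_of_dominated_loc_of_lip (μ := P) (𝕜 := ℝ)
    (F := fun w ω => g i w (ζ i ω)) (x₀ := x)
    (F' := fun ω => InnerProductSpace.toDual ℝ _ (stochGrad g i x (ζ i ω)))
    (bound := fun ω => ‖stochGrad g i x (ζ i ω)‖ + Lip i (ζ i ω))
    (Metric.ball_mem_nhds x one_pos)
    (Eventually.of_forall fun w => ((hobj.measurable_g i w).comp (hζ i)).aestronglyMeasurable)
    (hobj.integrable_g i x)
    ((InnerProductSpace.toDual ℝ _).continuous.comp_aestronglyMeasurable hG.aestronglyMeasurable)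
    (ae_of_all _ fun ω => norm_sub_le_of_gradient_lipschitz (hobj.differentiable_g i _)
      (hobj.Lip_pos i _).le (hobj.lipschitz i (ζ i ω)) x)
    (hG.norm.add (integrable_Lip hobj hζ i))
    (ae_of_all _ fun ω => by
      rw [← hfd]
      exact (hobj.differentiable_g i (ζ i ω) x).hasFDerivAt)
  rw [hasGradientAt_iff_hasFDerivAt]
  have e := (InnerProductSpace.toDual ℝ (EuclideanSpace ℝ (Fin d))).toContinuousLinearEquiv
    |>.integral_comp_comm (μ := P) fun ω => stochGrad g i x (ζ i ω)
  exact e ▸ key.2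

theorem gradient_localCost (hobj : ObjectiveAssumption P g ζ Lip xs)
    (hζ : ∀ i, Measurable (ζ i)) (i : Fin n) (x : EuclideanSpace ℝ (Fin d)) :
    gradient (localCost P g ζ i) x = ∫ ω, stochGrad g i x (ζ i ω) ∂P :=
  (hasGradientAt_localCost hobj hζ i x).gradient

theorem gradient_globalCost (hobj : ObjectiveAssumption P g ζ Lip xs)
    (hζ : ∀ i, Measurable (ζ i)) (x : EuclideanSpace ℝ (Fin d)) :
    gradient (globalCost P g ζ) x = ∑ i, gradient (localCost P g ζ i) x := by
  refine HasGradientAt.gradient ?_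
  rw [hasGradientAt_iff_hasFDerivAt, map_sum]
  have := HasFDerivAt.fun_sum (u := Finset.univ) fun i _ =>
    hasGradientAt_iff_hasFDerivAt.1 (hasGradientAt_localCost hobj hζ i x).differentiableAt.hasGradientAt
  exact this

theorem exists_lipschitz_gradient_localCost (hobj : ObjectiveAssumption P g ζ Lip xs)
    (hζ : ∀ i, Measurable (ζ i)) :
    ∃ K : ℝ, 0 ≤ K ∧ ∀ i x y,
      ‖gradient (localCost P g ζ i) x - gradient (localCost P g ζ i) y‖ ≤ K * ‖x - y‖ := by
  have h0 : ∀ i, 0 ≤ ∫ ω, Lip i (ζ i ω) ∂P := fun i =>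
    integral_nonneg fun ω => (hobj.Lip_pos i _).le
  refine ⟨∑ i, ∫ ω, Lip i (ζ i ω) ∂P, Finset.sum_nonneg fun i _ => h0 i, fun i x y => ?_⟩
  rw [gradient_localCost hobj hζ, gradient_localCost hobj hζ, ← integral_sub
    (integrable_stochGrad hobj hζ i x) (integrable_stochGrad hobj hζ i y)]
  calc _ ≤ ∫ ω, Lip i (ζ i ω) * ‖x - y‖ ∂P :=
        norm_integral_le_of_norm_le ((integrable_Lip hobj hζ i).mul_const _)
          (ae_of_all _ fun ω => hobj.lipschitz i (ζ i ω) x y)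
    _ = (∫ ω, Lip i (ζ i ω) ∂P) * ‖x - y‖ := integral_mul_const _ _
    _ ≤ _ := by
        gcongr
        exact Finset.single_le_sum (f := fun i => ∫ ω, Lip i (ζ i ω) ∂P)
          (fun i _ => h0 i) (Finset.mem_univ i)

theorem integrable_stochHess_entry_optimal (hobj : ObjectiveAssumption P g ζ Lip xs)
    (hhess : HessianAssumption P g ζ xs) (hζ : ∀ i, Measurable (ζ i)) (i : Fin n) (a b : Fin d) :
    Integrable (fun ω => stochHess g i xs (ζ i ω) a b) P := by
  obtain ⟨L₁, -, L₂, -, -, h2⟩ := hhess.bounds i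
  have hm : Measurable fun ω => stochHess g i xs (ζ i ω) a b :=
    Measurable.comp (g := fun p : EuclideanSpace ℝ (Fin d) × Z i => stochHess g i p.1 p.2 a b)
      (f := fun ω => (xs, ζ i ω)) (measurable_stochHess_entry hobj hhess i a b)
      (measurable_const.prodMk (hζ i))
  have hint : Integrable (fun ω => 1 + ‖stochHess g i xs (ζ i ω)‖ ^ 2) P :=
    (integrable_const (1 : ℝ)).add h2.1
  exact hint.mono' hm.aestronglyMeasurable (ae_of_all _ fun ω =>
    (abs_entry_le_norm (stochHess g i xs (ζ i ω)) a b).trans (le_one_add_sq _))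

/-- Both sides are derivatives at `t = 0` of coordinate `a` of `∇f(xs + t e_b)`. The left side comes
from the differentiability of `∇f` at `xs`; the right side from differentiation under the
expectation, with difference quotients dominated by the Lipschitz constants. Derivatives are unique.
-/
theorem hessian_globalCost_entry (hobj : ObjectiveAssumption P g ζ Lip xs)
    (hhess : HessianAssumption P g ζ xs) (hζ : ∀ i, Measurable (ζ i)) (a b : Fin d) :
    hessian (globalCost P g ζ) xs a b = ∑ i, ∫ ω, stochHess g i xs (ζ i ω) a b ∂P := by
  set e : EuclideanSpace ℝ (Fin d) := EuclideanSpace.single b 1 with he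
  have hline : HasDerivAt (fun t : ℝ => xs + t • e) e 0 := by
    simpa using ((hasDerivAt_id (0 : ℝ)).smul_const e).const_add xs
  have hcoord : ∀ {f : ℝ → EuclideanSpace ℝ (Fin d)} {f' : EuclideanSpace ℝ (Fin d)},
      HasDerivAt f f' 0 → HasDerivAt (fun t => f t a) (f' a) 0 := fun {f f'} h =>
    (EuclideanSpace.proj (𝕜 := ℝ) a).hasFDerivAt.comp_hasDerivAt (0 : ℝ) h
  have h1 : HasDerivAt (fun t : ℝ => gradient (globalCost P g ζ) (xs + t • e) a)
      (hessian (globalCost P g ζ) xs a b) 0 := by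
    rw [← toEuclideanCLM_single (hessian (globalCost P g ζ) xs) a b]
    refine hcoord (HasFDerivAt.comp_hasDerivAt (l := gradient (globalCost P g ζ)) (0 : ℝ) ?_ hline)
    rw [zero_smul, add_zero]
    exact hasFDerivAt_gradient_globalCost hobj
  have h2 : ∀ i, HasDerivAt (fun t : ℝ => gradient (localCost P g ζ i) (xs + t • e) a)
      (∫ ω, stochHess g i xs (ζ i ω) a b ∂P) 0 := fun i => by
    have hco : ∀ x, gradient (localCost P g ζ i) x a = ∫ ω, stochGrad g i x (ζ i ω) a ∂P :=
      fun x => by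
      rw [gradient_localCost hobj hζ]
      exact ((EuclideanSpace.proj (𝕜 := ℝ) a).integral_comp_comm
        (integrable_stochGrad hobj hζ i x)).symm
    simp only [hco]
    refine (hasDerivAt_integral_of_dominated_loc_of_lip (μ := P) (𝕜 := ℝ)
      (F := fun t ω => stochGrad g i (xs + t • e) (ζ i ω) a) (s := Set.univ)
      (bound := fun ω => Lip i (ζ i ω)) univ_mem (Eventually.of_forall fun t => ?_) ?_
      (integrable_stochHess_entry_optimal hobj hhess hζ i a b).aestronglyMeasurable ?_
      (integrable_Lip hobj hζ i) ?_).2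
    · exact ((measurable_coord a).comp
        ((measurable_stochGrad hobj i _).comp (hζ i))).aestronglyMeasurable
    · exact (EuclideanSpace.proj (𝕜 := ℝ) a).integrable_comp (integrable_stochGrad hobj hζ i _)
    · refine ae_of_all _ fun ω => LipschitzOnWith.of_dist_le_mul fun t _ t' _ => ?_
      rw [Real.coe_nnabs, abs_of_pos (hobj.Lip_pos i _), Real.dist_eq, Real.dist_eq]
      refine (abs_coord_le (stochGrad g i (xs + t • e) (ζ i ω)
        - stochGrad g i (xs + t' • e) (ζ i ω)) a).trans ?_
      refine (hobj.lipschitz i (ζ i ω) _ _).trans (le_of_eq ?_)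
      rw [add_sub_add_left_eq_sub, ← sub_smul, norm_smul, he]
      simp
    · refine ae_of_all _ fun ω => ?_
      rw [stochHess, hessian_coord]
      refine hcoord (HasFDerivAt.comp_hasDerivAt (0 : ℝ) (l := fun x => stochGrad g i x (ζ i ω))
        ?_ hline)
      rw [zero_smul, add_zero]
      exact (hhess.twice_differentiable i (ζ i ω) xs).hasFDerivAt
  have h3 := HasDerivAt.fun_sum (u := Finset.univ) fun i _ => h2 i
  refine h1.unique ?_
  convert h3 using 2 with t
  rw [gradient_globalCost hobj hζ]
  simp

end Oracle

/-! ### One step of the push-pull iteration -/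

section PushPullStep

variable {n : ℕ} {V : Type*} [NormedAddCommGroup V] [InnerProductSpace ℝ V]
  {A B : Matrix (Fin n) (Fin n) ℝ} {w v : Fin n → ℝ}

theorem mix_vecMulVec (p q : Fin n → ℝ) (x : Fin n → V) :
    mix (Matrix.vecMulVec p q) x = fun i => p i • wsum q x := by
  ext i
  simp [mix_apply, wsum_apply, Matrix.vecMulVec_apply, mul_smul, Finset.smul_sum]

theorem mix_const (hA1 : ∀ i, ∑ j, A i j = 1) (c : V) :
    mix A (fun _ => c) = fun _ => c := by
  ext i
  rw [mix_apply, ← Finset.sum_smul, hA1, one_smul]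

theorem wsum_one_mix (hB1 : ∀ j, ∑ i, B i j = 1) (x : Fin n → V) :
    wsum 1 (mix B x) = wsum 1 x := by
  have h : (1 : Fin n → ℝ) ᵥ* B = 1 := by
    ext j
    simp [Matrix.vecMul, dotProduct, hB1]
  rw [wsum_mix, h]

/-- The consensus error contracts up to a multiple of the search direction. -/
theorem consensus_step (hA1 : ∀ i, ∑ j, A i j = 1) (hw1 : ∑ i, w i = 1) (hw : w ᵥ* A = w)
    (x y : Fin n → V) (α : ℝ) :
    (mix A x - α • y - fun _ => wsum w (mix A x - α • y)) =
      mix (A - Matrix.vecMulVec 1 w) (x - fun _ => wsum w x)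
        + (-α) • (y - fun _ => wsum w y) := by
  have h1 : wsum w (x - fun _ => wsum w x) = 0 := by
    rw [map_sub, wsum_const hw1, sub_self]
  rw [mix_sub_matrix, mix_vecMulVec, h1, map_sub, map_sub, mix_const hA1, wsum_mix, hw]
  ext i
  simp only [Pi.sub_apply, Pi.add_apply, Pi.smul_apply, Pi.neg_apply, map_smul, smul_zero, smul_sub,
    neg_smul, sub_zero]
  abel

/-- The tracking residual `s = y - G` follows a contractive recursion driven by `G`. -/
theorem residual_step {s : Fin n → V} (hs : wsum 1 s = 0) (G : Fin n → V) :
    mix B (s + G) - G = mix (B - Matrix.vecMulVec v 1) s + (mix B G - G) := by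
  rw [mix_sub_matrix, mix_vecMulVec, hs, map_add]
  ext i
  simp only [Pi.sub_apply, Pi.add_apply, smul_zero, sub_zero]
  abel

theorem wsum_one_residual_step (hB1 : ∀ j, ∑ i, B i j = 1) {s : Fin n → V} (hs : wsum 1 s = 0)
    (G : Fin n → V) : wsum 1 (mix B (s + G) - G) = 0 := by
  rw [map_sub, wsum_one_mix hB1, map_add, hs, zero_add, sub_self]

/-- The averaged search direction is the sum of the gradients up to a telescoping term. -/
theorem wsum_direction {q : Fin n → ℝ} {c : ℝ} (hq : ∀ i, q i - (Bᵀ *ᵥ q) i = w i - c)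
    {s : Fin n → V} (hs : wsum 1 s = 0) (G : Fin n → V) :
    wsum w (s + G) = c • wsum 1 G + wsum q (s - (mix B (s + G) - G)) := by
  have h1 : s - (mix B (s + G) - G) = (s + G) - mix B (s + G) := by abel
  have h2 : wsum q (s + G) - wsum (q ᵥ* B) (s + G) = wsum w (s + G) - c • wsum 1 (s + G) := by
    simp only [wsum_apply, Finset.smul_sum, ← Finset.sum_sub_distrib, ← sub_smul, smul_smul]
    refine Finset.sum_congr rfl fun i _ => ?_
    rw [← Matrix.mulVec_transpose, hq]
    simp
  rw [h1, map_sub, wsum_mix, h2, map_add (wsum 1), hs, zero_add]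
  abel

/-- Here `β` stands for the decrement of the step size. Being of order `α²`, it leaves the drift
`-2αc⟨e, g⟩` as the only first-order term. The drift is kept exact because its sign appears only
after taking expectations. -/
theorem energy_step {e g r : V} {α β c κ αmax : ℝ} (hα0 : 0 ≤ α) (hα : α ≤ αmax) (hβ0 : 0 ≤ β)
    (hβ : β ≤ κ * α ^ 2) :
    ‖e - (α * c) • g + β • r‖ ^ 2 ≤ ‖e‖ ^ 2 - 2 * α * c * inner ℝ e g
      + α ^ 2 * (κ * ‖e‖ ^ 2 + (κ + 2 * κ ^ 2 * αmax ^ 2) * ‖r‖ ^ 2 + 2 * c ^ 2 * ‖g‖ ^ 2) := by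
  have h1 : ‖e - (α * c) • g + β • r‖ ^ 2 = ‖e‖ ^ 2 - 2 * α * c * inner ℝ e g
      + 2 * β * inner ℝ e r + ‖β • r - (α * c) • g‖ ^ 2 := by
    rw [sub_add_eq_add_sub, add_sub_assoc, norm_add_sq_real, inner_sub_right, inner_smul_right,
      inner_smul_right]
    ring
  have h2 : ‖β • r - (α * c) • g‖ ^ 2 ≤ 2 * β ^ 2 * ‖r‖ ^ 2 + 2 * α ^ 2 * c ^ 2 * ‖g‖ ^ 2 := by
    have h3 := norm_sub_le (β • r) ((α * c) • g)
    have h4 : ‖β • r - (α * c) • g‖ ^ 2 ≤ (‖β • r‖ + ‖(α * c) • g‖) ^ 2 := by gcongr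
    have h5 : ‖β • r‖ ^ 2 = β ^ 2 * ‖r‖ ^ 2 := by
      rw [norm_smul, mul_pow, Real.norm_eq_abs, sq_abs]
    have h6 : ‖(α * c) • g‖ ^ 2 = α ^ 2 * c ^ 2 * ‖g‖ ^ 2 := by
      rw [norm_smul, mul_pow, Real.norm_eq_abs, sq_abs, mul_pow]
    nlinarith [sq_nonneg (‖β • r‖ - ‖(α * c) • g‖)]
  have h7 : 2 * inner ℝ e r ≤ ‖e‖ ^ 2 + ‖r‖ ^ 2 := by
    have := real_inner_le_norm e r
    nlinarith [sq_nonneg (‖e‖ - ‖r‖)]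
  have h8 : 2 * β * inner ℝ e r ≤ κ * α ^ 2 * (‖e‖ ^ 2 + ‖r‖ ^ 2) := by
    have h9 : β * (2 * inner ℝ e r) ≤ β * (‖e‖ ^ 2 + ‖r‖ ^ 2) := mul_le_mul_of_nonneg_left h7 hβ0
    have h10 : β * (‖e‖ ^ 2 + ‖r‖ ^ 2) ≤ κ * α ^ 2 * (‖e‖ ^ 2 + ‖r‖ ^ 2) :=
      mul_le_mul_of_nonneg_right hβ (by positivity)
    linarith
  have h11 : β ^ 2 * ‖r‖ ^ 2 ≤ κ ^ 2 * αmax ^ 2 * α ^ 2 * ‖r‖ ^ 2 := by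
    refine mul_le_mul_of_nonneg_right ?_ (sq_nonneg _)
    calc β ^ 2 ≤ (κ * α ^ 2) ^ 2 := by gcongr
      _ = κ ^ 2 * α ^ 2 * α ^ 2 := by ring
      _ ≤ _ := by gcongr
  rw [h1]
  linarith

/-- Strong monotonicity of the aggregate field survives evaluation at nearby points. -/
theorem inner_field_ge {m : Fin n → V → V} {xs : V} {K μ : ℝ} (hK : 0 ≤ K) (hμ : 0 < μ)
    (hLip : ∀ i x y, ‖m i x - m i y‖ ≤ K * ‖x - y‖)
    (hmono : ∀ x, μ * ‖x - xs‖ ^ 2 ≤ inner ℝ (x - xs) (∑ i, m i x))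
    {z : V} {x : Fin n → V} {δ : ℝ} (hδ : ∀ i, ‖x i - z‖ ≤ δ) :
    μ / 2 * ‖z - xs‖ ^ 2 - (n * K) ^ 2 / (2 * μ) * δ ^ 2 ≤
      inner ℝ (z - xs) (∑ i, m i (x i)) := by
  have h1 : ∑ i, m i (x i) = ∑ i, m i z + ∑ i, (m i (x i) - m i z) := by
    simp [Finset.sum_sub_distrib]
  have h2 : ‖∑ i, (m i (x i) - m i z)‖ ≤ n * K * δ := by
    refine (norm_sum_le_of_le _ fun i _ => (hLip i (x i) z).trans
      (mul_le_mul_of_nonneg_left (hδ i) hK)).trans ?_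
    simp [mul_assoc]
  have h3 : -(‖z - xs‖ * (n * K * δ)) ≤ inner ℝ (z - xs) (∑ i, (m i (x i) - m i z)) := by
    have h4 := abs_real_inner_le_norm (z - xs) (∑ i, (m i (x i) - m i z))
    have h5 : ‖z - xs‖ * ‖∑ i, (m i (x i) - m i z)‖ ≤ ‖z - xs‖ * (n * K * δ) := by gcongr
    have := neg_abs_le (inner ℝ (z - xs) (∑ i, (m i (x i) - m i z)))
    linarith
  have h6 : ‖z - xs‖ * (n * K * δ) ≤ μ / 2 * ‖z - xs‖ ^ 2 + (n * K) ^ 2 / (2 * μ) * δ ^ 2 := by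
    have : μ / 2 * ‖z - xs‖ ^ 2 + (n * K) ^ 2 / (2 * μ) * δ ^ 2 - ‖z - xs‖ * (n * K * δ) =
        (μ * ‖z - xs‖ - n * K * δ) ^ 2 / (2 * μ) := by
      field_simp
      ring
    have h7 : 0 ≤ (μ * ‖z - xs‖ - n * K * δ) ^ 2 / (2 * μ) := by positivity
    linarith
  rw [h1, inner_add_right]
  linarith [hmono z]

end PushPullStep

/-! ### Quadratic bounds for one step -/

section QuadraticBounds

variable {n : ℕ} {V : Type*} [NormedAddCommGroup V] [InnerProductSpace ℝ V]
  {A B : Matrix (Fin n) (Fin n) ℝ} {w v : Fin n → ℝ}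

theorem norm_add_sq_le {E : Type*} [SeminormedAddCommGroup E] (x y : E) :
    ‖x + y‖ ^ 2 ≤ 2 * (‖x‖ ^ 2 + ‖y‖ ^ 2) := by
  have h1 : ‖x + y‖ ^ 2 ≤ (‖x‖ + ‖y‖) ^ 2 := by gcongr; exact norm_add_le x y
  nlinarith [sq_nonneg (‖x‖ - ‖y‖)]

theorem norm_sub_wsum_le (w : Fin n → ℝ) (y : Fin n → V) :
    ‖y - fun _ => wsum w y‖ ≤ (1 + ∑ j, |w j|) * ‖y‖ := by
  have h1 : ‖fun _ : Fin n => wsum w y‖ ≤ (∑ j, |w j|) * ‖y‖ :=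
    (pi_norm_le_iff_of_nonneg (by positivity)).2 fun _ => norm_wsum_le w y
  have := norm_sub_le y fun _ => wsum w y
  linarith

/-- The constant is chosen before the state and the step size, so that the bound can be integrated
over trajectories and used at every time. -/
theorem exists_consensus_sq_le {ρ C : ℝ} (hρ0 : 0 ≤ ρ) (hρ1 : ρ < 1) {N : (Fin n → V) → ℝ}
    (hN0 : ∀ x, 0 ≤ N x)
    (hN : ∀ x h, N (mix (A - Matrix.vecMulVec 1 w) x + h) ≤ ρ * N x + C * ‖h‖)
    (hA1 : ∀ i, ∑ j, A i j = 1) (hw1 : ∑ i, w i = 1) (hw : w ᵥ* A = w) :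
    ∃ D, 0 ≤ D ∧ ∀ (x s G : Fin n → V) (α : ℝ),
      N (mix A x - α • (s + G) - fun _ => wsum w (mix A x - α • (s + G))) ^ 2 ≤
        ρ * N (x - fun _ => wsum w x) ^ 2 + D * α ^ 2 * (‖s‖ ^ 2 + ‖G‖ ^ 2) := by
  have h1ρ : 0 < 1 - ρ := by linarith
  refine ⟨C ^ 2 / (1 - ρ) * ((1 + ∑ j, |w j|) ^ 2 * 2), by positivity, fun x s G α => ?_⟩
  rw [consensus_step hA1 hw1 hw]
  refine (sq_le_of_contraction hρ0 hρ1 (hN0 _) (hN _ _)).trans (add_le_add_right ?_ _)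
  have h2 : ‖(-α) • (s + G - fun _ => wsum w (s + G))‖ ^ 2 ≤
      α ^ 2 * ((1 + ∑ j, |w j|) ^ 2 * (2 * (‖s‖ ^ 2 + ‖G‖ ^ 2))) := by
    rw [norm_smul, mul_pow, norm_neg, Real.norm_eq_abs, sq_abs]
    gcongr
    calc _ ≤ ((1 + ∑ j, |w j|) * ‖s + G‖) ^ 2 := by gcongr; exact norm_sub_wsum_le w _
      _ = (1 + ∑ j, |w j|) ^ 2 * ‖s + G‖ ^ 2 := by ring
      _ ≤ _ := by gcongr; exact norm_add_sq_le s G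
  calc _ ≤ C ^ 2 / (1 - ρ) * (α ^ 2 * ((1 + ∑ j, |w j|) ^ 2 * (2 * (‖s‖ ^ 2 + ‖G‖ ^ 2)))) := by
        gcongr
    _ = _ := by ring

theorem exists_residual_sq_le {ρ C : ℝ} (hρ0 : 0 ≤ ρ) (hρ1 : ρ < 1) {N : (Fin n → V) → ℝ}
    (hN0 : ∀ x, 0 ≤ N x)
    (hN : ∀ x h, N (mix (B - Matrix.vecMulVec v 1) x + h) ≤ ρ * N x + C * ‖h‖) :
    ∃ D, 0 ≤ D ∧ ∀ (s G : Fin n → V), wsum 1 s = 0 →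
      N (mix B (s + G) - G) ^ 2 ≤ ρ * N s ^ 2 + D * ‖G‖ ^ 2 := by
  have h1ρ : 0 < 1 - ρ := by linarith
  obtain ⟨b, hb0, hb⟩ := exists_norm_mix_le (V := V) B
  refine ⟨C ^ 2 / (1 - ρ) * (b + 1) ^ 2, by positivity, fun s G hs => ?_⟩
  rw [residual_step (v := v) hs]
  refine (sq_le_of_contraction hρ0 hρ1 (hN0 _) (hN _ _)).trans (add_le_add_right ?_ _)
  have h2 : ‖mix B G - G‖ ≤ (b + 1) * ‖G‖ := by
    have := norm_sub_le (mix B G) G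
    linarith [hb G]
  calc _ ≤ C ^ 2 / (1 - ρ) * ((b + 1) * ‖G‖) ^ 2 := by gcongr
    _ = _ := by ring

/-- Summation by parts: `wsum_direction` contributes `-α q(s - s')`, and the corrections `-α q(s)`
before and `-α' q(s')` after the step absorb all of it but `(α - α') q(s')`. The corrected error
therefore makes a gradient step perturbed at second order in `α`. -/
theorem exists_energy_sq_le {q : Fin n → ℝ} {c : ℝ}
    (hq : ∀ i, q i - (Bᵀ *ᵥ q) i = w i - c) (hw : w ᵥ* A = w) (xs : V) {κ αmax : ℝ}
    (hκ : 0 ≤ κ) :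
    ∃ D, 0 ≤ D ∧ ∀ (x s G : Fin n → V) (α α' : ℝ), wsum 1 s = 0 → 0 ≤ α → α ≤ αmax → α' ≤ α →
      α - α' ≤ κ * α ^ 2 →
      ‖wsum w (mix A x - α • (s + G)) - α' • wsum q (mix B (s + G) - G) - xs‖ ^ 2 ≤
        ‖wsum w x - α • wsum q s - xs‖ ^ 2
          - 2 * α * c * inner ℝ (wsum w x - α • wsum q s - xs) (wsum 1 G)
          + D * α ^ 2 * (‖wsum w x - α • wsum q s - xs‖ ^ 2 + ‖s‖ ^ 2 + ‖G‖ ^ 2) := by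
  obtain ⟨b, hb0, hb⟩ := exists_norm_mix_le (V := V) B
  set Q := ∑ j, |q j| with hQ
  have hQ0 : 0 ≤ Q := by positivity
  set R := (κ + 2 * κ ^ 2 * αmax ^ 2) * (2 * Q ^ 2 * (b + 1) ^ 2) with hR
  have hR0 : 0 ≤ R := by positivity
  set T := 2 * c ^ 2 * (n : ℝ) ^ 2 with hT
  have hT0 : 0 ≤ T := by positivity
  refine ⟨κ + R + T, by positivity, fun x s G α α' hs hα0 hα hα' hκα => ?_⟩
  set e := wsum w x - α • wsum q s - xs with he
  set s' := mix B (s + G) - G with hs'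
  have hstep : wsum w (mix A x - α • (s + G)) - α' • wsum q s' - xs =
      e - (α * c) • wsum 1 G + (α - α') • wsum q s' := by
    rw [map_sub, wsum_mix, hw, map_smul, wsum_direction hq hs, map_sub, he, ← hs', smul_add,
      smul_smul, smul_sub, sub_smul]
    abel
  have h1 := energy_step (e := e) (g := wsum 1 G) (r := wsum q s') (c := c) hα0 hα
    (sub_nonneg.2 hα') hκα
  have hr : ‖wsum q s'‖ ^ 2 ≤ 2 * Q ^ 2 * (b + 1) ^ 2 * (‖s‖ ^ 2 + ‖G‖ ^ 2) := by
    have h2 : ‖wsum q s'‖ ≤ Q * ((b + 1) * (‖s‖ + ‖G‖)) := by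
      refine (norm_wsum_le q s').trans (mul_le_mul_of_nonneg_left ?_ hQ0)
      have h3 := norm_sub_le (mix B (s + G)) G
      have h4 : b * ‖s + G‖ ≤ b * (‖s‖ + ‖G‖) := by gcongr; exact norm_add_le _ _
      have := norm_nonneg s
      linarith [hb (s + G)]
    calc _ ≤ (Q * ((b + 1) * (‖s‖ + ‖G‖))) ^ 2 := by gcongr
      _ = Q ^ 2 * (b + 1) ^ 2 * (‖s‖ + ‖G‖) ^ 2 := by ring
      _ ≤ Q ^ 2 * (b + 1) ^ 2 * (2 * (‖s‖ ^ 2 + ‖G‖ ^ 2)) := by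
        gcongr
        nlinarith [sq_nonneg (‖s‖ - ‖G‖)]
      _ = _ := by ring
  have hg : ‖wsum 1 G‖ ^ 2 ≤ (n : ℝ) ^ 2 * ‖G‖ ^ 2 := by
    have := norm_wsum_le 1 G
    simp only [Pi.one_apply, abs_one, Finset.sum_const, Finset.card_univ, Fintype.card_fin,
      nsmul_eq_mul, mul_one] at this
    calc _ ≤ ((n : ℝ) * ‖G‖) ^ 2 := by gcongr
      _ = _ := by ring
  rw [hstep]
  refine h1.trans (add_le_add_right ?_ _)
  rw [mul_comm (κ + R + T) (α ^ 2), mul_assoc (α ^ 2) (κ + R + T)]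
  refine mul_le_mul_of_nonneg_left ?_ (sq_nonneg α)
  have k1 : (κ + 2 * κ ^ 2 * αmax ^ 2) * ‖wsum q s'‖ ^ 2 ≤ R * (‖s‖ ^ 2 + ‖G‖ ^ 2) := by
    rw [hR, mul_assoc (κ + 2 * κ ^ 2 * αmax ^ 2)]
    exact mul_le_mul_of_nonneg_left hr (by positivity)
  have k2 : 2 * c ^ 2 * ‖wsum 1 G‖ ^ 2 ≤ T * ‖G‖ ^ 2 := by
    rw [hT, mul_assoc (2 * c ^ 2)]
    exact mul_le_mul_of_nonneg_left hg (by positivity)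
  have k3 := sq_nonneg ‖e‖
  have k4 := sq_nonneg ‖s‖
  have k5 := sq_nonneg ‖G‖
  linarith [mul_nonneg hκ k4, mul_nonneg hκ k5, mul_nonneg hR0 k3, mul_nonneg hT0 k3,
    mul_nonneg hT0 k4]

theorem norm_sub_center_le (w q : Fin n → ℝ) (x s : Fin n → V) {α : ℝ} (hα : 0 ≤ α)
    (i : Fin n) : ‖x i - (wsum w x - α • wsum q s)‖ ≤
      ‖x - fun _ => wsum w x‖ + α * ((∑ j, |q j|) * ‖s‖) := by
  have h1 : x i - (wsum w x - α • wsum q s) = (x i - wsum w x) + α • wsum q s := by abel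
  rw [h1]
  refine (norm_add_le _ _).trans (add_le_add ?_ ?_)
  · exact norm_le_pi_norm (x - fun _ => wsum w x) i
  · rw [norm_smul, Real.norm_of_nonneg hα]
    exact mul_le_mul_of_nonneg_left (norm_wsum_le q s) hα

theorem exists_norm_sub_sq_le (w q : Fin n → ℝ) (xs : V) :
    ∃ D, 0 ≤ D ∧ ∀ (x s : Fin n → V) (α : ℝ), 0 ≤ α → ‖x - fun _ => xs‖ ^ 2 ≤
      D * (‖wsum w x - α • wsum q s - xs‖ ^ 2 + ‖x - fun _ => wsum w x‖ ^ 2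
        + α ^ 2 * ‖s‖ ^ 2) := by
  set Q := ∑ j, |q j| with hQ
  have hQ0 : 0 ≤ Q := by positivity
  refine ⟨3 * (1 + Q ^ 2), by positivity, fun x s α hα => ?_⟩
  set e := ‖wsum w x - α • wsum q s - xs‖
  set t := ‖x - fun _ => wsum w x‖
  have h1 : ‖x - fun _ => xs‖ ≤ e + t + α * (Q * ‖s‖) := by
    refine (pi_norm_le_iff_of_nonneg (by positivity)).2 fun i => ?_
    have h2 := norm_sub_center_le w q x s hα i
    have h3 := norm_sub_le_norm_sub_add_norm_sub (x i) (wsum w x - α • wsum q s) xs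
    simp only [Pi.sub_apply]
    linarith
  have h4 : (e + t + α * (Q * ‖s‖)) ^ 2 ≤ 3 * (e ^ 2 + t ^ 2 + (α * (Q * ‖s‖)) ^ 2) := by
    nlinarith [sq_nonneg (e - t), sq_nonneg (e - α * (Q * ‖s‖)), sq_nonneg (t - α * (Q * ‖s‖))]
  calc _ ≤ (e + t + α * (Q * ‖s‖)) ^ 2 := by gcongr
    _ ≤ _ := h4
    _ = 3 * (e ^ 2 + t ^ 2) + 3 * Q ^ 2 * (α ^ 2 * ‖s‖ ^ 2) := by ring
    _ ≤ _ := by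
      have : 0 ≤ Q ^ 2 * (e ^ 2 + t ^ 2) := by positivity
      have : 0 ≤ α ^ 2 * ‖s‖ ^ 2 := by positivity
      linarith

/-- Each agent evaluates its field at `x i`, not at the corrected centre. The distance is controlled
by the consensus error and `α ‖s‖`, and Young's inequality pays for it with half of the monotonicity
constant. -/
theorem exists_inner_field_ge {m : Fin n → V → V} {xs : V} {K μ : ℝ} (hK : 0 ≤ K) (hμ : 0 < μ)
    (hLip : ∀ i x y, ‖m i x - m i y‖ ≤ K * ‖x - y‖)
    (hmono : ∀ x, μ * ‖x - xs‖ ^ 2 ≤ inner ℝ (x - xs) (∑ i, m i x)) (w q : Fin n → ℝ) :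
    ∃ D, 0 ≤ D ∧ ∀ (x s : Fin n → V) (α : ℝ), 0 ≤ α →
      μ / 2 * ‖wsum w x - α • wsum q s - xs‖ ^ 2
        - D * (‖x - fun _ => wsum w x‖ ^ 2 + α ^ 2 * ‖s‖ ^ 2) ≤
      inner ℝ (wsum w x - α • wsum q s - xs) (∑ i, m i (x i)) := by
  set Q := ∑ j, |q j| with hQ
  refine ⟨(n * K) ^ 2 / (2 * μ) * (2 * (1 + Q ^ 2)), by positivity, fun x s α hα => ?_⟩
  set t := ‖x - fun _ => wsum w x‖
  have h1 := inner_field_ge hK hμ hLip hmono (z := wsum w x - α • wsum q s)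
    (norm_sub_center_le w q x s hα)
  have h2 : (t + α * (Q * ‖s‖)) ^ 2 ≤ 2 * (1 + Q ^ 2) * (t ^ 2 + α ^ 2 * ‖s‖ ^ 2) := by
    have h3 : (t + α * (Q * ‖s‖)) ^ 2 ≤ 2 * (t ^ 2 + (α * (Q * ‖s‖)) ^ 2) := by
      nlinarith [sq_nonneg (t - α * (Q * ‖s‖))]
    have h4 : 0 ≤ Q ^ 2 * t ^ 2 := by positivity
    have h5 : 0 ≤ α ^ 2 * ‖s‖ ^ 2 := by positivity
    nlinarith
  have h6 := mul_le_mul_of_nonneg_left h2 (by positivity : 0 ≤ (n * K) ^ 2 / (2 * μ))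
  rw [← mul_assoc] at h6
  linarith

end QuadraticBounds

/-! ### Mean-square convergence of the push-pull iteration -/

section MeanSquare

variable {Ω : Type*} [MeasurableSpace Ω] {P : Measure Ω}

theorem MeasureTheory.MemLp.comp_of_norm_le {E F : Type*} [NormedAddCommGroup E]
    [NormedAddCommGroup F] {f : Ω → E} (hf : MemLp f 2 P) {φ : E → F} (hφ : Continuous φ) {C : ℝ}
    (hC : ∀ x, ‖φ x‖ ≤ C * ‖x‖) : MemLp (fun ω => φ (f ω)) 2 P :=
  hf.of_le_mul (hφ.comp_aestronglyMeasurable hf.aestronglyMeasurable)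
    (ae_of_all _ fun ω => hC (f ω))

theorem MeasureTheory.MemLp.integrable_sq_norm {E : Type*} [NormedAddCommGroup E] {f : Ω → E}
    (hf : MemLp f 2 P) : Integrable (fun ω => ‖f ω‖ ^ 2) P :=
  (memLp_two_iff_integrable_sq_norm hf.aestronglyMeasurable).1 hf

theorem MeasureTheory.Integrable.sub_fun {f g : Ω → ℝ} (hf : Integrable f P)
    (hg : Integrable g P) : Integrable (fun ω => f ω - g ω) P :=
  hf.sub hg

variable {n : ℕ} {V : Type*} [NormedAddCommGroup V] [InnerProductSpace ℝ V]

theorem MeasureTheory.MemLp.wsum {f : Ω → Fin n → V} (hf : MemLp f 2 P) (w : Fin n → ℝ) :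
    MemLp (fun ω => wsum w (f ω)) 2 P :=
  hf.comp_of_norm_le (continuous_wsum w) (norm_wsum_le w)

theorem MeasureTheory.MemLp.mix {f : Ω → Fin n → V} (hf : MemLp f 2 P)
    (M : Matrix (Fin n) (Fin n) ℝ) : MemLp (fun ω => mix M (f ω)) 2 P := by
  obtain ⟨c, -, hc⟩ := exists_norm_mix_le (V := V) M
  exact hf.comp_of_norm_le (continuous_mix M) hc

theorem MeasureTheory.MemLp.integrable_real_inner {f g : Ω → V} (hf : MemLp f 2 P)
    (hg : MemLp g 2 P) : Integrable (fun ω => inner ℝ (f ω) (g ω)) P := by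
  refine (hf.integrable_sq_norm.add hg.integrable_sq_norm).mono'
    (hf.aestronglyMeasurable.inner hg.aestronglyMeasurable) (ae_of_all _ fun ω => ?_)
  have := norm_inner_le_norm (𝕜 := ℝ) (f ω) (g ω)
  simp only [Pi.add_apply]
  nlinarith [sq_nonneg (‖f ω‖ - ‖g ω‖), sq_nonneg (‖f ω‖), sq_nonneg (‖g ω‖)]

/-- A push-pull iteration driven by noisy gradients `G`, where `S = y - G` is the tracking
residual: square integrable, with unbiased gradients whose second moment grows at most
quadratically. -/
structure NoisyPushPull (P : Measure Ω) (A B : Matrix (Fin n) (Fin n) ℝ) (α : ℕ → ℝ)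
    (m : Fin n → V → V) (xs : V) (X S G : ℕ → Ω → Fin n → V) : Prop where
  X_succ : ∀ k ω, X (k + 1) ω = mix A (X k ω) - α k • (S k ω + G k ω)
  S_zero : ∀ ω, S 0 ω = 0
  S_succ : ∀ k ω, S (k + 1) ω = mix B (S k ω + G k ω) - G k ω
  memLp_X : ∀ k, MemLp (X k) 2 P
  memLp_S : ∀ k, MemLp (S k) 2 P
  memLp_G : ∀ k, MemLp (G k) 2 P
  gradient_moment : ∃ D, 0 ≤ D ∧ ∀ k,
    ∫ ω, ‖G k ω‖ ^ 2 ∂P ≤ D * (1 + ∫ ω, ‖X k ω - fun _ => xs‖ ^ 2 ∂P)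
  unbiased : ∀ (p q : Fin n → ℝ) (r : ℝ) (k : ℕ),
    ∫ ω, inner ℝ (wsum p (X k ω) - r • wsum q (S k ω) - xs) (wsum 1 (G k ω)) ∂P =
      ∫ ω, inner ℝ (wsum p (X k ω) - r • wsum q (S k ω) - xs) (∑ i, m i (X k ω i)) ∂P

/-- Conditions on the step sizes. -/
structure StepCondition (α : ℕ → ℝ) : Prop where
  nonneg : ∀ k, 0 ≤ α k
  succ_le : ∀ k, α (k + 1) ≤ α k
  tendsto : Tendsto α atTop (𝓝 0)
  not_summable : ¬ Summable α
  sub_le : ∃ κ, 0 ≤ κ ∧ ∀ k, α k - α (k + 1) ≤ κ * α k ^ 2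

theorem StepCondition.le_zero {α : ℕ → ℝ} (h : StepCondition α) (k : ℕ) : α k ≤ α 0 := by
  induction k with
  | zero => exact le_rfl
  | succ k ih => exact (h.succ_le k).trans ih

/-- The three moment recursions imply convergence. -/
theorem tendsto_of_moment_recursions {α : ℕ → ℝ} (hα : StepCondition α)
    {a b s σ g I : ℕ → ℝ} {ρA ρB μ c D₁ D₂ D₃ D₄ D₅ D₆ : ℝ} (hμ : 0 < μ) (hc : 0 < c)
    (hρA : ρA < 1) (hρB : ρB < 1) (h₁ : 0 ≤ D₁) (h₂ : 0 ≤ D₂) (h₃ : 0 ≤ D₃) (h₄ : 0 ≤ D₄)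
    (h₅ : 0 ≤ D₅) (h₆ : 0 ≤ D₆)
    (ha0 : ∀ k, 0 ≤ a k) (hb0 : ∀ k, 0 ≤ b k) (hs0 : ∀ k, 0 ≤ s k)
    (hσs : ∀ k, σ k ≤ s k)
    (hb : ∀ k, b (k + 1) ≤ ρA * b k + D₁ * α k ^ 2 * (σ k + g k))
    (hs : ∀ k, s (k + 1) ≤ ρB * s k + D₂ * g k)
    (ha : ∀ k, a (k + 1) ≤ a k - 2 * α k * c * I k + D₃ * α k ^ 2 * (a k + σ k + g k))
    (hI : ∀ k, μ / 2 * a k - D₄ * (b k + α k ^ 2 * s k) ≤ I k)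
    (hg : ∀ k, g k ≤ D₆ * (1 + D₅ * (a k + b k + α k ^ 2 * s k))) :
    Tendsto (fun k => D₅ * (a k + b k + α k ^ 2 * s k)) atTop (𝓝 0) := by
  set α₀ := α 0 with hα₀
  have hα₀0 : 0 ≤ α₀ := hα.nonneg 0
  -- Two bounds on the gradient moment are used. The sharp one, with constant `H`, contains `s` only
  -- through `α² s` and feeds the residual recursion, where a full multiple of `s` could destroy the
  -- contraction. The coarse one, with constant `H'`, suffices for the other two recursions, which
  -- carry a factor `α²` already.
  set H := D₆ * (1 + D₅) with hH
  have hH0 : 0 ≤ H := by positivity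
  set H' := H * (1 + α₀ ^ 2) with hH'
  have hH'0 : 0 ≤ H' := by positivity
  set C := 2 * c * D₄ + (2 * c * D₄ * α₀ + D₃ * (1 + H')) + D₁ * (1 + H') + D₂ * H with hC
  have hC0 : 0 ≤ C := by positivity
  have hg1 : ∀ k, g k ≤ H * (1 + a k + b k + α k ^ 2 * s k) := fun k => by
    have := ha0 k; have := hb0 k; have := hs0 k
    refine (hg k).trans ?_
    rw [hH, mul_assoc]
    refine mul_le_mul_of_nonneg_left ?_ h₆
    have : 0 ≤ α k ^ 2 * s k := by positivity
    linarith
  have hg2 : ∀ k, g k ≤ H' * (1 + a k + b k + s k) := fun k => by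
    have := ha0 k; have := hb0 k; have := hs0 k
    refine (hg1 k).trans ?_
    rw [hH', mul_assoc H]
    refine mul_le_mul_of_nonneg_left ?_ hH0
    have h1 : α k ^ 2 * s k ≤ α₀ ^ 2 * s k := by
      have := hα.nonneg k; have := hα.le_zero k
      gcongr
    have : 0 ≤ α₀ ^ 2 * (1 + a k + b k) := by positivity
    linarith
  have key := tendsto_zero_of_coupled_recursion (a := a) (b := b) (s := s) (α := α)
    (γ := μ * c) (ρ := max ρA ρB) (C := C) (by positivity) (max_lt hρA hρB) hC0 ha0 hb0 hs0
    hα.nonneg hα.succ_le hα.tendsto hα.not_summable ?_ ?_ ?_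
  · simpa using ((key.1.add key.2.1).add key.2.2).const_mul D₅
  · intro k
    have a0 := ha0 k; have b0 := hb0 k; have s0 := hs0 k; have al := hα.nonneg k
    have t1 : 2 * α k * c * (μ / 2 * a k - D₄ * (b k + α k ^ 2 * s k)) ≤ 2 * α k * c * I k :=
      mul_le_mul_of_nonneg_left (hI k) (by positivity)
    have t2 : a k + σ k + g k ≤ (1 + H') * (1 + a k + b k + s k) := by
      have := hg2 k; have := hσs k; linarith
    have t3 : D₃ * α k ^ 2 * (a k + σ k + g k) ≤
        D₃ * α k ^ 2 * ((1 + H') * (1 + a k + b k + s k)) :=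
      mul_le_mul_of_nonneg_left t2 (by positivity)
    have t4 : 2 * c * D₄ * α k * (α k ^ 2 * s k) ≤
        2 * c * D₄ * α₀ * (α k ^ 2 * (1 + a k + b k + s k)) := by
      have := hα.le_zero k
      gcongr
      linarith
    have t5 : 2 * c * D₄ * α k * b k ≤ C * α k * b k := by
      gcongr
      rw [hC]
      have : 0 ≤ (2 * c * D₄ * α₀ + D₃ * (1 + H')) + D₁ * (1 + H') + D₂ * H := by positivity
      linarith
    have t6 : (2 * c * D₄ * α₀ + D₃ * (1 + H')) * (α k ^ 2 * (1 + a k + b k + s k)) ≤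
        C * (α k ^ 2 * (1 + a k + b k + s k)) := by
      gcongr
      rw [hC]
      have : 0 ≤ 2 * c * D₄ + D₁ * (1 + H') + D₂ * H := by positivity
      linarith
    linarith [ha k]
  · intro k
    have a0 := ha0 k; have b0 := hb0 k; have s0 := hs0 k
    have t2 : σ k + g k ≤ (1 + H') * (1 + a k + b k + s k) := by
      have := hg2 k; have := hσs k; linarith
    have t3 : D₁ * α k ^ 2 * (σ k + g k) ≤ D₁ * α k ^ 2 * ((1 + H') * (1 + a k + b k + s k)) :=
      mul_le_mul_of_nonneg_left t2 (by positivity)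
    have t4 : D₁ * (1 + H') * (α k ^ 2 * (1 + a k + b k + s k)) ≤
        C * (α k ^ 2 * (1 + a k + b k + s k)) := by
      gcongr
      rw [hC]
      have : 0 ≤ 2 * c * D₄ + (2 * c * D₄ * α₀ + D₃ * (1 + H')) + D₂ * H := by positivity
      linarith
    have t5 : ρA * b k ≤ max ρA ρB * b k := mul_le_mul_of_nonneg_right (le_max_left _ _) b0
    linarith [hb k]
  · intro k
    have a0 := ha0 k; have b0 := hb0 k; have s0 := hs0 k
    have t3 : D₂ * g k ≤ D₂ * (H * (1 + a k + b k + α k ^ 2 * s k)) :=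
      mul_le_mul_of_nonneg_left (hg1 k) h₂
    have t4 : D₂ * H * (1 + a k + b k + α k ^ 2 * s k) ≤ C * (1 + a k + b k + α k ^ 2 * s k) := by
      gcongr
      rw [hC]
      have : 0 ≤ 2 * c * D₄ + (2 * c * D₄ * α₀ + D₃ * (1 + H')) + D₁ * (1 + H') := by positivity
      linarith
    have t5 : ρB * s k ≤ max ρA ρB * s k := mul_le_mul_of_nonneg_right (le_max_right _ _) s0
    linarith [hs k]

variable {A B : Matrix (Fin n) (Fin n) ℝ} {α : ℕ → ℝ}
  {m : Fin n → V → V} {xs : V} {X S G : ℕ → Ω → Fin n → V} {w v : Fin n → ℝ}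

theorem NoisyPushPull.wsum_one_S (h : NoisyPushPull P A B α m xs X S G)
    (hB1 : ∀ j, ∑ i, B i j = 1) (k : ℕ) (ω : Ω) : wsum 1 (S k ω) = 0 := by
  induction k with
  | zero => rw [h.S_zero, map_zero]
  | succ k ih => rw [h.S_succ, wsum_one_residual_step hB1 ih]

variable [IsProbabilityMeasure P]

theorem continuous_field {V : Type*} [NormedAddCommGroup V] {m : Fin n → V → V} {K : ℝ}
    (hLip : ∀ i x y, ‖m i x - m i y‖ ≤ K * ‖x - y‖) (i : Fin n) :
    Continuous (m i) :=
  (LipschitzWith.of_dist_le_mul (K := Real.toNNReal K) fun x y => by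
    rw [dist_eq_norm, dist_eq_norm]
    exact (hLip i x y).trans (by gcongr; exact Real.le_coe_toNNReal K)).continuous

theorem memLp_field {V : Type*} [NormedAddCommGroup V] {m : Fin n → V → V} {K : ℝ}
    (hLip : ∀ i x y, ‖m i x - m i y‖ ≤ K * ‖x - y‖)
    {f : Ω → Fin n → V} (hf : MemLp f 2 P) : MemLp (fun ω => ∑ i, m i (f ω i)) 2 P := by
  refine memLp_finsetSum _ fun i _ => ?_
  have h1 : MemLp (fun ω => m i (f ω i) - m i 0) 2 P :=
    hf.comp_of_norm_le (φ := fun x => m i (x i) - m i 0)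
      (((continuous_field hLip i).comp (continuous_apply i)).sub continuous_const) (C := |K|)
      fun x => (hLip i (x i) 0).trans (by
        rw [sub_zero]
        exact mul_le_mul (le_abs_self K) (norm_le_pi_norm x i) (norm_nonneg _) (abs_nonneg _))
  refine (memLp_congr_ae (ae_of_all _ fun ω => ?_)).1 (h1.add (memLp_const (m i 0)))
  simp

theorem NoisyPushPull.tendsto_integral_sq (h : NoisyPushPull P A B α m xs X S G)
    (hα : StepCondition α) {K μ : ℝ} (hK : 0 ≤ K) (hμ : 0 < μ)
    (hLip : ∀ i x y, ‖m i x - m i y‖ ≤ K * ‖x - y‖)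
    (hmono : ∀ x, μ * ‖x - xs‖ ^ 2 ≤ inner ℝ (x - xs) (∑ i, m i x))
    (hA1 : ∀ i, ∑ j, A i j = 1) (hB1 : ∀ j, ∑ i, B i j = 1)
    (hw1 : ∑ i, w i = 1) (hw : w ᵥ* A = w)
    (hA : ∀ i j, Tendsto (fun k => ((A - Matrix.vecMulVec (1 : Fin n → ℝ) w) ^ k) i j) atTop (𝓝 0))
    (hB : ∀ i j, Tendsto (fun k => ((B - Matrix.vecMulVec v (1 : Fin n → ℝ)) ^ k) i j) atTop (𝓝 0))
    {q : Fin n → ℝ} {c : ℝ} (hc : 0 < c) (hq : ∀ i, q i - (Bᵀ *ᵥ q) i = w i - c) :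
    Tendsto (fun k => ∫ ω, ‖X k ω - fun _ => xs‖ ^ 2 ∂P) atTop (𝓝 0) := by
  obtain ⟨ρA, CA, hρA0, hρA1, -, NA, hNAc, hNAge, hNAle, hNA⟩ := exists_adapted_norm V hA
  obtain ⟨ρB, CB, hρB0, hρB1, -, NB, hNBc, hNBge, hNBle, hNB⟩ := exists_adapted_norm V hB
  have hNA0 : ∀ x, 0 ≤ NA x := fun x => (norm_nonneg x).trans (hNAge x)
  have hNB0 : ∀ x, 0 ≤ NB x := fun x => (norm_nonneg x).trans (hNBge x)
  obtain ⟨κ, hκ0, hκ⟩ := hα.sub_le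
  obtain ⟨D₁, h₁, hD₁⟩ := exists_consensus_sq_le hρA0.le hρA1 hNA0 hNA hA1 hw1 hw
  obtain ⟨D₂, h₂, hD₂⟩ := exists_residual_sq_le hρB0.le hρB1 hNB0 hNB
  obtain ⟨D₃, h₃, hD₃⟩ := exists_energy_sq_le hq hw xs (αmax := α 0) hκ0
  obtain ⟨D₄, h₄, hD₄⟩ := exists_inner_field_ge hK hμ hLip hmono w q
  obtain ⟨D₅, h₅, hD₅⟩ := exists_norm_sub_sq_le w q xs
  obtain ⟨D₆, h₆, hD₆⟩ := h.gradient_moment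
  set e : ℕ → Ω → V := fun k ω => wsum w (X k ω) - α k • wsum q (S k ω) - xs with he
  set t : ℕ → Ω → Fin n → V := fun k ω => X k ω - fun _ => wsum w (X k ω) with ht
  have heL : ∀ k, MemLp (e k) 2 P := fun k =>
    (((h.memLp_X k).wsum w).sub (((h.memLp_S k).wsum q).const_smul (α k))).sub (memLp_const xs)
  have htL : ∀ k, MemLp (t k) 2 P := fun k =>
    (h.memLp_X k).comp_of_norm_le (φ := fun x => x - fun _ => wsum w x)
      (continuous_id.sub (continuous_pi fun _ => continuous_wsum w)) (norm_sub_wsum_le w)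
  have hNAi : ∀ k, Integrable (fun ω => NA (t k ω) ^ 2) P := fun k =>
    ((htL k).comp_of_norm_le hNAc fun x => by
      rw [Real.norm_of_nonneg (hNA0 x)]; exact hNAle x).integrable_sq
  have hNBi : ∀ k, Integrable (fun ω => NB (S k ω) ^ 2) P := fun k =>
    ((h.memLp_S k).comp_of_norm_le hNBc fun x => by
      rw [Real.norm_of_nonneg (hNB0 x)]; exact hNBle x).integrable_sq
  have hei := fun k => (heL k).integrable_sq_norm
  have hti := fun k => (htL k).integrable_sq_norm
  have hSi := fun k => (h.memLp_S k).integrable_sq_norm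
  have hGi := fun k => (h.memLp_G k).integrable_sq_norm
  have heg := fun k => (heL k).integrable_real_inner ((h.memLp_G k).wsum 1)
  have hem := fun k => (heL k).integrable_real_inner (memLp_field hLip (h.memLp_X k))
  have hXi : ∀ k, Integrable (fun ω => ‖X k ω - fun _ => xs‖ ^ 2) P := fun k =>
    ((h.memLp_X k).sub (memLp_const fun _ => xs)).integrable_sq_norm
  have hSN : ∀ k, ∫ ω, ‖S k ω‖ ^ 2 ∂P ≤ ∫ ω, NB (S k ω) ^ 2 ∂P := fun k =>
    integral_mono (hSi k) (hNBi k) fun ω => by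
      have := hNBge (S k ω)
      simp only
      gcongr
  have htN : ∀ k, ∫ ω, ‖t k ω‖ ^ 2 ∂P ≤ ∫ ω, NA (t k ω) ^ 2 ∂P := fun k =>
    integral_mono (hti k) (hNAi k) fun ω => by
      have := hNAge (t k ω)
      simp only
      gcongr
  have hX : ∀ k, ∫ ω, ‖X k ω - fun _ => xs‖ ^ 2 ∂P ≤
      D₅ * (∫ ω, ‖e k ω‖ ^ 2 ∂P + ∫ ω, NA (t k ω) ^ 2 ∂P
        + α k ^ 2 * ∫ ω, NB (S k ω) ^ 2 ∂P) := fun k => by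
    calc _ ≤ ∫ ω, D₅ * (‖e k ω‖ ^ 2 + ‖t k ω‖ ^ 2 + α k ^ 2 * ‖S k ω‖ ^ 2) ∂P :=
          integral_mono (hXi k)
            ((((hei k).fun_add (hti k)).fun_add ((hSi k).const_mul _)).const_mul _)
            fun ω => hD₅ (X k ω) (S k ω) (α k) (hα.nonneg k)
      _ = D₅ * (∫ ω, ‖e k ω‖ ^ 2 ∂P + ∫ ω, ‖t k ω‖ ^ 2 ∂P + α k ^ 2 * ∫ ω, ‖S k ω‖ ^ 2 ∂P) := by
          rw [integral_const_mul, integral_add ((hei k).fun_add (hti k)) ((hSi k).const_mul _),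
            integral_add (hei k) (hti k), integral_const_mul]
      _ ≤ _ := by
          have := htN k; have := hSN k
          gcongr
  refine squeeze_zero (fun k => integral_nonneg fun ω => sq_nonneg _) hX ?_
  refine tendsto_of_moment_recursions hα (σ := fun k => ∫ ω, ‖S k ω‖ ^ 2 ∂P)
    (g := fun k => ∫ ω, ‖G k ω‖ ^ 2 ∂P) (I := fun k => ∫ ω, inner ℝ (e k ω) (wsum 1 (G k ω)) ∂P)
    hμ hc hρA1 hρB1 h₁ h₂ h₃ h₄ h₅ h₆ (fun k => integral_nonneg fun ω => sq_nonneg _)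
    (fun k => integral_nonneg fun ω => sq_nonneg _) (fun k => integral_nonneg fun ω => sq_nonneg _)
    hSN ?_ ?_ ?_ ?_ ?_
  · intro k
    calc _ ≤ ∫ ω, (ρA * NA (t k ω) ^ 2 + D₁ * α k ^ 2 * (‖S k ω‖ ^ 2 + ‖G k ω‖ ^ 2)) ∂P := by
          refine integral_mono (hNAi _)
            (((hNAi k).const_mul _).fun_add (((hSi k).fun_add (hGi k)).const_mul _)) fun ω => ?_
          simp only [ht, h.X_succ]
          exact hD₁ (X k ω) (S k ω) (G k ω) (α k)
      _ = _ := by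
          rw [integral_add ((hNAi k).const_mul _) (((hSi k).fun_add (hGi k)).const_mul _),
            integral_const_mul, integral_const_mul, integral_add (hSi k) (hGi k)]
  · intro k
    calc _ ≤ ∫ ω, (ρB * NB (S k ω) ^ 2 + D₂ * ‖G k ω‖ ^ 2) ∂P := by
          refine integral_mono (hNBi _) (((hNBi k).const_mul _).fun_add ((hGi k).const_mul _))
            fun ω => ?_
          simp only [h.S_succ]
          exact hD₂ (S k ω) (G k ω) (h.wsum_one_S hB1 k ω)
      _ = _ := by
          rw [integral_add ((hNBi k).const_mul _) ((hGi k).const_mul _), integral_const_mul,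
            integral_const_mul]
  · intro k
    calc _ ≤ ∫ ω, (‖e k ω‖ ^ 2 - 2 * α k * c * inner ℝ (e k ω) (wsum 1 (G k ω))
            + D₃ * α k ^ 2 * (‖e k ω‖ ^ 2 + ‖S k ω‖ ^ 2 + ‖G k ω‖ ^ 2)) ∂P := by
          refine integral_mono (hei _) (((hei k).sub_fun ((heg k).const_mul _)).add
            ((((hei k).fun_add (hSi k)).fun_add (hGi k)).const_mul _)) fun ω => ?_
          simp only [he, h.X_succ, h.S_succ]
          exact hD₃ (X k ω) (S k ω) (G k ω) (α k) (α (k + 1)) (h.wsum_one_S hB1 k ω)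
            (hα.nonneg k) (hα.le_zero k) (hα.succ_le k) (hκ k)
      _ = _ := by
          rw [integral_add ((hei k).sub_fun ((heg k).const_mul _))
            ((((hei k).fun_add (hSi k)).fun_add (hGi k)).const_mul _),
            integral_sub (hei k) ((heg k).const_mul _), integral_const_mul, integral_const_mul,
            integral_add ((hei k).fun_add (hSi k)) (hGi k), integral_add (hei k) (hSi k)]
  · intro k
    -- Unbiasedness enters here only: in the drift the noisy gradients are replaced by the mean
    -- field, to which strong monotonicity applies.
    rw [h.unbiased w q (α k) k]
    calc _ ≤ μ / 2 * ∫ ω, ‖e k ω‖ ^ 2 ∂P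
            - D₄ * (∫ ω, ‖t k ω‖ ^ 2 ∂P + α k ^ 2 * ∫ ω, ‖S k ω‖ ^ 2 ∂P) := by
          have := htN k; have := hSN k
          gcongr
      _ = ∫ ω, (μ / 2 * ‖e k ω‖ ^ 2 - D₄ * (‖t k ω‖ ^ 2 + α k ^ 2 * ‖S k ω‖ ^ 2)) ∂P := by
          rw [integral_sub ((hei k).const_mul _)
            (((hti k).fun_add ((hSi k).const_mul _)).const_mul _), integral_const_mul,
            integral_const_mul, integral_add (hti k) ((hSi k).const_mul _), integral_const_mul]
      _ ≤ _ := integral_mono (((hei k).const_mul _).sub_fun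
            (((hti k).fun_add ((hSi k).const_mul _)).const_mul _)) (hem k)
            fun ω => hD₄ (X k ω) (S k ω) (α k) (hα.nonneg k)
  · intro k
    refine (hD₆ k).trans ?_
    have := hX k
    gcongr

end MeanSquare

/-! ### The push-pull iteration driven by random samples -/

section RandomIteration

variable {Ω : Type*} {n d : ℕ} {Z : Fin n → Type*}
  {g : ∀ i, EuclideanSpace ℝ (Fin d) → Z i → ℝ}
  {ζs : ℕ → ∀ i, Ω → Z i} {x0 : Fin n → Ω → EuclideanSpace ℝ (Fin d)}
  {A B : Matrix (Fin n) (Fin n) ℝ} {step : ℕ → ℝ}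

/-- The random iterates `x_k`. -/
noncomputable def iterX (A B : Matrix (Fin n) (Fin n) ℝ) (g : ∀ i, EuclideanSpace ℝ (Fin d) → Z i → ℝ)
    (step : ℕ → ℝ) (x0 : Fin n → Ω → EuclideanSpace ℝ (Fin d)) (ζs : ℕ → ∀ i, Ω → Z i)
    (k : ℕ) (ω : Ω) : Fin n → EuclideanSpace ℝ (Fin d) :=
  (sabIter A B g step (fun j => x0 j ω) (fun t j => ζs t j ω) k).1

/-- The random gradients `∇ g_{i,k}`. -/
noncomputable def iterG (A B : Matrix (Fin n) (Fin n) ℝ) (g : ∀ i, EuclideanSpace ℝ (Fin d) → Z i → ℝ)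
    (step : ℕ → ℝ) (x0 : Fin n → Ω → EuclideanSpace ℝ (Fin d)) (ζs : ℕ → ∀ i, Ω → Z i)
    (k : ℕ) (ω : Ω) : Fin n → EuclideanSpace ℝ (Fin d) :=
  gradIter A B g step (fun j => x0 j ω) (fun t j => ζs t j ω) k

/-- The tracking residual `y_k - ∇ g_k`. -/
noncomputable def iterS (A B : Matrix (Fin n) (Fin n) ℝ) (g : ∀ i, EuclideanSpace ℝ (Fin d) → Z i → ℝ)
    (step : ℕ → ℝ) (x0 : Fin n → Ω → EuclideanSpace ℝ (Fin d)) (ζs : ℕ → ∀ i, Ω → Z i)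
    (k : ℕ) (ω : Ω) : Fin n → EuclideanSpace ℝ (Fin d) :=
  (sabIter A B g step (fun j => x0 j ω) (fun t j => ζs t j ω) k).2 - iterG A B g step x0 ζs k ω

theorem iterG_apply (k : ℕ) (ω : Ω) (i : Fin n) :
    iterG A B g step x0 ζs k ω i = stochGrad g i (iterX A B g step x0 ζs k ω i) (ζs k i ω) := rfl

theorem iterX_succ (k : ℕ) (ω : Ω) : iterX A B g step x0 ζs (k + 1) ω =
    mix A (iterX A B g step x0 ζs k ω)
      - step k • (iterS A B g step x0 ζs k ω + iterG A B g step x0 ζs k ω) := by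
  rw [iterS, sub_add_cancel]
  rfl

theorem iterS_zero (ω : Ω) : iterS A B g step x0 ζs 0 ω = 0 := by
  ext i
  simp [iterS, iterG, gradIter, sabIter]

theorem iterS_succ (k : ℕ) (ω : Ω) : iterS A B g step x0 ζs (k + 1) ω =
    mix B (iterS A B g step x0 ζs k ω + iterG A B g step x0 ζs k ω)
      - iterG A B g step x0 ζs k ω := by
  rw [iterS, iterS, sub_add_cancel]
  funext i
  simp only [Pi.sub_apply, mix_apply]
  rw [sabIter]
  simp only [iterG, gradIter]
  rw [sabIter]
  abel

end RandomIteration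

section History

variable {Ω : Type*} {n d : ℕ} {Z : Fin n → Type*} [∀ i, MeasurableSpace (Z i)]

/-- The information available before the samples at time `k` are drawn. -/
@[reducible] def history (x0 : Fin n → Ω → EuclideanSpace ℝ (Fin d)) (ζs : ℕ → ∀ i, Ω → Z i)
    (k : ℕ) : MeasurableSpace Ω :=
  past (fun ω i => x0 i ω) (fun t ω i => ζs t i ω) k

theorem measurable_history_sample {x0 : Fin n → Ω → EuclideanSpace ℝ (Fin d)}
    {ζs : ℕ → ∀ i, Ω → Z i} {k t : ℕ} (h : t < k) (i : Fin n) :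
    Measurable[history x0 ζs k] (ζs t i) :=
  (measurable_pi_apply i).comp
    (measurable_past_sample (fun ω i => x0 i ω) (fun t ω i => ζs t i ω) h)

theorem measurable_mix {m : MeasurableSpace Ω} {f : Ω → Fin n → EuclideanSpace ℝ (Fin d)}
    (hf : Measurable f) (M : Matrix (Fin n) (Fin n) ℝ) : Measurable fun ω => mix M (f ω) :=
  (continuous_mix M).measurable.comp hf

theorem measurable_stochGrad_comp {Ω' : Type*} [MeasurableSpace Ω'] {P : Measure Ω'}
    {g : ∀ i, EuclideanSpace ℝ (Fin d) → Z i → ℝ} {ζ : ∀ i, Ω' → Z i} {Lip : ∀ i, Z i → ℝ}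
    {xs : EuclideanSpace ℝ (Fin d)} (hobj : ObjectiveAssumption P g ζ Lip xs) (i : Fin n)
    {m : MeasurableSpace Ω} {f : Ω → EuclideanSpace ℝ (Fin d)} {h : Ω → Z i}
    (hf : Measurable f) (hh : Measurable h) : Measurable fun ω => stochGrad g i (f ω) (h ω) :=
  (measurable_stochGrad_uncurry hobj i).comp (hf.prodMk hh)

theorem sq_norm_pi_le_sum {V : Type*} [NormedAddCommGroup V] (x : Fin n → V) :
    ‖x‖ ^ 2 ≤ ∑ i, ‖x i‖ ^ 2 := by
  have h : ‖x‖ ≤ √(∑ i, ‖x i‖ ^ 2) := by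
    refine (pi_norm_le_iff_of_nonneg (Real.sqrt_nonneg _)).2 fun i => ?_
    refine Real.le_sqrt_of_sq_le ?_
    exact Finset.single_le_sum (f := fun i => ‖x i‖ ^ 2) (fun i _ => sq_nonneg _)
      (Finset.mem_univ i)
  calc ‖x‖ ^ 2 ≤ √(∑ i, ‖x i‖ ^ 2) ^ 2 := by gcongr
    _ = _ := Real.sq_sqrt (Finset.sum_nonneg fun i _ => sq_nonneg _)

end History

/-! ### Measurability, moments and unbiasedness along the random iteration -/

section RandomIterationMoments

variable {Ω : Type*} [mΩ : MeasurableSpace Ω] {P : Measure Ω} {n d : ℕ} {Z : Fin n → Type*}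
  [∀ i, MeasurableSpace (Z i)]
  {g : ∀ i, EuclideanSpace ℝ (Fin d) → Z i → ℝ} {ζ : ∀ i, Ω → Z i} {Lip : ∀ i, Z i → ℝ}
  {ζs : ℕ → ∀ i, Ω → Z i} {x0 : Fin n → Ω → EuclideanSpace ℝ (Fin d)}
  {xs : EuclideanSpace ℝ (Fin d)} {A B : Matrix (Fin n) (Fin n) ℝ} {step : ℕ → ℝ}

/-- The reason for working with `y - G`: the recursion for the residual at time `k + 1` involves
samples up to time `k` only, whereas `y` contains the current gradient. Iterate and residual are
thus both independent of the samples at their own time. -/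
theorem measurable_iter (hobj : ObjectiveAssumption P g ζ Lip xs) (k : ℕ) :
    Measurable[history x0 ζs k] (iterX A B g step x0 ζs k) ∧
      Measurable[history x0 ζs k] (iterS A B g step x0 ζs k) := by
  induction k with
  | zero =>
    refine ⟨measurable_past_init (fun ω i => x0 i ω) (fun t ω i => ζs t i ω) 0, ?_⟩
    have : iterS A B g step x0 ζs 0 = fun _ => 0 := funext iterS_zero
    rw [this]
    exact measurable_const
  | succ k ih =>
    have hle : history x0 ζs k ≤ history x0 ζs (k + 1) := past_mono _ _ (Nat.le_succ k)
    have hX := ih.1.mono hle le_rfl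
    have hS := ih.2.mono hle le_rfl
    have hG : Measurable[history x0 ζs (k + 1)] (iterG A B g step x0 ζs k) :=
      @measurable_pi_lambda _ _ _ (history x0 ζs (k + 1)) _ _ fun i =>
        measurable_stochGrad_comp hobj i ((measurable_pi_apply i).comp hX)
          (measurable_history_sample (Nat.lt_succ_self k) i)
    have eX : iterX A B g step x0 ζs (k + 1) = fun ω => mix A (iterX A B g step x0 ζs k ω)
      - step k • (iterS A B g step x0 ζs k ω + iterG A B g step x0 ζs k ω) := funext (iterX_succ k)
    have eS : iterS A B g step x0 ζs (k + 1) = fun ω =>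
      mix B (iterS A B g step x0 ζs k ω + iterG A B g step x0 ζs k ω)
      - iterG A B g step x0 ζs k ω := funext (iterS_succ k)
    rw [eX, eS]
    exact ⟨(measurable_mix hX A).sub ((hS.add hG).const_smul (step k)),
      (measurable_mix (hS.add hG) B).sub hG⟩

theorem memLp_of_components {V : Type*} [NormedAddCommGroup V] {f : Ω → Fin n → V}
    (hf : AEStronglyMeasurable f P) (h : ∀ i, MemLp (fun ω => f ω i) 2 P) : MemLp f 2 P := by
  have h1 : MemLp (fun ω => ∑ i, ‖f ω i‖) 2 P := memLp_finsetSum _ fun i _ => (h i).norm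
  refine h1.of_le hf (ae_of_all _ fun ω => ?_)
  refine (pi_norm_le_iff_of_nonneg (norm_nonneg _)).2 fun i => ?_
  rw [Real.norm_of_nonneg (Finset.sum_nonneg fun i _ => norm_nonneg _)]
  exact Finset.single_le_sum (f := fun i => ‖f ω i‖) (fun i _ => norm_nonneg _) (Finset.mem_univ i)

theorem SamplingModel.measurable_samples (h : SamplingModel P ζ ζs x0) (k : ℕ) :
    Measurable fun ω i => ζs k i ω :=
  measurable_pi_lambda _ fun i => h.measurable_sample k i

theorem SamplingModel.history_le (h : SamplingModel P ζ ζs x0) (k : ℕ) :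
    history x0 ζs k ≤ mΩ :=
  past_le (measurable_pi_lambda _ h.measurable_init) h.measurable_samples k

variable [IsProbabilityMeasure P]

theorem SamplingModel.indepFun_sample (h : SamplingModel P ζ ζs x0) {γ : Type*}
    [MeasurableSpace γ] {k : ℕ} {W : Ω → γ} (hW : Measurable[history x0 ζs k] W) (i : Fin n) :
    IndepFun W (ζs k i) P := by
  have h1 := indepFun_of_measurable_past (measurable_pi_lambda _ h.measurable_init)
    h.measurable_samples h.indep_time h.indep_init hW
  exact h1.comp measurable_id (measurable_pi_apply i)

theorem SamplingModel.expectationLE_sample (h : SamplingModel P ζ ζs x0) {k : ℕ}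
    {W : Ω → EuclideanSpace ℝ (Fin d)} (hW : Measurable[history x0 ζs k] W) {i : Fin n}
    {φ : EuclideanSpace ℝ (Fin d) × Z i → ℝ} (hφ : Measurable φ) (hφ0 : ∀ p, 0 ≤ φ p)
    {ψ : EuclideanSpace ℝ (Fin d) → ℝ}
    (hψ : ∀ x, ExpectationLE P (fun ω => φ (x, ζ i ω)) (ψ x))
    (hψW : Integrable (fun ω => ψ (W ω)) P) :
    ExpectationLE P (fun ω => φ (W ω, ζs k i ω)) (∫ ω, ψ (W ω) ∂P) :=
  expectationLE_comp_of_indepFun (hW.mono (h.history_le k) le_rfl) (h.measurable_sample k i)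
    (h.measurable_zeta i) (h.indepFun_sample hW i) (h.identDistrib k i) hφ hφ0 hψ hψW

theorem measurable_meanGradient (hobj : ObjectiveAssumption P g ζ Lip xs)
    (hζ : ∀ i, Measurable (ζ i)) (i : Fin n) : Measurable (gradient (localCost P g ζ i)) := by
  obtain ⟨K, -, hL⟩ := exists_lipschitz_gradient_localCost hobj hζ
  exact (continuous_field hL i).measurable

theorem measurable_noise (hobj : ObjectiveAssumption P g ζ Lip xs)
    (hζ : ∀ i, Measurable (ζ i)) (i : Fin n) :
    Measurable fun p : EuclideanSpace ℝ (Fin d) × Z i =>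
      stochGrad g i p.1 p.2 - gradient (localCost P g ζ i) p.1 :=
  (measurable_stochGrad_uncurry hobj i).sub
    ((measurable_meanGradient hobj hζ i).comp measurable_fst)

/-- The noise in the gradients has bounded second moments, whatever the iterate. -/
theorem exists_noise_bound (hobj : ObjectiveAssumption P g ζ Lip xs)
    (h : SamplingModel P ζ ζs x0) : ∃ σ : ℝ, 0 ≤ σ ∧ ∀ k i (W : Ω → EuclideanSpace ℝ (Fin d)),
      Measurable[history x0 ζs k] W → ExpectationLE P
        (fun ω => ‖stochGrad g i (W ω) (ζs k i ω) - gradient (localCost P g ζ i) (W ω)‖ ^ 2) σ := by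
  obtain ⟨σ, hσ⟩ := exists_variance_bound hobj h.measurable_zeta
  refine ⟨max σ 0, le_max_right _ _, fun k i W hW => ?_⟩
  have := h.expectationLE_sample hW
    (φ := fun p => ‖stochGrad g i p.1 p.2 - gradient (localCost P g ζ i) p.1‖ ^ 2)
    ((measurable_noise hobj h.measurable_zeta i).norm.pow_const 2) (fun p => sq_nonneg _)
    (ψ := fun _ => σ) (hσ i) (integrable_const σ)
  simp only [integral_const, probReal_univ, one_smul] at this
  exact ⟨this.1, this.2.trans (le_max_left _ _)⟩

/-- The gradient is noise plus mean field. The noise has bounded second moment whatever the iterate,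
and the mean field is Lipschitz, so it inherits square integrability from the iterate. -/
theorem memLp_iterG (hobj : ObjectiveAssumption P g ζ Lip xs) (h : SamplingModel P ζ ζs x0)
    {k : ℕ} (hX : MemLp (iterX A B g step x0 ζs k) 2 P) :
    MemLp (iterG A B g step x0 ζs k) 2 P ∧
      ∀ i, MemLp (fun ω => iterG A B g step x0 ζs k ω i
        - gradient (localCost P g ζ i) (iterX A B g step x0 ζs k ω i)) 2 P := by
  obtain ⟨σ, -, hσ⟩ := exists_noise_bound hobj h
  obtain ⟨K, -, hL⟩ := exists_lipschitz_gradient_localCost hobj h.measurable_zeta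
  have hXm : Measurable (iterX A B g step x0 ζs k) :=
    (measurable_iter hobj k).1.mono (h.history_le k) le_rfl
  have hGm : ∀ i, Measurable fun ω => iterG A B g step x0 ζs k ω i := fun i =>
    measurable_stochGrad_comp hobj i ((measurable_pi_apply i).comp hXm) (h.measurable_sample k i)
  have h1 : ∀ i, MemLp (fun ω => iterG A B g step x0 ζs k ω i
        - gradient (localCost P g ζ i) (iterX A B g step x0 ζs k ω i)) 2 P := fun i => by
    refine (memLp_two_iff_integrable_sq_norm ?_).2
      (hσ k i _ ((measurable_pi_apply i).comp (measurable_iter hobj k).1)).1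
    exact ((hGm i).sub ((measurable_meanGradient hobj h.measurable_zeta i).comp
      ((measurable_pi_apply i).comp hXm))).aestronglyMeasurable
  refine ⟨memLp_of_components (measurable_pi_lambda _ hGm).aestronglyMeasurable fun i => ?_, h1⟩
  have h2 : MemLp (fun ω => gradient (localCost P g ζ i) (iterX A B g step x0 ζs k ω i)
      - gradient (localCost P g ζ i) 0) 2 P :=
    hX.comp_of_norm_le (φ := fun x => gradient (localCost P g ζ i) (x i)
        - gradient (localCost P g ζ i) 0)
      (((continuous_field hL i).comp (continuous_apply i)).sub continuous_const) (C := |K|)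
      fun x => (hL i (x i) 0).trans (by
        rw [sub_zero]
        exact mul_le_mul (le_abs_self K) (norm_le_pi_norm x i) (norm_nonneg _) (abs_nonneg _))
  refine (memLp_congr_ae (ae_of_all _ fun ω => ?_)).1 (((h1 i).add h2).add
    (memLp_const (gradient (localCost P g ζ i) 0)))
  simp

theorem memLp_iter (hobj : ObjectiveAssumption P g ζ Lip xs) (h : SamplingModel P ζ ζs x0)
    (hx0 : MemLp (fun ω i => x0 i ω) 2 P) (k : ℕ) :
    MemLp (iterX A B g step x0 ζs k) 2 P ∧ MemLp (iterS A B g step x0 ζs k) 2 P := by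
  induction k with
  | zero =>
    refine ⟨hx0, ?_⟩
    have : iterS A B g step x0 ζs 0 = fun _ => 0 := funext iterS_zero
    rw [this]
    exact memLp_const 0
  | succ k ih =>
    have hG := (memLp_iterG hobj h ih.1).1
    have eX : iterX A B g step x0 ζs (k + 1) = fun ω => mix A (iterX A B g step x0 ζs k ω)
      - step k • (iterS A B g step x0 ζs k ω + iterG A B g step x0 ζs k ω) := funext (iterX_succ k)
    have eS : iterS A B g step x0 ζs (k + 1) = fun ω =>
      mix B (iterS A B g step x0 ζs k ω + iterG A B g step x0 ζs k ω)
      - iterG A B g step x0 ζs k ω := funext (iterS_succ k)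
    rw [eX, eS]
    exact ⟨(ih.1.mix A).sub ((ih.2.add hG).const_smul (step k)), ((ih.2.add hG).mix B).sub hG⟩

theorem exists_gradient_moment (hobj : ObjectiveAssumption P g ζ Lip xs)
    (h : SamplingModel P ζ ζs x0) (hx0 : MemLp (fun ω i => x0 i ω) 2 P) :
    ∃ D, 0 ≤ D ∧ ∀ k, ∫ ω, ‖iterG A B g step x0 ζs k ω‖ ^ 2 ∂P ≤
      D * (1 + ∫ ω, ‖iterX A B g step x0 ζs k ω - fun _ => xs‖ ^ 2 ∂P) := by
  obtain ⟨σ, hσ0, hσ⟩ := exists_noise_bound hobj h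
  obtain ⟨K, hK0, hL⟩ := exists_lipschitz_gradient_localCost hobj h.measurable_zeta
  set M := ∑ i, ‖gradient (localCost P g ζ i) xs‖ ^ 2 with hM
  have hM0 : 0 ≤ M := by positivity
  refine ⟨n * (2 * σ) + 4 * M + n * (4 * K ^ 2), by positivity, fun k => ?_⟩
  obtain ⟨hX, -⟩ := memLp_iter (A := A) (B := B) (step := step) hobj h hx0 k
  obtain ⟨hG, hN⟩ := memLp_iterG hobj h hX
  have hD : Integrable (fun ω => ‖iterX A B g step x0 ζs k ω - fun _ => xs‖ ^ 2) P :=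
    (hX.sub (memLp_const fun _ => xs)).integrable_sq_norm
  have hpt : ∀ ω, ‖iterG A B g step x0 ζs k ω‖ ^ 2 ≤
      ∑ i, (2 * ‖iterG A B g step x0 ζs k ω i
        - gradient (localCost P g ζ i) (iterX A B g step x0 ζs k ω i)‖ ^ 2
        + (4 * ‖gradient (localCost P g ζ i) xs‖ ^ 2
          + 4 * K ^ 2 * ‖iterX A B g step x0 ζs k ω - fun _ => xs‖ ^ 2)) := fun ω => by
    refine (sq_norm_pi_le_sum _).trans (Finset.sum_le_sum fun i _ => ?_)
    set m := gradient (localCost P g ζ i) (iterX A B g step x0 ζs k ω i)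
    set m' := gradient (localCost P g ζ i) xs
    -- The splitting is noise, then deviation of the mean gradient from its value at `xs`, then that
    -- value. Using `‖x + y‖² ≤ 2(‖x‖² + ‖y‖²)` twice gives the factors `2`, `4`, `4`.
    have h1 := norm_add_sq_le (iterG A B g step x0 ζs k ω i - m) m
    have h2 := norm_add_sq_le (m - m') m'
    rw [sub_add_cancel] at h1 h2
    have h3 : ‖m - m'‖ ^ 2 ≤ (K * ‖iterX A B g step x0 ζs k ω - fun _ => xs‖) ^ 2 := by
      gcongr
      exact (hL i _ _).trans (mul_le_mul_of_nonneg_left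
        (norm_le_pi_norm (iterX A B g step x0 ζs k ω - fun _ => xs) i) hK0)
    rw [mul_pow] at h3
    linarith
  have hNi := fun i => (hN i).integrable_sq_norm
  have hterm : ∀ i, Integrable (fun ω => 2 * ‖iterG A B g step x0 ζs k ω i
        - gradient (localCost P g ζ i) (iterX A B g step x0 ζs k ω i)‖ ^ 2
        + (4 * ‖gradient (localCost P g ζ i) xs‖ ^ 2
          + 4 * K ^ 2 * ‖iterX A B g step x0 ζs k ω - fun _ => xs‖ ^ 2)) P := fun i =>
    ((hNi i).const_mul 2).fun_add ((integrable_const _).fun_add (hD.const_mul _))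
  have hD0 : 0 ≤ ∫ ω, ‖iterX A B g step x0 ζs k ω - fun _ => xs‖ ^ 2 ∂P :=
    integral_nonneg fun ω => sq_nonneg _
  calc _ ≤ ∫ ω, ∑ i, (2 * ‖iterG A B g step x0 ζs k ω i
        - gradient (localCost P g ζ i) (iterX A B g step x0 ζs k ω i)‖ ^ 2
        + (4 * ‖gradient (localCost P g ζ i) xs‖ ^ 2
          + 4 * K ^ 2 * ‖iterX A B g step x0 ζs k ω - fun _ => xs‖ ^ 2)) ∂P :=
        integral_mono hG.integrable_sq_norm (integrable_finsetSum _ fun i _ => hterm i) hpt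
    _ = ∑ i, (2 * ∫ ω, ‖iterG A B g step x0 ζs k ω i
        - gradient (localCost P g ζ i) (iterX A B g step x0 ζs k ω i)‖ ^ 2 ∂P
        + (4 * ‖gradient (localCost P g ζ i) xs‖ ^ 2
          + 4 * K ^ 2 * ∫ ω, ‖iterX A B g step x0 ζs k ω - fun _ => xs‖ ^ 2 ∂P)) := by
        rw [integral_finsetSum _ fun i _ => hterm i]
        refine Finset.sum_congr rfl fun i _ => ?_
        rw [integral_add ((hNi i).const_mul 2) ((integrable_const _).fun_add (hD.const_mul _)),
          integral_add (integrable_const _) (hD.const_mul _), integral_const_mul,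
          integral_const_mul]
        simp [integral_const_mul]
    _ ≤ ∑ i, (2 * σ + (4 * ‖gradient (localCost P g ζ i) xs‖ ^ 2
          + 4 * K ^ 2 * ∫ ω, ‖iterX A B g step x0 ζs k ω - fun _ => xs‖ ^ 2 ∂P)) := by
        refine Finset.sum_le_sum fun i _ => ?_
        have := (hσ k i (fun ω => iterX A B g step x0 ζs k ω i)
          ((measurable_pi_apply i).comp (measurable_iter hobj k).1)).2
        simp only [iterG_apply]
        linarith
    _ = n * (2 * σ) + 4 * M
          + n * (4 * K ^ 2) * ∫ ω, ‖iterX A B g step x0 ζs k ω - fun _ => xs‖ ^ 2 ∂P := by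
        rw [Finset.sum_add_distrib, Finset.sum_add_distrib, hM, Finset.mul_sum]
        simp only [Finset.sum_const, Finset.card_univ, Fintype.card_fin, nsmul_eq_mul]
        ring
    _ ≤ _ := by
        have h1 : 0 ≤ (n * (2 * σ) + 4 * M) *
          ∫ ω, ‖iterX A B g step x0 ζs k ω - fun _ => xs‖ ^ 2 ∂P := by positivity
        have h2 : 0 ≤ (n : ℝ) * (4 * K ^ 2) := by positivity
        linarith

/-- The pair formed by the test vector and the iterate belongs to the past. With it frozen, the
noise has mean zero, because the mean stochastic gradient is the gradient of the local cost. -/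
theorem integral_inner_noise (hobj : ObjectiveAssumption P g ζ Lip xs)
    (h : SamplingModel P ζ ζs x0) (hx0 : MemLp (fun ω i => x0 i ω) 2 P) {k : ℕ}
    {W : Ω → EuclideanSpace ℝ (Fin d)} (hW : Measurable[history x0 ζs k] W) (hW2 : MemLp W 2 P)
    (i : Fin n) : ∫ ω, inner ℝ (W ω) (iterG A B g step x0 ζs k ω i
        - gradient (localCost P g ζ i) (iterX A B g step x0 ζs k ω i)) ∂P = 0 := by
  obtain ⟨hX, -⟩ := memLp_iter (A := A) (B := B) (step := step) hobj h hx0 k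
  obtain ⟨-, hN⟩ := memLp_iterG hobj h hX
  have hXi : Measurable[history x0 ζs k] fun ω => iterX A B g step x0 ζs k ω i :=
    (measurable_pi_apply i).comp (measurable_iter hobj k).1
  have hWX : Measurable[history x0 ζs k] fun ω => (W ω, iterX A B g step x0 ζs k ω i) :=
    hW.prodMk hXi
  have hn := measurable_noise hobj h.measurable_zeta i
  refine integral_comp_eq_zero_of_indepFun (hWX.mono (h.history_le k) le_rfl)
    (h.measurable_sample k i) (h.measurable_zeta i) (h.indepFun_sample hWX i) (h.identDistrib k i)
    (φ := fun p => inner ℝ p.1.1 (stochGrad g i p.1.2 p.2 - gradient (localCost P g ζ i) p.1.2))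
    ?_ ?_ (hW2.integrable_real_inner (hN i))
  · exact (measurable_fst.comp measurable_fst).inner
      (hn.comp ((measurable_snd.comp measurable_fst).prodMk measurable_snd))
  · rintro ⟨w, x⟩
    have hint := integrable_stochGrad hobj h.measurable_zeta i x
    have hs : Integrable (fun ω => stochGrad g i x (ζ i ω) - gradient (localCost P g ζ i) x) P :=
      hint.sub (integrable_const _)
    change ∫ ω, inner ℝ w (stochGrad g i x (ζ i ω) - gradient (localCost P g ζ i) x) ∂P = 0
    rw [integral_inner hs, integral_sub hint (integrable_const _),
      gradient_localCost hobj h.measurable_zeta]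
    simp

theorem noisyPushPull_iter (hobj : ObjectiveAssumption P g ζ Lip xs)
    (h : SamplingModel P ζ ζs x0) (hx0 : MemLp (fun ω i => x0 i ω) 2 P) :
    NoisyPushPull P A B step (fun i => gradient (localCost P g ζ i)) xs
      (iterX A B g step x0 ζs) (iterS A B g step x0 ζs) (iterG A B g step x0 ζs) where
  X_succ := iterX_succ
  S_zero := iterS_zero
  S_succ := iterS_succ
  memLp_X k := (memLp_iter hobj h hx0 k).1
  memLp_S k := (memLp_iter hobj h hx0 k).2
  memLp_G k := (memLp_iterG hobj h (memLp_iter hobj h hx0 k).1).1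
  gradient_moment := exists_gradient_moment hobj h hx0
  unbiased p q r k := by
    obtain ⟨hX, hS⟩ := memLp_iter (A := A) (B := B) (step := step) hobj h hx0 k
    obtain ⟨hG, hN⟩ := memLp_iterG hobj h hX
    obtain ⟨hXm, hSm⟩ := measurable_iter (x0 := x0) (ζs := ζs) (A := A) (B := B) (step := step)
      hobj k
    obtain ⟨K, -, hL⟩ := exists_lipschitz_gradient_localCost hobj h.measurable_zeta
    set W : Ω → EuclideanSpace ℝ (Fin d) := fun ω =>
      wsum p (iterX A B g step x0 ζs k ω) - r • wsum q (iterS A B g step x0 ζs k ω) - xs with hWdef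
    have hW2 : MemLp W 2 P := ((hX.wsum p).sub ((hS.wsum q).const_smul r)).sub (memLp_const xs)
    have hW : Measurable[history x0 ζs k] W :=
      (((continuous_wsum p).measurable.comp hXm).sub
        (((continuous_wsum q).measurable.comp hSm).const_smul r)).sub_const xs
    rw [← sub_eq_zero, ← integral_sub (hW2.integrable_real_inner (hG.wsum 1))
      (hW2.integrable_real_inner (memLp_field hL hX))]
    have hpt : ∀ ω, inner ℝ (W ω) (wsum 1 (iterG A B g step x0 ζs k ω))
        - inner ℝ (W ω) (∑ i, gradient (localCost P g ζ i) (iterX A B g step x0 ζs k ω i)) =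
        ∑ i, inner ℝ (W ω) (iterG A B g step x0 ζs k ω i
          - gradient (localCost P g ζ i) (iterX A B g step x0 ζs k ω i)) := fun ω => by
      rw [← inner_sub_right, ← inner_sum]
      simp [wsum_apply, Finset.sum_sub_distrib]
    simp only [hpt]
    rw [integral_finsetSum _ fun i _ => hW2.integrable_real_inner (hN i)]
    exact Finset.sum_eq_zero fun i _ => integral_inner_noise hobj h hx0 hW hW2 i

end RandomIterationMoments

theorem stepCondition_rpow {a b α : ℝ} {step : ℕ → ℝ} (ha : 0 < a) (hb : 0 < b) (hα0 : 0 < α)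
    (hα : α ≤ 1) (hstep : ∀ k : ℕ, step k = a / ((k : ℝ) + b) ^ α) : StepCondition step where
  nonneg k := (step_pos ha hb hstep k).le
  succ_le := step_succ_le ha hb hα0.le hstep
  tendsto := tendsto_step hα0 hstep
  not_summable := not_summable_step ha hb hα0.le hα hstep
  sub_le := ⟨a⁻¹, (inv_pos.2 ha).le, step_sub_le ha hb hα0.le hα hstep⟩

theorem exists_root_reach {n : ℕ} {A B : Matrix (Fin n) (Fin n) ℝ} (h : WeightAssumption A B) :
    ∃ r, ∀ i, Relation.ReflTransGen (inducedGraph Bᵀ) r i := by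
  obtain ⟨r, -, T, hT⟩ := h.common_root
  exact ⟨r, fun i => Relation.ReflTransGen.mono (fun a b => hT.subgraph a b) r i (hT.reach i)⟩

theorem sq_integral_le {Ω : Type*} [MeasurableSpace Ω] {P : Measure Ω} [IsProbabilityMeasure P]
    {f : Ω → ℝ} (hf : MemLp f 2 P) : (∫ ω, f ω ∂P) ^ 2 ≤ ∫ ω, f ω ^ 2 ∂P := by
  have h := variance_nonneg f P
  rw [variance_eq_sub hf] at h
  simpa using h

/-! ### Mean-square convergence of iterates and gradients, convergence in mean of Hessians -/

section Convergence

variable {Ω : Type*} [mΩ : MeasurableSpace Ω] {P : Measure Ω} [IsProbabilityMeasure P] {n d : ℕ}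
  {Z : Fin n → Type*} [∀ i, MeasurableSpace (Z i)]
  {g : ∀ i, EuclideanSpace ℝ (Fin d) → Z i → ℝ} {ζ : ∀ i, Ω → Z i} {Lip : ∀ i, Z i → ℝ}
  {ζs : ℕ → ∀ i, Ω → Z i} {x0 : Fin n → Ω → EuclideanSpace ℝ (Fin d)}
  {xs : EuclideanSpace ℝ (Fin d)} {A B : Matrix (Fin n) (Fin n) ℝ} {step : ℕ → ℝ}
  {w v : Fin n → ℝ}

/-- Mean square convergence of the iterates for square integrable initial values. -/
theorem tendsto_integral_sq_iterX (hobj : ObjectiveAssumption P g ζ Lip xs)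
    (h : SamplingModel P ζ ζs x0) (hweight : WeightAssumption A B)
    (hconn : IsStronglyConnected (inducedGraph A)) (hstep : StepCondition step)
    (hw0 : ∀ i, 0 ≤ w i) (hw1 : ∑ i, w i = 1) (hw : w ᵥ* A = w)
    (hv0 : ∀ i, 0 ≤ v i) (hv1 : ∑ i, v i = 1) (hv : B *ᵥ v = v)
    (hx0 : MemLp (fun ω i => x0 i ω) 2 P) :
    Tendsto (fun k => ∫ ω, ‖iterX A B g step x0 ζs k ω - fun _ => xs‖ ^ 2 ∂P) atTop (𝓝 0) := by
  obtain ⟨r, hr⟩ := exists_root_reach hweight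
  obtain ⟨K, hK, hL⟩ := exists_lipschitz_gradient_localCost hobj h.measurable_zeta
  obtain ⟨μ, hμ, hmono⟩ := exists_strong_monotone hobj
  have hvT : v ᵥ* Bᵀ = v := by rw [Matrix.vecMul_transpose, hv]
  -- `Bᵀ` is row stochastic with stationary distribution `v`, so the Poisson equation with
  -- right-hand side `w` is solvable after subtraction of `c = v ⬝ᵥ w`. This `c` is positive because
  -- `w` is strictly positive and `v` is a probability vector.
  obtain ⟨q, hq⟩ := exists_poisson (M := Bᵀ) (fun i j => hweight.B_nonneg j i)
    hweight.B_col_stochastic hweight.B_diag_pos hr hv0 hv1 hvT w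
  have hpos := stationary_pos hweight.A_nonneg hweight.A_diag_pos hconn hw0 hw1 hw
  have hc : 0 < v ⬝ᵥ w := by
    refine lt_of_le_of_ne (Finset.sum_nonneg fun i _ => mul_nonneg (hv0 i) (hw0 i)) fun h0 => ?_
    have h1 := (Finset.sum_eq_zero_iff_of_nonneg
      fun i _ => mul_nonneg (hv0 i) (hw0 i)).1 h0.symm
    have h2 : ∀ i, v i = 0 := fun i =>
      (mul_eq_zero.1 (h1 i (Finset.mem_univ i))).resolve_right (hpos i).ne'
    simp [h2] at hv1
  refine (noisyPushPull_iter hobj h hx0).tendsto_integral_sq hstep hK hμ hL (fun x => ?_)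
    hweight.A_row_stochastic hweight.B_col_stochastic hw1 hw
    (tendsto_pow_sub_entry hweight.A_nonneg hweight.A_row_stochastic hweight.A_diag_pos
      (hconn r) hw0 hw1 hw) (v := v) (fun i j => ?_) hc hq
  · rw [← gradient_globalCost hobj h.measurable_zeta]
    exact hmono x
  · have := tendsto_pow_sub_entry (M := Bᵀ) (fun i j => hweight.B_nonneg j i)
      hweight.B_col_stochastic hweight.B_diag_pos hr hv0 hv1 hvT j i
    have e : ∀ k, (B - Matrix.vecMulVec v (1 : Fin n → ℝ)) ^ k =
        ((Bᵀ - Matrix.vecMulVec (1 : Fin n → ℝ) v) ^ k)ᵀ := fun k => by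
      rw [Matrix.transpose_pow, Matrix.transpose_sub, Matrix.transpose_transpose,
        Matrix.transpose_vecMulVec]
    simpa only [e, Matrix.transpose_apply] using this

theorem integrable_sq_iterX_sub (hobj : ObjectiveAssumption P g ζ Lip xs)
    (h : SamplingModel P ζ ζs x0) (hx0 : MemLp (fun ω i => x0 i ω) 2 P) (k : ℕ) (i : Fin n) :
    Integrable (fun ω => ‖iterX A B g step x0 ζs k ω i - xs‖ ^ 2) P ∧
      ∫ ω, ‖iterX A B g step x0 ζs k ω i - xs‖ ^ 2 ∂P ≤
        ∫ ω, ‖iterX A B g step x0 ζs k ω - fun _ => xs‖ ^ 2 ∂P := by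
  have hX := (memLp_iter (A := A) (B := B) (step := step) hobj h hx0 k).1
  have h1 : Integrable (fun ω => ‖iterX A B g step x0 ζs k ω - fun _ => xs‖ ^ 2) P :=
    (hX.sub (memLp_const fun _ => xs)).integrable_sq_norm
  have hXm : Measurable (iterX A B g step x0 ζs k) :=
    (measurable_iter hobj k).1.mono (h.history_le k) le_rfl
  have hle : ∀ ω, ‖iterX A B g step x0 ζs k ω i - xs‖ ^ 2 ≤
      ‖iterX A B g step x0 ζs k ω - fun _ => xs‖ ^ 2 := fun ω => by
    gcongr
    exact norm_le_pi_norm (iterX A B g step x0 ζs k ω - fun _ => xs) i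
  have h2 : Integrable (fun ω => ‖iterX A B g step x0 ζs k ω i - xs‖ ^ 2) P := by
    refine h1.mono' ?_ (ae_of_all _ fun ω => ?_)
    · exact ((((measurable_pi_apply i).comp hXm).sub_const xs).norm.pow_const 2).aestronglyMeasurable
    · rw [Real.norm_of_nonneg (sq_nonneg _)]
      exact hle ω
  exact ⟨h2, integral_mono h2 h1 hle⟩

/-- The gradients approach, in mean square, the gradients at the solution. -/
theorem tendsto_integral_sq_iterG (hobj : ObjectiveAssumption P g ζ Lip xs)
    (h : SamplingModel P ζ ζs x0) (hx0 : MemLp (fun ω i => x0 i ω) 2 P)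
    (hX : Tendsto (fun k => ∫ ω, ‖iterX A B g step x0 ζs k ω - fun _ => xs‖ ^ 2 ∂P) atTop (𝓝 0))
    (i : Fin n) :
    (∀ k, MemLp (fun ω => iterG A B g step x0 ζs k ω i - stochGrad g i xs (ζs k i ω)) 2 P) ∧
    Tendsto (fun k => ∫ ω, ‖iterG A B g step x0 ζs k ω i - stochGrad g i xs (ζs k i ω)‖ ^ 2 ∂P)
      atTop (𝓝 0) := by
  set L := ∫ ω, Lip i (ζ i ω) ^ 2 ∂P with hLdef
  have hL0 : 0 ≤ L := integral_nonneg fun ω => sq_nonneg _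
  have hLi : Integrable (fun ω => Lip i (ζ i ω) ^ 2) P :=
    (memLp_Lip hobj h.measurable_zeta i).integrable_sq
  have hm := measurable_stochGrad_uncurry hobj i
  have hφm : Measurable fun p : EuclideanSpace ℝ (Fin d) × Z i =>
      stochGrad g i p.1 p.2 - stochGrad g i xs p.2 :=
    hm.sub (hm.comp (measurable_const.prodMk measurable_snd))
  have hE : ∀ k, ExpectationLE P
      (fun ω => ‖iterG A B g step x0 ζs k ω i - stochGrad g i xs (ζs k i ω)‖ ^ 2)
      (∫ ω, L * ‖iterX A B g step x0 ζs k ω i - xs‖ ^ 2 ∂P) := fun k => by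
    refine h.expectationLE_sample (W := fun ω => iterX A B g step x0 ζs k ω i)
      ((measurable_pi_apply i).comp (measurable_iter hobj k).1)
      (φ := fun p => ‖stochGrad g i p.1 p.2 - stochGrad g i xs p.2‖ ^ 2)
      (hφm.norm.pow_const 2) (fun p => sq_nonneg _) (ψ := fun x => L * ‖x - xs‖ ^ 2)
      (fun x => ?_) ((integrable_sq_iterX_sub hobj h hx0 k i).1.const_mul L)
    have hle : ∀ ω, ‖stochGrad g i x (ζ i ω) - stochGrad g i xs (ζ i ω)‖ ^ 2 ≤
        Lip i (ζ i ω) ^ 2 * ‖x - xs‖ ^ 2 := fun ω => by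
      rw [← mul_pow]
      gcongr
      exact hobj.lipschitz i _ _ _
    have hi : Integrable (fun ω => ‖stochGrad g i x (ζ i ω) - stochGrad g i xs (ζ i ω)‖ ^ 2) P := by
      refine (hLi.mul_const (‖x - xs‖ ^ 2)).mono' ?_ (ae_of_all _ fun ω => ?_)
      · exact ((hφm.comp (measurable_const.prodMk (h.measurable_zeta i))).norm.pow_const
          2).aestronglyMeasurable
      · rw [Real.norm_of_nonneg (sq_nonneg _)]
        exact hle ω
    refine ⟨hi, ?_⟩
    rw [hLdef, ← integral_mul_const]
    exact integral_mono hi (hLi.mul_const _) hle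
  refine ⟨fun k => ?_, ?_⟩
  · have hXm : Measurable (iterX A B g step x0 ζs k) :=
      (measurable_iter hobj k).1.mono (h.history_le k) le_rfl
    refine (memLp_two_iff_integrable_sq_norm ?_).2 (hE k).1
    exact (hφm.comp (((measurable_pi_apply i).comp hXm).prodMk
      (h.measurable_sample k i))).aestronglyMeasurable
  · refine squeeze_zero (fun k => integral_nonneg fun ω => sq_nonneg _) (fun k => (hE k).2) ?_
    simp only [integral_const_mul]
    rw [← mul_zero L]
    exact (squeeze_zero (fun k => integral_nonneg fun ω => sq_nonneg _)
      (fun k => (integrable_sq_iterX_sub hobj h hx0 k i).2) hX).const_mul L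

/-- The Hessians approach, in mean, the Hessians at the solution. -/
theorem tendsto_integral_abs_hessIter (hobj : ObjectiveAssumption P g ζ Lip xs)
    (hhess : HessianAssumption P g ζ xs)
    (h : SamplingModel P ζ ζs x0) (hx0 : MemLp (fun ω i => x0 i ω) 2 P)
    (hX : Tendsto (fun k => ∫ ω, ‖iterX A B g step x0 ζs k ω - fun _ => xs‖ ^ 2 ∂P) atTop (𝓝 0))
    (i : Fin n) (a b : Fin d) :
    (∀ k, Integrable (fun ω => stochHess g i (iterX A B g step x0 ζs k ω i) (ζs k i ω) a b
      - stochHess g i xs (ζs k i ω) a b) P) ∧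
    Tendsto (fun k => ∫ ω, |stochHess g i (iterX A B g step x0 ζs k ω i) (ζs k i ω) a b
      - stochHess g i xs (ζs k i ω) a b| ∂P) atTop (𝓝 0) := by
  obtain ⟨L₁, hL₁, L₂, -, hb, -⟩ := hhess.bounds i
  have hm := measurable_stochHess_entry hobj hhess i a b
  have hm' : Measurable fun p : EuclideanSpace ℝ (Fin d) × Z i => stochHess g i xs p.2 a b :=
    Measurable.comp (g := fun p : EuclideanSpace ℝ (Fin d) × Z i => stochHess g i p.1 p.2 a b)
      (f := fun p : EuclideanSpace ℝ (Fin d) × Z i => (xs, p.2)) hm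
      (measurable_const.prodMk measurable_snd)
  have hφm : Measurable fun p : EuclideanSpace ℝ (Fin d) × Z i =>
      stochHess g i p.1 p.2 a b - stochHess g i xs p.2 a b := hm.sub hm'
  have hXm : ∀ k, Measurable (iterX A B g step x0 ζs k) := fun k =>
    (measurable_iter hobj k).1.mono (h.history_le k) le_rfl
  have hX2 : ∀ k, MemLp (fun ω => iterX A B g step x0 ζs k ω i - xs) 2 P := fun k =>
    (memLp_two_iff_integrable_sq_norm (((measurable_pi_apply i).comp
      (hXm k)).sub_const xs).aestronglyMeasurable).2 (integrable_sq_iterX_sub hobj h hx0 k i).1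
  have hX1 : ∀ k, Integrable (fun ω => ‖iterX A B g step x0 ζs k ω i - xs‖) P := fun k =>
    ((hX2 k).integrable one_le_two).norm
  have hE : ∀ k, ExpectationLE P
      (fun ω => |stochHess g i (iterX A B g step x0 ζs k ω i) (ζs k i ω) a b
        - stochHess g i xs (ζs k i ω) a b|)
      (∫ ω, L₁ * ‖iterX A B g step x0 ζs k ω i - xs‖ ∂P) := fun k => by
    refine h.expectationLE_sample (W := fun ω => iterX A B g step x0 ζs k ω i)
      ((measurable_pi_apply i).comp (measurable_iter hobj k).1)
      (φ := fun p => |stochHess g i p.1 p.2 a b - stochHess g i xs p.2 a b|)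
      hφm.abs (fun p => abs_nonneg _) (ψ := fun x => L₁ * ‖x - xs‖)
      (fun x => ?_) ((hX1 k).const_mul L₁)
    have hle : ∀ ω, |stochHess g i x (ζ i ω) a b - stochHess g i xs (ζ i ω) a b| ≤
        ‖stochHess g i x (ζ i ω) - stochHess g i xs (ζ i ω)‖ := fun ω =>
      abs_entry_le_norm (stochHess g i x (ζ i ω) - stochHess g i xs (ζ i ω)) a b
    have hi : Integrable
        (fun ω => |stochHess g i x (ζ i ω) a b - stochHess g i xs (ζ i ω) a b|) P := by
      refine (hb x).1.mono' ?_ (ae_of_all _ fun ω => ?_)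
      · exact (Measurable.comp (g := fun p : EuclideanSpace ℝ (Fin d) × Z i =>
          |stochHess g i p.1 p.2 a b - stochHess g i xs p.2 a b|) (f := fun ω => (x, ζ i ω))
          hφm.abs (measurable_const.prodMk (h.measurable_zeta i))).aestronglyMeasurable
      · rw [Real.norm_of_nonneg (abs_nonneg _)]
        exact hle ω
    exact ⟨hi, (integral_mono hi (hb x).1 hle).trans (hb x).2⟩
  refine ⟨fun k => ?_, ?_⟩
  · refine (integrable_norm_iff ?_).1 (hE k).1
    exact (Measurable.comp (g := fun p : EuclideanSpace ℝ (Fin d) × Z i =>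
      stochHess g i p.1 p.2 a b - stochHess g i xs p.2 a b)
      (f := fun ω => (iterX A B g step x0 ζs k ω i, ζs k i ω)) hφm
      (((measurable_pi_apply i).comp (hXm k)).prodMk
        (h.measurable_sample k i))).aestronglyMeasurable
  · have hsqrt : Tendsto (fun k => √(∫ ω, ‖iterX A B g step x0 ζs k ω - fun _ => xs‖ ^ 2 ∂P))
        atTop (𝓝 0) := by
      simpa only [Real.sqrt_zero, Function.comp_def] using (Real.continuous_sqrt.tendsto 0).comp hX
    refine squeeze_zero (fun k => integral_nonneg fun ω => abs_nonneg _) (fun k => (hE k).2) ?_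
    simp only [integral_const_mul]
    rw [← mul_zero L₁]
    refine (squeeze_zero (fun k => integral_nonneg fun ω => norm_nonneg _) (fun k => ?_)
      hsqrt).const_mul L₁
    refine Real.le_sqrt_of_sq_le (le_trans ?_ (integrable_sq_iterX_sub hobj h hx0 k i).2)
    exact sq_integral_le (hX2 k).norm

end Convergence

/-! ### Distributed averaging -/

/-- The solution of `z (k + 1) = r z k + a k`, `z 0 = 0`. -/
def discountedSum (r : ℝ) (a : ℕ → ℝ) : ℕ → ℝ
  | 0 => 0
  | k + 1 => r * discountedSum r a k + a k

theorem discountedSum_le {r b : ℝ} (hr0 : 0 ≤ r) (hr1 : r < 1) {a : ℕ → ℝ} (ha : ∀ k, a k ≤ b)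
    (hb : 0 ≤ b) (k : ℕ) : discountedSum r a k ≤ b / (1 - r) := by
  have h1 : 0 < 1 - r := by linarith
  induction k with
  | zero => exact div_nonneg hb h1.le
  | succ k ih =>
    calc r * discountedSum r a k + a k ≤ r * (b / (1 - r)) + b := by gcongr; exact ha k
      _ = b / (1 - r) := by field_simp; ring

theorem integral_discountedSum {Ω : Type*} [MeasurableSpace Ω] {P : Measure Ω} (r : ℝ)
    {f : ℕ → Ω → ℝ} (hf : ∀ k, Integrable (f k) P) (k : ℕ) :
    Integrable (fun ω => discountedSum r (fun t => f t ω) k) P ∧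
      ∫ ω, discountedSum r (fun t => f t ω) k ∂P = discountedSum r (fun t => ∫ ω, f t ω ∂P) k := by
  induction k with
  | zero => simp [discountedSum]
  | succ k ih =>
    refine ⟨(ih.1.const_mul r).fun_add (hf k), ?_⟩
    simp only [discountedSum]
    rw [integral_add (ih.1.const_mul r) (hf k), integral_const_mul, ih.2]

/-- Distributed summation: up to a discounted sum of its inputs, every agent holds the weighted sum
of all inputs. -/
theorem exists_distributed_sum_error {n : ℕ} {A : Matrix (Fin n) (Fin n) ℝ} {w : Fin n → ℝ}
    (hA1 : ∀ i, ∑ j, A i j = 1) (hw1 : ∑ i, w i = 1) (hw : w ᵥ* A = w)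
    (hA : ∀ i j, Tendsto (fun k => ((A - Matrix.vecMulVec (1 : Fin n → ℝ) w) ^ k) i j) atTop
      (𝓝 0)) :
    ∃ r D : ℝ, 0 ≤ r ∧ r < 1 ∧ 0 ≤ D ∧ ∀ M F : ℕ → Fin n → ℝ, M 0 = 0 →
      (∀ k, M (k + 1) = mix A (M k) + F k) → ∀ k i,
      |M k i - ∑ t ∈ Finset.range k, ∑ j, w j * F t j| ≤
        discountedSum r (fun t => D * ∑ j, |F t j|) k := by
  obtain ⟨r, C, hr0, hr1, hC, N, -, hNge, hNle, hN⟩ := exists_adapted_norm ℝ hA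
  refine ⟨r, C * (1 + ∑ j, |w j|), hr0.le, hr1, by positivity, fun M F hM0 hM => ?_⟩
  have hsum : ∀ k, wsum w (M k) = ∑ t ∈ Finset.range k, ∑ j, w j * F t j := fun k => by
    induction k with
    | zero => simp [hM0]
    | succ k ih =>
      rw [hM, map_add, wsum_mix, hw, ih, Finset.sum_range_succ]
      simp [wsum_apply]
  have hZ : ∀ k, N (M k - fun _ => wsum w (M k)) ≤
      discountedSum r (fun t => C * (1 + ∑ j, |w j|) * ∑ j, |F t j|) k := fun k => by
    induction k with
    | zero =>
      refine (hNle _).trans ?_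
      rw [hM0, map_zero]
      have : ((0 : Fin n → ℝ) - fun _ => (0 : ℝ)) = 0 := by ext; simp
      rw [this, norm_zero, mul_zero]
      exact le_rfl
    | succ k ih =>
      -- The consensus recursion of the optimization method is reused with step `-1` and search
      -- direction `F`.
      have h1 := consensus_step hA1 hw1 hw (M k) (F k) (-1)
      rw [neg_smul, one_smul, sub_neg_eq_add, neg_neg, one_smul] at h1
      rw [hM, h1]
      refine (hN _ _).trans ?_
      have h2 : ‖F k‖ ≤ ∑ j, |F k j| :=
        (pi_norm_le_iff_of_nonneg (by positivity)).2 fun i =>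
          Finset.single_le_sum (f := fun j => |F k j|) (fun j _ => abs_nonneg _) (Finset.mem_univ i)
      calc _ ≤ r * discountedSum r (fun t => C * (1 + ∑ j, |w j|) * ∑ j, |F t j|) k
            + C * ((1 + ∑ j, |w j|) * ∑ j, |F k j|) := by
            gcongr
            exact (norm_sub_wsum_le w (F k)).trans (by gcongr)
        _ = _ := by rw [discountedSum]; ring
  intro k i
  rw [← hsum]
  exact (norm_le_pi_norm (M k - fun _ => wsum w (M k)) i).trans ((hNge _).trans (hZ k))

theorem tendsto_succ_inv_mul_sum {u : ℕ → ℝ} (hu0 : ∀ k, 0 ≤ u k) (hu : Tendsto u atTop (𝓝 0)) :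
    Tendsto (fun k : ℕ => ((k : ℝ) + 1)⁻¹ * ∑ t ∈ Finset.range k, u t) atTop (𝓝 0) := by
  refine squeeze_zero (fun k => by have := Finset.sum_nonneg fun t (_ : t ∈ Finset.range k) => hu0 t
                                   positivity) (fun k => ?_) hu.cesaro
  rcases Nat.eq_zero_or_pos k with rfl | hk
  · simp
  · have : 0 < (k : ℝ) := by exact_mod_cast hk
    gcongr
    · exact Finset.sum_nonneg fun t _ => hu0 t
    · linarith

section Averaging

variable {Ω : Type*} [MeasurableSpace Ω] {P : Measure Ω} {n : ℕ}
  {A : Matrix (Fin n) (Fin n) ℝ} {w : Fin n → ℝ}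

/-- Running distributed averages with asymptotically correct importance weights converge to the sum
of the limits of the individual averages. -/
theorem tendstoInMeasure_distributed_average (hA1 : ∀ i, ∑ j, A i j = 1) (hw1 : ∑ i, w i = 1)
    (hw : w ᵥ* A = w)
    (hA : ∀ i j, Tendsto (fun k => ((A - Matrix.vecMulVec (1 : Fin n → ℝ) w) ^ k) i j) atTop
      (𝓝 0))
    {ρ : ℕ → Fin n → ℝ} (hρ : ∀ j, Tendsto (fun k => w j * ρ k j) atTop (𝓝 1))
    (hw0 : ∀ j, w j ≠ 0)
    {est h hs : ℕ → Ω → Fin n → ℝ} (hest0 : ∀ ω, est 0 ω = 0)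
    (hest : ∀ k ω i, est (k + 1) ω i = ((k + 1 : ℕ) : ℝ) / ((k + 1 : ℕ) + 1) *
      ∑ j, A i j * est k ω j + 1 / (((k + 1 : ℕ) : ℝ) + 1) * (ρ k i * h k ω i))
    (hsi : ∀ k j, Integrable (fun ω => hs k ω j) P)
    (hδi : ∀ k j, Integrable (fun ω => h k ω j - hs k ω j) P)
    {C : Fin n → ℝ} (hC : ∀ k j, ∫ ω, |hs k ω j| ∂P ≤ C j)
    (hδ : ∀ j, Tendsto (fun k => ∫ ω, |h k ω j - hs k ω j| ∂P) atTop (𝓝 0))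
    {μ : Fin n → ℝ}
    (hlln : ∀ j, TendstoInMeasure P
      (fun (k : ℕ) ω => ((k : ℝ) + 1)⁻¹ * ∑ t ∈ Finset.range k, hs t ω j) atTop (fun _ => μ j))
    (i : Fin n) :
    TendstoInMeasure P (fun k ω => est k ω i) atTop (fun _ => ∑ j, μ j) := by
  obtain ⟨r, D, hr0, hr1, hD, herr⟩ := exists_distributed_sum_error hA1 hw1 hw hA
  have hhi : ∀ k j, Integrable (fun ω => h k ω j) P := fun k j => by
    simpa using (hδi k j).fun_add (hsi k j)
  set F : ℕ → Ω → Fin n → ℝ := fun k ω j => ρ k j * h k ω j with hF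
  have hFi : ∀ k j, Integrable (fun ω => F k ω j) P := fun k j => (hhi k j).const_mul _
  have hesti : ∀ k j, Integrable (fun ω => est k ω j) P := fun k => by
    induction k with
    | zero => simp [hest0]
    | succ k ih =>
      intro j
      simp only [hest]
      exact ((integrable_finsetSum _ fun l _ => (ih l).const_mul _).const_mul _).fun_add
        ((hFi k j).const_mul _)
  -- the weighted error of the individual averages
  set R : ℕ → Ω → ℝ := fun k ω =>
    ∑ j, (|w j * ρ k j - 1| * |hs k ω j| + |w j * ρ k j| * |h k ω j - hs k ω j|) with hR
  have hRi : ∀ k, Integrable (R k) P := fun k => integrable_finsetSum _ fun j _ =>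
    ((hsi k j).abs.const_mul _).fun_add ((hδi k j).abs.const_mul _)
  have hR0 : ∀ k ω, 0 ≤ R k ω := fun k ω => Finset.sum_nonneg fun j _ => by positivity
  have hRt : Tendsto (fun k => ∫ ω, R k ω ∂P) atTop (𝓝 0) := by
    have hlim : Tendsto (fun k => ∑ j, (|w j * ρ k j - 1| * C j
        + |w j * ρ k j| * ∫ ω, |h k ω j - hs k ω j| ∂P)) atTop (𝓝 0) := by
      have h0 : ∑ j : Fin n, (|(1 : ℝ) - 1| * C j + |(1 : ℝ)| * 0) = 0 := by simp
      rw [← h0]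
      exact tendsto_finsetSum _ fun j _ => ((((hρ j).sub_const 1).abs).mul_const (C j)).add
        ((hρ j).abs.mul (hδ j))
    refine squeeze_zero (fun k => integral_nonneg (hR0 k)) (fun k => ?_) hlim
    rw [hR]
    dsimp only
    rw [integral_finsetSum _ fun j _ =>
      ((hsi k j).abs.const_mul _).fun_add ((hδi k j).abs.const_mul _)]
    refine Finset.sum_le_sum fun j _ => ?_
    rw [integral_add ((hsi k j).abs.const_mul _) ((hδi k j).abs.const_mul _), integral_const_mul,
      integral_const_mul]
    gcongr
    exact hC k j
  -- the consensus error
  set Q : ℕ → Ω → ℝ := fun k ω => D * ∑ j, |F k ω j| with hQ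
  have hQi : ∀ k, Integrable (Q k) P := fun k =>
    (integrable_finsetSum _ fun j _ => (hFi k j).abs).const_mul D
  obtain ⟨b, hb⟩ : ∃ b, ∀ k, ∫ ω, Q k ω ∂P ≤ b := by
    have hρ' : ∀ j, Tendsto (fun k => |ρ k j|) atTop (𝓝 |(w j)⁻¹|) := fun j => by
      have := (hρ j).const_mul (w j)⁻¹
      simp only [← mul_assoc, inv_mul_cancel₀ (hw0 j), one_mul, mul_one] at this
      exact this.abs
    have hlim : Tendsto (fun k => D * ∑ j, |ρ k j| * (∫ ω, |h k ω j - hs k ω j| ∂P + C j)) atTop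
        (𝓝 (D * ∑ j, |(w j)⁻¹| * (0 + C j))) :=
      (tendsto_finsetSum _ fun j _ => (hρ' j).mul ((hδ j).add_const (C j))).const_mul D
    obtain ⟨b, hb⟩ := hlim.bddAbove_range
    refine ⟨b, fun k => le_trans ?_ (hb ⟨k, rfl⟩)⟩
    rw [hQ]
    dsimp only
    rw [integral_const_mul, integral_finsetSum _ fun j _ => (hFi k j).abs]
    gcongr with j
    simp only [hF, abs_mul]
    rw [integral_const_mul]
    gcongr
    calc ∫ ω, |h k ω j| ∂P ≤ ∫ ω, (|h k ω j - hs k ω j| + |hs k ω j|) ∂P := by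
          refine integral_mono (hhi k j).abs ((hδi k j).abs.fun_add (hsi k j).abs) fun ω => ?_
          have := abs_add_le (h k ω j - hs k ω j) (hs k ω j)
          rwa [sub_add_cancel] at this
      _ ≤ _ := by
          rw [integral_add (hδi k j).abs (hsi k j).abs]
          gcongr
          exact hC k j
  have hb0 : 0 ≤ b := (integral_nonneg fun ω => by positivity).trans (hb 0)
  -- the pathwise bound
  have hpt : ∀ (k : ℕ) ω, |est k ω i - ∑ j, ((k : ℝ) + 1)⁻¹ * ∑ t ∈ Finset.range k, hs t ω j| ≤
      ((k : ℝ) + 1)⁻¹ * (discountedSum r (fun t => Q t ω) k + ∑ t ∈ Finset.range k, R t ω) := by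
    intro k ω
    have hk : 0 < (k : ℝ) + 1 := by positivity
    -- Multiplication by `k + 1` cancels the discount `(k + 1) / (k + 2)` and turns the running
    -- average into a plain distributed sum.
    have h1 := herr (fun k => ((k : ℝ) + 1) • est k ω) (fun k => F k ω) (by simp [hest0])
      (fun k => by
        ext j
        have : ((k : ℝ) + 1) + 1 ≠ 0 := by positivity
        simp only [Pi.smul_apply, Pi.add_apply, smul_eq_mul, hest, mix_apply, hF]
        push_cast
        simp only [mul_left_comm _ ((k : ℝ) + 1) _, ← Finset.mul_sum]
        field_simp) k i
    have h2 : |∑ t ∈ Finset.range k, ∑ j, w j * F t ω j - ∑ j, ∑ t ∈ Finset.range k, hs t ω j| ≤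
        ∑ t ∈ Finset.range k, R t ω := by
      rw [Finset.sum_comm (s := Finset.univ), ← Finset.sum_sub_distrib]
      refine (Finset.abs_sum_le_sum_abs _ _).trans (Finset.sum_le_sum fun t _ => ?_)
      rw [← Finset.sum_sub_distrib]
      refine (Finset.abs_sum_le_sum_abs _ _).trans (Finset.sum_le_sum fun j _ => ?_)
      have e : w j * F t ω j - hs t ω j =
          (w j * ρ t j - 1) * hs t ω j + w j * ρ t j * (h t ω j - hs t ω j) := by
        simp only [hF]; ring
      rw [e]
      refine (abs_add_le _ _).trans ?_
      rw [abs_mul, abs_mul (w j * ρ t j)]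
    have h3 : est k ω i - ∑ j, ((k : ℝ) + 1)⁻¹ * ∑ t ∈ Finset.range k, hs t ω j =
        ((k : ℝ) + 1)⁻¹ * (((((k : ℝ) + 1) • est k ω) i
          - ∑ t ∈ Finset.range k, ∑ j, w j * F t ω j)
          + (∑ t ∈ Finset.range k, ∑ j, w j * F t ω j
            - ∑ j, ∑ t ∈ Finset.range k, hs t ω j)) := by
      rw [← Finset.mul_sum, Pi.smul_apply, smul_eq_mul, sub_add_sub_cancel, mul_sub,
        inv_mul_cancel_left₀ hk.ne']
    rw [h3, abs_mul, abs_of_pos (inv_pos.2 hk)]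
    gcongr
    exact (abs_add_le _ _).trans (add_le_add h1 h2)
  have hdi : ∀ k, Integrable
      (fun ω => est k ω i - ∑ j, ((k : ℝ) + 1)⁻¹ * ∑ t ∈ Finset.range k, hs t ω j) P := fun k =>
    (hesti k i).sub (integrable_finsetSum _ fun j _ =>
      (integrable_finsetSum _ fun t _ => hsi t j).const_mul _)
  have hdiff : TendstoInMeasure P
      (fun (k : ℕ) ω => est k ω i - ∑ j, ((k : ℝ) + 1)⁻¹ * ∑ t ∈ Finset.range k, hs t ω j) atTop
      (fun _ => 0) := by
    -- The discounted sum has mean at most `b / (1 - r)` at all times, so division by `k + 1`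
    -- suffices. The sum of the `R t` grows with `k`, but its average vanishes by Cesàro's theorem.
    refine tendstoInMeasure_zero_of_integral_abs hdi ?_
    have hlim : Tendsto (fun k : ℕ => ((k : ℝ) + 1)⁻¹ * (b / (1 - r))
        + ((k : ℝ) + 1)⁻¹ * ∑ t ∈ Finset.range k, ∫ ω, R t ω ∂P) atTop
        (𝓝 (0 * (b / (1 - r)) + 0)) :=
      ((tendsto_inv_atTop_zero.comp (tendsto_atTop_add_const_right _ _
        tendsto_natCast_atTop_atTop)).mul_const _).add
        (tendsto_succ_inv_mul_sum (fun k => integral_nonneg (hR0 k)) hRt)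
    rw [zero_mul, zero_add] at hlim
    refine squeeze_zero (fun k => integral_nonneg fun ω => abs_nonneg _) (fun k => ?_) hlim
    obtain ⟨hZi, hZ⟩ := integral_discountedSum r hQi k
    have hsumi := integrable_finsetSum (Finset.range k) fun t _ => hRi t
    calc _ ≤ ∫ ω, ((k : ℝ) + 1)⁻¹ * (discountedSum r (fun t => Q t ω) k
            + ∑ t ∈ Finset.range k, R t ω) ∂P :=
          integral_mono (hdi k).abs ((hZi.fun_add hsumi).const_mul _) (hpt k)
      _ = ((k : ℝ) + 1)⁻¹ * discountedSum r (fun t => ∫ ω, Q t ω ∂P) k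
            + ((k : ℝ) + 1)⁻¹ * ∑ t ∈ Finset.range k, ∫ ω, R t ω ∂P := by
          rw [integral_const_mul, integral_add hZi hsumi, hZ, mul_add,
            integral_finsetSum _ fun t _ => hRi t]
      _ ≤ _ := by
          gcongr
          exact discountedSum_le hr0 hr1 hb hb0 k
  have := hdiff.add_const (TendstoInMeasure.sum_const hlln)
  simpa using this

end Averaging

/-! ### Laws of large numbers for the samples -/

theorem integral_abs_mul_le {Ω : Type*} [MeasurableSpace Ω] {P : Measure Ω} {f g : Ω → ℝ}
    (hf : MemLp f 2 P) (hg : MemLp g 2 P) :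
    ∫ ω, |f ω * g ω| ∂P ≤ √(∫ ω, f ω ^ 2 ∂P) * √(∫ ω, g ω ^ 2 ∂P) := by
  have h := integral_mul_norm_le_Lp_mul_Lq (μ := P) Real.HolderConjugate.two_two (f := f) (g := g)
    (by simpa using hf) (by simpa using hg)
  simpa [abs_mul, Real.sqrt_eq_rpow] using h

/-- Products of mean-square approximations are approximations in mean. -/
theorem tendsto_integral_abs_mul_sub {Ω : Type*} [MeasurableSpace Ω] {P : Measure Ω}
    {U V u v : ℕ → Ω → ℝ} (hu : ∀ k, MemLp (u k) 2 P) (hv : ∀ k, MemLp (v k) 2 P)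
    (hU : ∀ k, MemLp (fun ω => U k ω - u k ω) 2 P) (hV : ∀ k, MemLp (fun ω => V k ω - v k ω) 2 P)
    {C : ℝ} (hCu : ∀ k, ∫ ω, u k ω ^ 2 ∂P ≤ C) (hCv : ∀ k, ∫ ω, v k ω ^ 2 ∂P ≤ C)
    (hUt : Tendsto (fun k => ∫ ω, (U k ω - u k ω) ^ 2 ∂P) atTop (𝓝 0))
    (hVt : Tendsto (fun k => ∫ ω, (V k ω - v k ω) ^ 2 ∂P) atTop (𝓝 0)) :
    (∀ k, Integrable (fun ω => U k ω * V k ω - u k ω * v k ω) P) ∧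
    Tendsto (fun k => ∫ ω, |U k ω * V k ω - u k ω * v k ω| ∂P) atTop (𝓝 0) := by
  have e : ∀ k ω, U k ω * V k ω - u k ω * v k ω = (U k ω - u k ω) * (V k ω - v k ω)
      + ((U k ω - u k ω) * v k ω + u k ω * (V k ω - v k ω)) := fun k ω => by ring
  have h1 : ∀ k, Integrable (fun ω => (U k ω - u k ω) * (V k ω - v k ω)) P := fun k =>
    (hU k).integrable_mul (hV k)
  have h2 : ∀ k, Integrable (fun ω => (U k ω - u k ω) * v k ω) P := fun k =>
    (hU k).integrable_mul (hv k)
  have h3 : ∀ k, Integrable (fun ω => u k ω * (V k ω - v k ω)) P := fun k =>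
    (hu k).integrable_mul (hV k)
  have hi : ∀ k, Integrable (fun ω => U k ω * V k ω - u k ω * v k ω) P := fun k => by
    simp only [e]
    exact (h1 k).fun_add ((h2 k).fun_add (h3 k))
  refine ⟨hi, ?_⟩
  have hsU : Tendsto (fun k => √(∫ ω, (U k ω - u k ω) ^ 2 ∂P)) atTop (𝓝 0) := by
    simpa only [Real.sqrt_zero, Function.comp_def] using (Real.continuous_sqrt.tendsto 0).comp hUt
  have hsV : Tendsto (fun k => √(∫ ω, (V k ω - v k ω) ^ 2 ∂P)) atTop (𝓝 0) := by
    simpa only [Real.sqrt_zero, Function.comp_def] using (Real.continuous_sqrt.tendsto 0).comp hVt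
  have hlim := (hsU.mul hsV).add ((hsU.mul_const √C).add (hsV.const_mul √C))
  simp only [zero_mul, mul_zero, add_zero] at hlim
  refine squeeze_zero (fun k => integral_nonneg fun ω => abs_nonneg _) (fun k => ?_) hlim
  calc _ ≤ ∫ ω, (|(U k ω - u k ω) * (V k ω - v k ω)|
        + (|(U k ω - u k ω) * v k ω| + |u k ω * (V k ω - v k ω)|)) ∂P := by
        refine integral_mono (hi k).abs ((h1 k).abs.fun_add ((h2 k).abs.fun_add (h3 k).abs))
          fun ω => ?_
        dsimp only
        rw [e]
        exact (abs_add_le _ _).trans (add_le_add_right (abs_add_le _ _) _)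
    _ = ∫ ω, |(U k ω - u k ω) * (V k ω - v k ω)| ∂P
        + (∫ ω, |(U k ω - u k ω) * v k ω| ∂P + ∫ ω, |u k ω * (V k ω - v k ω)| ∂P) := by
        rw [integral_add (h1 k).abs ((h2 k).abs.fun_add (h3 k).abs),
          integral_add (h2 k).abs (h3 k).abs]
    _ ≤ _ := by
        refine add_le_add (integral_abs_mul_le (hU k) (hV k)) (add_le_add ?_ ?_)
        · refine (integral_abs_mul_le (hU k) (hv k)).trans ?_
          gcongr
          exact hCv k
        · refine (integral_abs_mul_le (hu k) (hV k)).trans ?_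
          gcongr
          exact hCu k

section LawOfLargeNumbers

variable {Ω : Type*} [mΩ : MeasurableSpace Ω] {P : Measure Ω} {n d : ℕ}
  {Z : Fin n → Type*} [∀ i, MeasurableSpace (Z i)] {ζ : ∀ i, Ω → Z i}
  {ζs : ℕ → ∀ i, Ω → Z i} {x0 : Fin n → Ω → EuclideanSpace ℝ (Fin d)}

theorem SamplingModel.identDistrib_comp (h : SamplingModel P ζ ζs x0) {i : Fin n} {φ : Z i → ℝ}
    (hφ : Measurable φ) (k : ℕ) :
    IdentDistrib (fun ω => φ (ζs k i ω)) (fun ω => φ (ζ i ω)) P P :=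
  (h.identDistrib k i).comp hφ

variable [IsProbabilityMeasure P]

/-- The law of large numbers for functions of the samples of one agent. -/
theorem SamplingModel.tendstoInMeasure_average (h : SamplingModel P ζ ζs x0) {i : Fin n}
    {φ : Z i → ℝ} (hφ : Measurable φ) (hint : Integrable (fun ω => φ (ζ i ω)) P) (s : ℕ) :
    TendstoInMeasure P
      (fun (k : ℕ) ω => ((k : ℝ) + 1)⁻¹ * ∑ t ∈ Finset.range k, φ (ζs (t + s) i ω)) atTop
      (fun _ => ∫ ω, φ (ζ i ω) ∂P) := by
  have hid := h.identDistrib_comp (i := i) hφ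
  have hslln := strong_law_ae_real (μ := P) (fun t ω => φ (ζs (t + s) i ω))
    ((hid _).symm.integrable_snd hint) (fun t t' htt' => by
      have h1 := h.indep_time.indepFun (i := t + s) (j := t' + s) (by omega)
      exact h1.comp (φ := fun z : ∀ i, Z i => φ (z i)) (ψ := fun z : ∀ i, Z i => φ (z i))
        (hφ.comp (measurable_pi_apply i)) (hφ.comp (measurable_pi_apply i)))
    (fun t => (hid _).trans (hid _).symm)
  rw [(hid _).integral_eq] at hslln
  refine tendstoInMeasure_of_tendsto_ae (fun k => ?_) ?_
  · exact (Measurable.const_mul (Finset.measurable_fun_sum _ fun t _ =>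
      hφ.comp (h.measurable_sample _ i)) _).aestronglyMeasurable
  · filter_upwards [hslln] with ω hω
    -- The averages have `k` terms but are divided by `k + 1`, as in the estimators; the factor `k /
    -- (k + 1)` accounts for the difference from the strong law.
    have h1 : Tendsto (fun k : ℕ => (k : ℝ) / ((k : ℝ) + 1)) atTop (𝓝 1) :=
      tendsto_natCast_div_add_atTop 1
    have h2 := h1.mul hω
    rw [one_mul] at h2
    refine h2.congr fun k => ?_
    rcases Nat.eq_zero_or_pos k with rfl | hk
    · simp
    · have : (k : ℝ) ≠ 0 := by exact_mod_cast hk.ne'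
      field_simp

/-- The past partial sums are uncorrelated with the present innovation. -/
theorem SamplingModel.integral_sq_sum (h : SamplingModel P ζ ζs x0) {i : Fin n}
    {φ ψ : Z i → ℝ} (hφ : Measurable φ) (hψ : Measurable ψ)
    (hφ2 : MemLp (fun ω => φ (ζ i ω)) 2 P) (hψ2 : MemLp (fun ω => ψ (ζ i ω)) 2 P)
    (hφ0 : ∫ ω, φ (ζ i ω) ∂P = 0) (k : ℕ) :
    MemLp (fun ω => ∑ t ∈ Finset.range k, φ (ζs (t + 1) i ω) * ψ (ζs t i ω)) 2 P ∧
    ∫ ω, (∑ t ∈ Finset.range k, φ (ζs (t + 1) i ω) * ψ (ζs t i ω)) ^ 2 ∂P =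
      k * ((∫ ω, φ (ζ i ω) ^ 2 ∂P) * ∫ ω, ψ (ζ i ω) ^ 2 ∂P) := by
  have hs : ∀ t, Measurable[history x0 ζs (t + 1)] (ζs t i) := fun t =>
    measurable_history_sample (Nat.lt_succ_self t) i
  have hφt : ∀ t, MemLp (fun ω => φ (ζs t i ω)) 2 P := fun t =>
    (h.identDistrib_comp hφ t).symm.memLp_snd hφ2
  have hψt : ∀ t, MemLp (fun ω => ψ (ζs t i ω)) 2 P := fun t =>
    (h.identDistrib_comp hψ t).symm.memLp_snd hψ2
  have hprod : ∀ t, MemLp (fun ω => φ (ζs (t + 1) i ω) * ψ (ζs t i ω)) 2 P ∧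
      ∫ ω, (φ (ζs (t + 1) i ω) * ψ (ζs t i ω)) ^ 2 ∂P =
        (∫ ω, φ (ζ i ω) ^ 2 ∂P) * ∫ ω, ψ (ζ i ω) ^ 2 ∂P := fun t => by
    have hind : IndepFun (fun ω => φ (ζs (t + 1) i ω) ^ 2) (fun ω => ψ (ζs t i ω) ^ 2) P :=
      (h.indepFun_sample (hs t) i).symm.comp (φ := fun z => φ z ^ 2) (ψ := fun z => ψ z ^ 2)
        (hφ.pow_const 2) (hψ.pow_const 2)
    have hm : AEStronglyMeasurable (fun ω => φ (ζs (t + 1) i ω) * ψ (ζs t i ω)) P :=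
      (hφt (t + 1)).aestronglyMeasurable.mul (hψt t).aestronglyMeasurable
    have hi : Integrable (fun ω => φ (ζs (t + 1) i ω) ^ 2 * ψ (ζs t i ω) ^ 2) P :=
      hind.integrable_mul (hφt (t + 1)).integrable_sq (hψt t).integrable_sq
    refine ⟨(memLp_two_iff_integrable_sq hm).2 (by simpa only [mul_pow] using hi), ?_⟩
    simp only [mul_pow]
    rw [hind.integral_fun_mul_eq_mul_integral
      (hφt (t + 1)).integrable_sq.aestronglyMeasurable (hψt t).integrable_sq.aestronglyMeasurable]
    rw [(h.identDistrib_comp (φ := fun z => φ z ^ 2) (hφ.pow_const 2) (t + 1)).integral_eq,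
      (h.identDistrib_comp (φ := fun z => ψ z ^ 2) (hψ.pow_const 2) t).integral_eq]
  induction k with
  | zero => simp
  | succ k ih =>
    obtain ⟨ih1, ih2⟩ := ih
    set T : Ω → ℝ := fun ω => ∑ t ∈ Finset.range k, φ (ζs (t + 1) i ω) * ψ (ζs t i ω) with hT
    have hTm : Measurable[history x0 ζs (k + 1)] fun ω => T ω * ψ (ζs k i ω) := by
      have hle : ∀ t < k + 1, Measurable[history x0 ζs (k + 1)] (ζs t i) := fun t ht =>
        measurable_history_sample ht i
      refine Measurable.mul (Finset.measurable_fun_sum _ fun t ht => ?_) (hψ.comp (hs k))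
      rw [Finset.mem_range] at ht
      exact (hφ.comp (hle _ (by omega))).mul (hψ.comp (hle _ (by omega)))
    have hTψ : Integrable (fun ω => T ω * ψ (ζs k i ω)) P := ih1.integrable_mul (hψt k)
    -- Everything except the last factor is determined by samples up to time `k`, and the last
    -- factor is independent of these with mean zero. So the increments are orthogonal.
    have hcross : ∫ ω, T ω * ψ (ζs k i ω) * φ (ζs (k + 1) i ω) ∂P = 0 := by
      have hind := (h.indepFun_sample hTm i).comp (φ := id) measurable_id hφ
      have := hind.integral_fun_mul_eq_mul_integral hTψ.aestronglyMeasurable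
        (hφt (k + 1)).aestronglyMeasurable
      simp only [Function.comp_def, id] at this
      rw [this, (h.identDistrib_comp hφ (k + 1)).integral_eq, hφ0, mul_zero]
    simp only [Finset.sum_range_succ]
    refine ⟨ih1.add (hprod k).1, ?_⟩
    have e : ∀ ω, (T ω + φ (ζs (k + 1) i ω) * ψ (ζs k i ω)) ^ 2 = T ω ^ 2
        + ((φ (ζs (k + 1) i ω) * ψ (ζs k i ω)) ^ 2
          + 2 * (T ω * ψ (ζs k i ω) * φ (ζs (k + 1) i ω))) := fun ω => by ring
    have hci : Integrable (fun ω => T ω * ψ (ζs k i ω) * φ (ζs (k + 1) i ω)) P := by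
      have : Integrable (fun ω => T ω * (φ (ζs (k + 1) i ω) * ψ (ζs k i ω))) P :=
        ih1.integrable_mul (hprod k).1
      refine this.congr (ae_of_all _ fun ω => ?_)
      dsimp only
      ring
    change ∫ ω, (T ω + φ (ζs (k + 1) i ω) * ψ (ζs k i ω)) ^ 2 ∂P = _
    simp only [e]
    rw [integral_add ih1.integrable_sq ((hprod k).1.integrable_sq.fun_add (hci.const_mul 2)),
      integral_add (hprod k).1.integrable_sq (hci.const_mul 2), integral_const_mul, hcross,
      (hprod k).2, ih2]
    push_cast
    ring

/-- The law of large numbers for products of consecutive samples. -/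
theorem SamplingModel.tendstoInMeasure_average_cross (h : SamplingModel P ζ ζs x0) {i : Fin n}
    {φ ψ : Z i → ℝ} (hφ : Measurable φ) (hψ : Measurable ψ)
    (hφ2 : MemLp (fun ω => φ (ζ i ω)) 2 P) (hψ2 : MemLp (fun ω => ψ (ζ i ω)) 2 P) :
    TendstoInMeasure P (fun (k : ℕ) ω =>
      ((k : ℝ) + 1)⁻¹ * ∑ t ∈ Finset.range k, φ (ζs (t + 1) i ω) * ψ (ζs t i ω)) atTop
      (fun _ => (∫ ω, φ (ζ i ω) ∂P) * ∫ ω, ψ (ζ i ω) ∂P) := by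
  -- Only the later factor is centred: `φψ = (φ - m)ψ + mψ`. The sum of the first parts has second
  -- moment linear in `k`, so its average is of order `k^(-1/2)` in mean; the second parts obey the
  -- ordinary law of large numbers.
  set m := ∫ ω, φ (ζ i ω) ∂P with hm
  have hφint := hφ2.integrable one_le_two
  have hξ0 : ∫ ω, (φ (ζ i ω) - m) ∂P = 0 := by
    rw [integral_sub hφint (integrable_const _)]
    simp [hm]
  have hsq := h.integral_sq_sum (φ := fun z => φ z - m) (hφ.sub_const m) hψ
    (hφ2.sub (memLp_const m)) hψ2 hξ0
  set σ := (∫ ω, (φ (ζ i ω) - m) ^ 2 ∂P) * ∫ ω, ψ (ζ i ω) ^ 2 ∂P with hσ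
  have hσ0 : 0 ≤ σ := mul_nonneg (integral_nonneg fun ω => sq_nonneg _)
    (integral_nonneg fun ω => sq_nonneg _)
  have h1 : TendstoInMeasure P (fun (k : ℕ) ω => ((k : ℝ) + 1)⁻¹ *
      ∑ t ∈ Finset.range k, (φ (ζs (t + 1) i ω) - m) * ψ (ζs t i ω)) atTop (fun _ => 0) := by
    refine tendstoInMeasure_zero_of_integral_abs
      (fun k => ((hsq k).1.integrable one_le_two).const_mul _) ?_
    have hlim : Tendsto (fun k : ℕ => √(((k : ℝ) + 1)⁻¹ * σ)) atTop (𝓝 0) := by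
      have h0 : Tendsto (fun k : ℕ => ((k : ℝ) + 1)⁻¹ * σ) atTop (𝓝 (0 * σ)) :=
        (tendsto_inv_atTop_zero.comp (tendsto_atTop_add_const_right _ _
          tendsto_natCast_atTop_atTop)).mul_const _
      rw [zero_mul] at h0
      simpa only [Real.sqrt_zero, Function.comp_def] using (Real.continuous_sqrt.tendsto 0).comp h0
    refine squeeze_zero (fun k => integral_nonneg fun ω => abs_nonneg _) (fun k => ?_) hlim
    refine Real.le_sqrt_of_sq_le ((sq_integral_le (f := fun ω => |((k : ℝ) + 1)⁻¹ *
      ∑ t ∈ Finset.range k, (φ (ζs (t + 1) i ω) - m) * ψ (ζs t i ω)|)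
      ((hsq k).1.const_mul _).abs).trans ?_)
    simp only [sq_abs, mul_pow]
    rw [integral_const_mul, (hsq k).2]
    have hk : (0 : ℝ) < (k : ℝ) + 1 := by positivity
    rw [← mul_assoc]
    gcongr
    rw [inv_pow, inv_mul_le_iff₀ (by positivity)]
    field_simp
    linarith
  have h2 := (h.tendstoInMeasure_average hψ (hψ2.integrable one_le_two) 0).const_mul m
  have h3 := h1.add_const h2
  rw [zero_add] at h3
  convert h3 using 3 with k ω
  rw [mul_left_comm m, ← mul_add, Finset.mul_sum (a := m), ← Finset.sum_add_distrib]
  congr 1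
  refine Finset.sum_congr rfl fun t _ => ?_
  rw [add_zero]
  ring

end LawOfLargeNumbers

/-! ### Convergence of the plug-in estimators -/

theorem eigIter_eq_pow {n : ℕ} (A : Matrix (Fin n) (Fin n) ℝ) (k : ℕ) (i l : Fin n) :
    eigIter A k i l = (A ^ k) i l := by
  induction k generalizing i with
  | zero => simp [eigIter, Matrix.one_apply, Pi.single_apply, eq_comm]
  | succ k ih => simp [eigIter, pow_succ', Matrix.mul_apply, ih]

/-- The local quantity `u_{j,k}(j)` is the diagonal entry of `A ^ k`, hence tends to the positive
weight `w j`. The index is `k + 1` because the increment leading from time `k` to `k + 1` divides by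
that entry. -/
theorem tendsto_mul_inv_eigIter {n : ℕ} {A : Matrix (Fin n) (Fin n) ℝ} {w : Fin n → ℝ}
    (h0 : ∀ i j, 0 ≤ A i j) (h1 : ∀ i, ∑ j, A i j = 1) (hd : ∀ i, 0 < A i i)
    (hconn : IsStronglyConnected (inducedGraph A)) (hw0 : ∀ i, 0 ≤ w i) (hw1 : ∑ i, w i = 1)
    (hw : w ᵥ* A = w) (j : Fin n) :
    Tendsto (fun k => w j * (eigIter A (k + 1) j j)⁻¹) atTop (𝓝 1) := by
  have hpos := stationary_pos h0 hd hconn hw0 hw1 hw j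
  have h := (tendsto_pow_entry h0 h1 hd (hconn j) hw0 hw1 hw j j).comp (tendsto_add_atTop_nat 1)
  have h' := (h.inv₀ hpos.ne').const_mul (w j)
  rw [mul_inv_cancel₀ hpos.ne'] at h'
  simpa only [eigIter_eq_pow, Function.comp_def] using h'

section Estimators

variable {Ω : Type*} [mΩ : MeasurableSpace Ω] {P : Measure Ω} [IsProbabilityMeasure P] {n d : ℕ}
  {Z : Fin n → Type*} [∀ i, MeasurableSpace (Z i)]
  {g : ∀ i, EuclideanSpace ℝ (Fin d) → Z i → ℝ} {ζ : ∀ i, Ω → Z i} {Lip : ∀ i, Z i → ℝ}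
  {ζs : ℕ → ∀ i, Ω → Z i} {x0 : Fin n → Ω → EuclideanSpace ℝ (Fin d)}
  {xs : EuclideanSpace ℝ (Fin d)} {A B : Matrix (Fin n) (Fin n) ℝ} {step : ℕ → ℝ}
  {w : Fin n → ℝ}

/-- Replacing each Hessian by its value at `xs` costs an error vanishing in mean. The distributed
average of the resulting copies has as its limit the sum of the mean Hessians, which is the Hessian
of `f`. -/
theorem tendstoInMeasure_hessEst_entry (hobj : ObjectiveAssumption P g ζ Lip xs)
    (hhess : HessianAssumption P g ζ xs)
    (h : SamplingModel P ζ ζs x0) (hweight : WeightAssumption A B)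
    (hconn : IsStronglyConnected (inducedGraph A))
    (hw0 : ∀ i, 0 ≤ w i) (hw1 : ∑ i, w i = 1) (hw : w ᵥ* A = w)
    (hx0 : MemLp (fun ω i => x0 i ω) 2 P)
    (hX : Tendsto (fun k => ∫ ω, ‖iterX A B g step x0 ζs k ω - fun _ => xs‖ ^ 2 ∂P) atTop (𝓝 0))
    (i : Fin n) (a b : Fin d) :
    TendstoInMeasure P (fun k ω =>
      hessEst A B g step (fun j => x0 j ω) (fun t j => ζs t j ω) k i a b) atTop
      (fun _ => hessian (globalCost P g ζ) xs a b) := by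
  have hφ : ∀ j, Measurable fun z => stochHess g j xs z a b := fun j =>
    Measurable.comp (g := fun p : EuclideanSpace ℝ (Fin d) × Z j => stochHess g j p.1 p.2 a b)
      (f := fun z => (xs, z)) (measurable_stochHess_entry hobj hhess j a b)
      (measurable_const.prodMk measurable_id)
  have hint := fun j => integrable_stochHess_entry_optimal hobj hhess h.measurable_zeta j a b
  have hδ := fun j => tendsto_integral_abs_hessIter (A := A) (B := B) (step := step)
    hobj hhess h hx0 hX j a b
  rw [hessian_globalCost_entry hobj hhess h.measurable_zeta]
  refine tendstoInMeasure_distributed_average hweight.A_row_stochastic hw1 hw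
    (tendsto_pow_sub_entry hweight.A_nonneg hweight.A_row_stochastic hweight.A_diag_pos
      (hconn i) hw0 hw1 hw) (ρ := fun k j => (eigIter A (k + 1) j j)⁻¹)
    (tendsto_mul_inv_eigIter hweight.A_nonneg hweight.A_row_stochastic hweight.A_diag_pos hconn
      hw0 hw1 hw)
    (fun j => (stationary_pos hweight.A_nonneg hweight.A_diag_pos hconn hw0 hw1 hw j).ne')
    (est := fun k ω j => hessEst A B g step (fun j => x0 j ω) (fun t j => ζs t j ω) k j a b)
    (h := fun k ω j =>
      stochHess g j (iterX A B g step x0 ζs (k + 1) ω j) (ζs (k + 1) j ω) a b)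
    (hs := fun k ω j => stochHess g j xs (ζs (k + 1) j ω) a b)
    (fun ω => rfl) (fun k ω j => ?_) (fun k j => ?_) (fun k j => (hδ j).1 (k + 1))
    (C := fun j => ∫ ω, |stochHess g j xs (ζ j ω) a b| ∂P) (fun k j => ?_)
    (fun j => (hδ j).2.comp (tendsto_add_atTop_nat 1))
    (fun j => h.tendstoInMeasure_average (hφ j) (hint j) 1) i
  · simp only [hessEst, Matrix.add_apply, Matrix.smul_apply, Matrix.sum_apply, smul_eq_mul,
      hessIter, iterX, one_div, mul_inv]
    ring
  · exact (h.identDistrib_comp (hφ j) (k + 1)).symm.integrable_snd (hint j)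
  · exact (h.identDistrib_comp (hφ j).abs (k + 1)).integral_eq.le

theorem tendsto_integral_sq_iterG_coord (hobj : ObjectiveAssumption P g ζ Lip xs)
    (h : SamplingModel P ζ ζs x0) (hx0 : MemLp (fun ω i => x0 i ω) 2 P)
    (hX : Tendsto (fun k => ∫ ω, ‖iterX A B g step x0 ζs k ω - fun _ => xs‖ ^ 2 ∂P) atTop (𝓝 0))
    (i : Fin n) (a : Fin d) :
    (∀ k, MemLp (fun ω => iterG A B g step x0 ζs k ω i a - stochGrad g i xs (ζs k i ω) a) 2 P) ∧
    Tendsto (fun k => ∫ ω, (iterG A B g step x0 ζs k ω i a - stochGrad g i xs (ζs k i ω) a) ^ 2 ∂P)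
      atTop (𝓝 0) := by
  obtain ⟨h1, h2⟩ := tendsto_integral_sq_iterG hobj h hx0 hX i
  have h3 : ∀ k, MemLp
      (fun ω => iterG A B g step x0 ζs k ω i a - stochGrad g i xs (ζs k i ω) a) 2 P := fun k =>
    (h1 k).of_le ((PiLp.continuous_apply 2 (fun _ : Fin d => ℝ) a).comp_aestronglyMeasurable
      (h1 k).aestronglyMeasurable) (ae_of_all _ fun ω => abs_coord_le
        (iterG A B g step x0 ζs k ω i - stochGrad g i xs (ζs k i ω)) a)
  refine ⟨h3, squeeze_zero (fun k => integral_nonneg fun ω => sq_nonneg _) (fun k => ?_) h2⟩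
  refine integral_mono (h3 k).integrable_sq (h1 k).integrable_sq_norm fun ω => ?_
  dsimp only
  rw [← sq_abs]
  gcongr
  exact abs_coord_le (iterG A B g step x0 ζs k ω i - stochGrad g i xs (ζs k i ω)) a

/-- With current gradient `G` and previous gradient `G'`, entry `(a, b)` of the symmetrized
increment is `G_a G_b - G_a G'_b / 2 - G_b G'_a / 2`. Near `xs` the first product averages to a
second moment; the lagged ones average to products of means, since consecutive samples are
independent. Each agent thereby estimates its own covariance although its mean gradient at `xs` need
not vanish, and the covariances add up by `hsep`. -/
theorem tendstoInMeasure_covEst_entry (hobj : ObjectiveAssumption P g ζ Lip xs)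
    (h : SamplingModel P ζ ζs x0) (hweight : WeightAssumption A B)
    (hconn : IsStronglyConnected (inducedGraph A))
    (hsep : gradCov P g ζ xs = ∑ j, covMatrix P fun ω => stochGrad g j xs (ζ j ω))
    (hw0 : ∀ i, 0 ≤ w i) (hw1 : ∑ i, w i = 1) (hw : w ᵥ* A = w)
    (hx0 : MemLp (fun ω i => x0 i ω) 2 P)
    (hX : Tendsto (fun k => ∫ ω, ‖iterX A B g step x0 ζs k ω - fun _ => xs‖ ^ 2 ∂P) atTop (𝓝 0))
    (i : Fin n) (a b : Fin d) :
    TendstoInMeasure P (fun k ω =>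
      covEst A B g step (fun j => x0 j ω) (fun t j => ζs t j ω) k i a b) atTop
      (fun _ => gradCov P g ζ xs a b) := by
  have hφ : ∀ j c, Measurable fun z => stochGrad g j xs z c := fun j c =>
    (measurable_coord c).comp (measurable_stochGrad hobj j xs)
  have hL : ∀ j c, MemLp (fun ω => stochGrad g j xs (ζ j ω) c) 2 P := fun j c =>
    (memLp_stochGrad hobj h.measurable_zeta j xs).of_le
      ((hφ j c).comp (h.measurable_zeta j)).aestronglyMeasurable
      (ae_of_all _ fun ω => abs_coord_le _ c)
  have hLs : ∀ k j c, MemLp (fun ω => stochGrad g j xs (ζs k j ω) c) 2 P := fun k j c =>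
    (h.identDistrib_comp (hφ j c) k).symm.memLp_snd (hL j c)
  have hsq : ∀ k j c, ∫ ω, stochGrad g j xs (ζs k j ω) c ^ 2 ∂P =
      ∫ ω, stochGrad g j xs (ζ j ω) c ^ 2 ∂P := fun k j c =>
    (h.identDistrib_comp ((hφ j c).pow_const 2) k).integral_eq
  have hG := fun j c => tendsto_integral_sq_iterG_coord (A := A) (B := B) (step := step)
    hobj h hx0 hX j c
  have hG' : ∀ j c, Tendsto (fun k => ∫ ω, (iterG A B g step x0 ζs (k + 1) ω j c
      - stochGrad g j xs (ζs (k + 1) j ω) c) ^ 2 ∂P) atTop (𝓝 0) := fun j c =>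
    (hG j c).2.comp (tendsto_add_atTop_nat 1)
  have hnn : ∀ j c, 0 ≤ ∫ ω, stochGrad g j xs (ζ j ω) c ^ 2 ∂P := fun j c =>
    integral_nonneg fun ω => sq_nonneg _
  -- The sum of the two second moments bounds both coordinates at once, as required by
  -- `tendsto_integral_abs_mul_sub`.
  set q : Fin n → ℝ := fun j => ∫ ω, stochGrad g j xs (ζ j ω) a ^ 2 ∂P
    + ∫ ω, stochGrad g j xs (ζ j ω) b ^ 2 ∂P with hq
  have hqa : ∀ k j, ∫ ω, stochGrad g j xs (ζs k j ω) a ^ 2 ∂P ≤ q j := fun k j => by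
    rw [hsq]; linarith [hnn j b]
  have hqb : ∀ k j, ∫ ω, stochGrad g j xs (ζs k j ω) b ^ 2 ∂P ≤ q j := fun k j => by
    rw [hsq]; linarith [hnn j a]
  have hp1 := fun j => tendsto_integral_abs_mul_sub (fun k => hLs (k + 1) j a)
    (fun k => hLs (k + 1) j b) (fun k => (hG j a).1 (k + 1)) (fun k => (hG j b).1 (k + 1))
    (fun k => hqa (k + 1) j) (fun k => hqb (k + 1) j) (hG' j a) (hG' j b)
  have hp2 := fun j => tendsto_integral_abs_mul_sub (fun k => hLs (k + 1) j a)
    (fun k => hLs k j b) (fun k => (hG j a).1 (k + 1)) (hG j b).1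
    (fun k => hqa (k + 1) j) (fun k => hqb k j) (hG' j a) (hG j b).2
  have hp3 := fun j => tendsto_integral_abs_mul_sub (fun k => hLs (k + 1) j b)
    (fun k => hLs k j a) (fun k => (hG j b).1 (k + 1)) (hG j a).1
    (fun k => hqb (k + 1) j) (fun k => hqa k j) (hG' j b) (hG j a).2
  set H : ℕ → Ω → Fin n → ℝ := fun k ω j =>
    iterG A B g step x0 ζs (k + 1) ω j a * iterG A B g step x0 ζs (k + 1) ω j b
      + (-1 / 2 * (iterG A B g step x0 ζs (k + 1) ω j a * iterG A B g step x0 ζs k ω j b)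
      + -1 / 2 * (iterG A B g step x0 ζs (k + 1) ω j b * iterG A B g step x0 ζs k ω j a)) with hH
  set Hs : ℕ → Ω → Fin n → ℝ := fun k ω j =>
    stochGrad g j xs (ζs (k + 1) j ω) a * stochGrad g j xs (ζs (k + 1) j ω) b
      + (-1 / 2 * (stochGrad g j xs (ζs (k + 1) j ω) a * stochGrad g j xs (ζs k j ω) b)
      + -1 / 2 * (stochGrad g j xs (ζs (k + 1) j ω) b * stochGrad g j xs (ζs k j ω) a)) with hHs
  have hI : ∀ k l j c e, Integrable
      (fun ω => stochGrad g j xs (ζs k j ω) c * stochGrad g j xs (ζs l j ω) e) P :=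
    fun k l j c e => (hLs k j c).integrable_mul (hLs l j e)
  have hHsi : ∀ k j, Integrable (fun ω => Hs k ω j) P := fun k j =>
    (hI _ _ j a b).fun_add (((hI _ _ j a b).const_mul _).fun_add ((hI _ _ j b a).const_mul _))
  have hD : ∀ k ω j, H k ω j - Hs k ω j =
      (iterG A B g step x0 ζs (k + 1) ω j a * iterG A B g step x0 ζs (k + 1) ω j b
        - stochGrad g j xs (ζs (k + 1) j ω) a * stochGrad g j xs (ζs (k + 1) j ω) b)
      + (-1 / 2 * (iterG A B g step x0 ζs (k + 1) ω j a * iterG A B g step x0 ζs k ω j b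
        - stochGrad g j xs (ζs (k + 1) j ω) a * stochGrad g j xs (ζs k j ω) b)
      + -1 / 2 * (iterG A B g step x0 ζs (k + 1) ω j b * iterG A B g step x0 ζs k ω j a
        - stochGrad g j xs (ζs (k + 1) j ω) b * stochGrad g j xs (ζs k j ω) a)) :=
    fun k ω j => by simp only [hH, hHs]; ring
  have hDi : ∀ k j, Integrable (fun ω => H k ω j - Hs k ω j) P := fun k j => by
    simp only [hD]
    exact ((hp1 j).1 k).fun_add
      ((((hp2 j).1 k).const_mul _).fun_add (((hp3 j).1 k).const_mul _))
  have hDt : ∀ j, Tendsto (fun k => ∫ ω, |H k ω j - Hs k ω j| ∂P) atTop (𝓝 0) := fun j => by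
    have hlim := (hp1 j).2.add ((hp2 j).2.add (hp3 j).2)
    simp only [add_zero] at hlim
    refine squeeze_zero (fun k => integral_nonneg fun ω => abs_nonneg _) (fun k => ?_) hlim
    rw [← integral_add ((hp2 j).1 k).abs ((hp3 j).1 k).abs,
      ← integral_add ((hp1 j).1 k).abs (((hp2 j).1 k).abs.fun_add ((hp3 j).1 k).abs)]
    refine integral_mono (hDi k j).abs
      (((hp1 j).1 k).abs.fun_add (((hp2 j).1 k).abs.fun_add ((hp3 j).1 k).abs)) fun ω => ?_
    dsimp only
    rw [hD]
    refine (abs_add_le _ _).trans (add_le_add_right ((abs_add_le _ _).trans ?_) _)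
    rw [abs_mul, abs_mul (-1 / 2)]
    have e : |(-1 / 2 : ℝ)| = 1 / 2 := by norm_num [abs_of_neg]
    rw [e]
    gcongr <;> exact (mul_le_of_le_one_left (abs_nonneg _) (by norm_num))
  have hlln : ∀ j, TendstoInMeasure P
      (fun (k : ℕ) ω => ((k : ℝ) + 1)⁻¹ * ∑ t ∈ Finset.range k, Hs t ω j) atTop
      (fun _ => covMatrix P (fun ω => stochGrad g j xs (ζ j ω)) a b) := fun j => by
    have l1 := h.tendstoInMeasure_average ((hφ j a).mul (hφ j b))
      ((hL j a).integrable_mul (hL j b)) 1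
    have l2 := (h.tendstoInMeasure_average_cross (hφ j a) (hφ j b) (hL j a) (hL j b)).const_mul
      (-1 / 2)
    have l3 := (h.tendstoInMeasure_average_cross (hφ j b) (hφ j a) (hL j b) (hL j a)).const_mul
      (-1 / 2)
    convert l1.add_const (l2.add_const l3) using 2 with k
    · ext ω
      simp only [hHs, Finset.sum_add_distrib, ← Finset.mul_sum, Pi.mul_apply]
      ring
    · rw [covMatrix, Matrix.of_apply, covariance_eq_sub (hL j a) (hL j b)]
      simp only [Pi.mul_apply]
      ring
  have hmain := tendstoInMeasure_distributed_average hweight.A_row_stochastic hw1 hw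
    (tendsto_pow_sub_entry hweight.A_nonneg hweight.A_row_stochastic hweight.A_diag_pos
      (hconn i) hw0 hw1 hw) (ρ := fun k j => (eigIter A (k + 1) j j)⁻¹)
    (tendsto_mul_inv_eigIter hweight.A_nonneg hweight.A_row_stochastic hweight.A_diag_pos hconn
      hw0 hw1 hw)
    (fun j => (stationary_pos hweight.A_nonneg hweight.A_diag_pos hconn hw0 hw1 hw j).ne')
    (est := fun k ω j => covEst A B g step (fun j => x0 j ω) (fun t j => ζs t j ω) k j a b)
    (h := H) (hs := Hs) (fun ω => rfl) (fun k ω j => ?_) hHsi hDi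
    (C := fun j => 2 * q j) (fun k j => ?_) hDt hlln i
  · rw [hsep, Matrix.sum_apply]
    exact hmain
  · simp only [covEst, Matrix.add_apply, Matrix.smul_apply, Matrix.sum_apply, smul_eq_mul,
      outerProd, Matrix.of_apply, PiLp.sub_apply, hH, iterG, one_div, mul_inv]
    ring
  · have hb : Integrable (fun ω => (stochGrad g j xs (ζs (k + 1) j ω) a ^ 2
        + stochGrad g j xs (ζs (k + 1) j ω) b ^ 2) + (stochGrad g j xs (ζs k j ω) a ^ 2
        + stochGrad g j xs (ζs k j ω) b ^ 2)) P :=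
      ((hLs _ j a).integrable_sq.fun_add (hLs _ j b).integrable_sq).fun_add
        ((hLs _ j a).integrable_sq.fun_add (hLs _ j b).integrable_sq)
    refine (integral_mono (hHsi k j).abs hb fun ω => ?_).trans (le_of_eq ?_)
    · simp only [hHs]
      generalize stochGrad g j xs (ζs (k + 1) j ω) a = p
      generalize stochGrad g j xs (ζs (k + 1) j ω) b = r
      generalize stochGrad g j xs (ζs k j ω) a = p'
      generalize stochGrad g j xs (ζs k j ω) b = r'
      rw [abs_le]
      constructor <;>
        nlinarith [sq_nonneg (p - r), sq_nonneg (p + r), sq_nonneg (p - r'), sq_nonneg (p + r'),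
          sq_nonneg (r - p'), sq_nonneg (r + p')]
    · rw [integral_add ((hLs _ j a).integrable_sq.fun_add (hLs _ j b).integrable_sq)
        ((hLs _ j a).integrable_sq.fun_add (hLs _ j b).integrable_sq),
        integral_add (hLs _ j a).integrable_sq (hLs _ j b).integrable_sq,
        integral_add (hLs _ j a).integrable_sq (hLs _ j b).integrable_sq, hsq, hsq, hsq, hsq]
      simp only [hq]
      ring

end Estimators

/-! ### Entrywise convergence of matrices and continuity of the sandwich map -/

section Matrices

variable {Ω : Type*} [MeasurableSpace Ω] {P : Measure Ω} {d : ℕ}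

theorem tendstoInMeasure_matrix {f : ℕ → Ω → Matrix (Fin d) (Fin d) ℝ}
    {M : Matrix (Fin d) (Fin d) ℝ}
    (h : ∀ a b, TendstoInMeasure P (fun k ω => f k ω a b) atTop (fun _ => M a b)) :
    TendstoInMeasure P f atTop (fun _ => M) := by
  have h1 : TendstoInMeasure P (fun k ω a b => f k ω a b) atTop (fun _ a b => M a b) :=
    TendstoInMeasure.pi fun a => TendstoInMeasure.pi fun b => h a b
  have hc : Continuous fun x : Fin d → Fin d → ℝ => (Matrix.of x : Matrix (Fin d) (Fin d) ℝ) :=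
    continuous_matrix fun a b => (continuous_apply b).comp (continuous_apply a)
  exact h1.continuousAt_comp hc.continuousAt

theorem continuousAt_sandwich {H S : Matrix (Fin d) (Fin d) ℝ} (hH : IsUnit H) :
    ContinuousAt (fun p : Matrix (Fin d) (Fin d) ℝ × Matrix (Fin d) (Fin d) ℝ =>
      p.1⁻¹ * p.2 * p.1⁻¹) (H, S) := by
  have hinv : ContinuousAt (fun M : Matrix (Fin d) (Fin d) ℝ => M⁻¹) H := by
    obtain ⟨U, rfl⟩ := hH
    have : (fun M : Matrix (Fin d) (Fin d) ℝ => M⁻¹) = Ring.inverse :=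
      funext Matrix.nonsing_inv_eq_ringInverse
    rw [this]
    exact NormedRing.inverse_continuousAt U
  have h1 : ContinuousAt (fun p : Matrix (Fin d) (Fin d) ℝ × Matrix (Fin d) (Fin d) ℝ => p.1⁻¹)
      (H, S) := hinv.comp (x := (H, S)) continuousAt_fst
  exact (h1.mul continuousAt_snd).mul h1

end Matrices

/-! ### Truncation of the initial values -/

section Truncation

variable {Ω : Type*} [MeasurableSpace Ω] {P : Measure Ω} {n d : ℕ} {Z : Fin n → Type*}
  [∀ i, MeasurableSpace (Z i)] {ζ : ∀ i, Ω → Z i} {ζs : ℕ → ∀ i, Ω → Z i}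
  {x0 : Fin n → Ω → EuclideanSpace ℝ (Fin d)}

/-- The point `x` if its norm is at most `R`, and zero otherwise. -/
noncomputable def truncate (R : ℝ) (x : EuclideanSpace ℝ (Fin d)) : EuclideanSpace ℝ (Fin d) :=
  if ‖x‖ ≤ R then x else 0

theorem measurable_truncate (R : ℝ) :
    Measurable (truncate R : EuclideanSpace ℝ (Fin d) → EuclideanSpace ℝ (Fin d)) :=
  Measurable.ite (measurableSet_le measurable_norm measurable_const) measurable_id measurable_const

theorem norm_truncate_le {R : ℝ} (hR : 0 ≤ R) (x : EuclideanSpace ℝ (Fin d)) :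
    ‖truncate R x‖ ≤ R := by
  rw [truncate]
  split_ifs with h
  · exact h
  · simpa using hR

theorem SamplingModel.truncate (h : SamplingModel P ζ ζs x0) (R : ℝ) :
    SamplingModel P ζ ζs fun i ω => truncate R (x0 i ω) where
  measurable_zeta := h.measurable_zeta
  measurable_sample := h.measurable_sample
  measurable_init i := (measurable_truncate R).comp (h.measurable_init i)
  identDistrib := h.identDistrib
  indep_time := h.indep_time
  indep_init := h.indep_init.comp
    (φ := fun (x : Fin n → EuclideanSpace ℝ (Fin d)) i => _root_.truncate R (x i))
    (measurable_pi_lambda _ fun i => (measurable_truncate R).comp (measurable_pi_apply i))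
    measurable_id

variable [IsProbabilityMeasure P]

theorem SamplingModel.memLp_truncate (h : SamplingModel P ζ ζs x0) {R : ℝ} (hR : 0 ≤ R) :
    MemLp (fun ω i => _root_.truncate R (x0 i ω)) 2 P :=
  MemLp.of_bound (measurable_pi_lambda _ (h.truncate R).measurable_init).aestronglyMeasurable R
    (ae_of_all _ fun _ => (pi_norm_le_iff_of_nonneg hR).2 fun _ => norm_truncate_le hR _)

/-- The initial values are finite at every `ω`, so the decreasing tail events have empty
intersection, and continuity from above applies. -/
theorem SamplingModel.tendsto_measure_large_init (h : SamplingModel P ζ ζs x0) :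
    Tendsto (fun R : ℕ => P {ω | ∃ i, (R : ℝ) < ‖x0 i ω‖}) atTop (𝓝 0) := by
  have hanti : Antitone fun R : ℕ => {ω | ∃ i, (R : ℝ) < ‖x0 i ω‖} := fun R R' hRR' ω hω => by
    obtain ⟨i, hi⟩ := hω
    exact ⟨i, lt_of_le_of_lt (by exact_mod_cast hRR') hi⟩
  have hmeas : ∀ R : ℕ, NullMeasurableSet {ω | ∃ i, (R : ℝ) < ‖x0 i ω‖} P := fun R => by
    have : {ω | ∃ i, (R : ℝ) < ‖x0 i ω‖} = ⋃ i, {ω | (R : ℝ) < ‖x0 i ω‖} := by ext; simp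
    rw [this]
    exact (MeasurableSet.iUnion fun i =>
      measurableSet_lt measurable_const (h.measurable_init i).norm).nullMeasurableSet
  have hempty : ⋂ R : ℕ, {ω | ∃ i, (R : ℝ) < ‖x0 i ω‖} = ∅ := by
    refine Set.eq_empty_iff_forall_notMem.2 fun ω hω => ?_
    obtain ⟨R, hR⟩ := exists_nat_gt (∑ i, ‖x0 i ω‖)
    obtain ⟨i, hi⟩ := Set.mem_iInter.1 hω R
    have := Finset.single_le_sum (f := fun i => ‖x0 i ω‖) (fun i _ => norm_nonneg _)
      (Finset.mem_univ i)
    linarith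
  have := tendsto_measure_iInter_atTop hmeas hanti ⟨0, measure_ne_top P _⟩
  rwa [hempty, measure_empty] at this

end Truncation

/-! ### Consistency of the plug-in estimators -/

theorem theorem3 {Ω : Type*} [MeasurableSpace Ω] (P : Measure Ω) [IsProbabilityMeasure P]
    {n d : ℕ} {Z : Fin n → Type*} [∀ i, MeasurableSpace (Z i)]
    (g : ∀ i, EuclideanSpace ℝ (Fin d) → Z i → ℝ) (Lip : ∀ i, Z i → ℝ)
    (ζ : ∀ i, Ω → Z i) (ζs : ℕ → ∀ i, Ω → Z i)
    (x0 : Fin n → Ω → EuclideanSpace ℝ (Fin d)) (xs : EuclideanSpace ℝ (Fin d))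
    (A B : Matrix (Fin n) (Fin n) ℝ) (u v : Fin n → ℝ) (a b α : ℝ) (step : ℕ → ℝ)
    -- the objective, the samples and the weight matrices
    (hobj : ObjectiveAssumption P g ζ Lip xs)
    (hsample : SamplingModel P ζ ζs x0)
    (hweight : WeightAssumption A B)
    -- the normalized nonnegative left eigenvector of `A` and right eigenvector of `B`
    (hu_nonneg : ∀ i, 0 ≤ u i) (hu_eig : u ᵥ* A = u) (hu_sum : ∑ i, u i = n)
    (hv_nonneg : ∀ i, 0 ≤ v i) (hv_eig : B *ᵥ v = v) (hv_sum : ∑ i, v i = n)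
    -- the step sizes
    (ha : 0 < a) (hb : 0 < b) (hα : 1 / 2 < α) (hα' : α < 1)
    (hab : a / b ^ α ≤ min 1 (n / ((u ⬝ᵥ v) * lipConst P Lip ζ)))
    (hstep : ∀ k : ℕ, step k = a / ((k : ℝ) + b) ^ α)
    -- strong connectivity, separable covariance, stochastic Hessians
    (hconn : IsStronglyConnected (inducedGraph A))
    (hsep : gradCov P g ζ xs = ∑ j, covMatrix P fun ω => stochGrad g j xs (ζ j ω))
    (hhess : HessianAssumption P g ζ xs) :
    -- the inverses in the claim make sense
    IsUnit (hessian (globalCost P g ζ) xs) ∧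
    ∀ i : Fin n,
      Tendsto (fun k => P {ω | IsUnit
        (hessEst A B g step (fun j => x0 j ω) (fun t j => ζs t j ω) k i)}) atTop (𝓝 1) ∧
      TendstoInMeasure P
        (fun k ω =>
          (hessEst A B g step (fun j => x0 j ω) (fun t j => ζs t j ω) k i)⁻¹
            * covEst A B g step (fun j => x0 j ω) (fun t j => ζs t j ω) k i
            * (hessEst A B g step (fun j => x0 j ω) (fun t j => ζs t j ω) k i)⁻¹)
        atTop
        (fun _ => (hessian (globalCost P g ζ) xs)⁻¹ * gradCov P g ζ xs
          * (hessian (globalCost P g ζ) xs)⁻¹) := by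
  have hunit := isUnit_hessian_globalCost hobj
  refine ⟨hunit, fun i => ?_⟩
  -- The agent `i` witnesses `n > 0`, so both eigenvectors can be rescaled to probability vectors.
  have hn : (n : ℝ) ≠ 0 := by
    have := i.pos
    positivity
  have hw0 : ∀ j, 0 ≤ ((n : ℝ)⁻¹ • u) j := fun j => mul_nonneg (by positivity) (hu_nonneg j)
  have hw1 : ∑ j, ((n : ℝ)⁻¹ • u) j = 1 := by
    simp [← Finset.mul_sum, hu_sum, inv_mul_cancel₀ hn]
  have hw : ((n : ℝ)⁻¹ • u) ᵥ* A = (n : ℝ)⁻¹ • u := by rw [Matrix.smul_vecMul, hu_eig]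
  have hv0 : ∀ j, 0 ≤ ((n : ℝ)⁻¹ • v) j := fun j => mul_nonneg (by positivity) (hv_nonneg j)
  have hv1 : ∑ j, ((n : ℝ)⁻¹ • v) j = 1 := by
    simp [← Finset.mul_sum, hv_sum, inv_mul_cancel₀ hn]
  have hv : B *ᵥ ((n : ℝ)⁻¹ • v) = (n : ℝ)⁻¹ • v := by rw [Matrix.mulVec_smul, hv_eig]
  have hsteps := stepCondition_rpow ha hb (by linarith) hα'.le hstep
  have hX := fun R : ℕ => tendsto_integral_sq_iterX hobj (hsample.truncate R) hweight hconn hsteps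
    hw0 hw1 hw hv0 hv1 hv (hsample.memLp_truncate R.cast_nonneg)
  -- Off the tail event the truncated and the original initial values coincide, and therefore the
  -- estimators coincide at all times `k` simultaneously.
  have heq : ∀ (R : ℕ) ω, ω ∉ {ω | ∃ i, (R : ℝ) < ‖x0 i ω‖} →
      (fun j => truncate R (x0 j ω)) = fun j => x0 j ω := fun R ω hω => by
    funext j
    exact if_pos (not_lt.1 fun hlt => hω ⟨j, hlt⟩)
  have hH : TendstoInMeasure P
      (fun k ω => hessEst A B g step (fun j => x0 j ω) (fun t j => ζs t j ω) k i) atTop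
      (fun _ => hessian (globalCost P g ζ) xs) :=
    tendstoInMeasure_of_approx (f' := fun (R k : ℕ) ω =>
        hessEst A B g step (fun j => truncate R (x0 j ω)) (fun t j => ζs t j ω) k i)
      hsample.tendsto_measure_large_init (fun R k ω hω => by rw [heq R ω hω])
      fun R => tendstoInMeasure_matrix fun a b =>
        tendstoInMeasure_hessEst_entry hobj hhess (hsample.truncate R) hweight hconn hw0 hw1 hw
          (hsample.memLp_truncate R.cast_nonneg) (hX R) i a b
  have hS : TendstoInMeasure P
      (fun k ω => covEst A B g step (fun j => x0 j ω) (fun t j => ζs t j ω) k i) atTop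
      (fun _ => gradCov P g ζ xs) :=
    tendstoInMeasure_of_approx (f' := fun (R k : ℕ) ω =>
        covEst A B g step (fun j => truncate R (x0 j ω)) (fun t j => ζs t j ω) k i)
      hsample.tendsto_measure_large_init (fun R k ω hω => by rw [heq R ω hω])
      fun R => tendstoInMeasure_matrix fun a b =>
        tendstoInMeasure_covEst_entry hobj (hsample.truncate R) hweight hconn hsep hw0 hw1 hw
          (hsample.memLp_truncate R.cast_nonneg) (hX R) i a b
  refine ⟨?_, (hH.prodMk_const hS).continuousAt_comp (continuousAt_sandwich hunit)⟩
  -- Invertible matrices form an open set containing the limit, so the estimators lie in it with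
  -- probability tending to one.
  exact tendsto_measure_mem_of_tendstoInMeasure hH (Units.isOpen.mem_nhds hunit)
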